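/- Let $n\ge 2$. For $\epsilon\in\{1,-1\}^n$ put $H_{\epsilon,\mathbb R}=\{x\in\mathbb R^n:\epsilon_1x_1+\dots+\epsilon_nx_n=1\}$, and put $L_i=\{x\in\mathbb R^n: x_i=0\}$ for $1\le i\le n$. Let $\mathcal H$ be the arrangement of all $H_{\epsilon,\mathbb R}$ and $L_i$. A linear subset of $\mathcal H$ is a nonempty intersection of finitely many of its hyperplanes ($\mathbb R^n$ included), and an $i$-chamber is a connected component of the complement, in an $i$-dimensional linear subset, of its proper linear subsets. Let $X_2$ be the $2$-skeleton of the Salvetti complex of $\mathcal H$. It is the following cell complex. Its $0$-cells are the $n$-chambers. For each $n$-chamber $\sigma$ and each $(n-1)$-chamber $\tau\subset\overline\sigma$ there is a $1$-cell (arrow) $\widetilde D_{\sigma,\tau}$ from $\sigma$ to the other $n$-chamber $\rho_\tau(\sigma)$ whose closure contains $\tau$. For each $n$-chamber $\sigma$ and each $(n-2)$-chamber $\tau\subset\overline\sigma$ there is a $2$-cell $\widetilde D_{\sigma,\tau}$ whose boundary is attached along the two shortest oriented paths from $\sigma$ to the $n$-chamber opposite to $\sigma$ with respect to $\tau$ (the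 one with $\tau$ in its closure that is separated from $\sigma$ by every hyperplane of $\mathcal H$ containing $\tau$). The group $\mu_2^n=\{1,-1\}^n$ acts on $\mathbb R^n$ by coordinatewise multiplication, hence on $X_2$; let $\overline{X_2}=X_2/\mu_2^n$ with the quotient topology. The height $h(\sigma)$ of an $n$-chamber $\sigma$ is the number of hyperplanes $H_{\epsilon,\mathbb R}$ separating it from $0$. The spanning complex $\mathcal S\subset\overline{X_2}$ is the union of the images of the following closed cells $\widetilde D_{\sigma,\tau}$ with $\sigma,\tau\subset\mathbb R^n_{\ge0}$: the $1$-cells for which $\tau$ lies in some $H_{\epsilon,\mathbb R}$ and $h(\rho_\tau(\sigma))=h(\sigma)+1$; and the $2$-cells for which $\tau\subset H_{\epsilon,\mathbb R}\cap H_{\epsilon',\mathbb R}$ for some $\epsilon,\epsilon'$ that differ in at least two entries and $h(\sigma)$ is the smallest height of an $n$-chamber with $\tau$ in its closure. Let $\overline{X_2}^{(s)}$ be the space obtained from $\overline{X_2}$ by collapsing $\mathcal S$ to a point $s$. Put $\sigma_0=\{x: x_j>0\ (1\le j\le n),\ \sum_j x_j<1\}$, $\tau_0=\{x: x_j>0\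 (1\le j\le n),\ \sum_j x_j=1\}$ and $\tau_i=\{x: x_i=0,\ x_j>0\ (j\ne i),\ \sum_j x_j<1\}$ for $1\le i\le n$. Let $\gamma_0,\gamma_1,\dots,\gamma_n\in\pi_1(\overline{X_2}^{(s)},s)$ be the classes of the loops given by the arrow $\widetilde D_{\rho_{\tau_0}(\sigma_0),\tau_0}$ (from $\rho_{\tau_0}(\sigma_0)$ to $\sigma_0$) and by the arrows $\widetilde D_{\sigma_0,\tau_i}$ $(1\le i\le n)$. Write products of loops in the order in which they are traversed, and put $m_\epsilon=\prod_{i:\,\epsilon_i=-1}\gamma_i$, the product in increasing order of $i$. Then $\pi_1(\overline{X_2}^{(s)},s)$ is presented by the generators $\gamma_0,\gamma_1,\dots,\gamma_n$ and the relations $$[\gamma_i,\gamma_j]=1\quad(1\le i,j\le n),\qquad (\gamma_0\gamma_i)^2=(\gamma_i\gamma_0)^2\quad(1\le i\le n),$$ $$[m_\epsilon^{-1}\gamma_0m_\epsilon,\ m_{\epsilon'}^{-1}\gamma_0m_{\epsilon'}]=1\quad\text{for all }\epsilon,\epsilon'\in\{1,-1\}^n\text{ with }H_{\epsilon,\mathbb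 R}\cap H_{\epsilon',\mathbb R}\cap\mathbb R^n_{>0}\ne\emptyset.$$ -/

import Mathlib

open scoped Pointwise

noncomputable section

/-! ## Chambers of a real hyperplane arrangement -/

namespace Salvetti

variable {n : ℕ}

/-- A linear subset of the arrangement `A` in `ℝⁿ`: a nonempty intersection of finitely many
hyperplanes of `A` (the empty intersection is `ℝⁿ`). -/
def IsFlat (A : Set (Set (Fin n → ℝ))) (L : Set (Fin n → ℝ)) : Prop :=
  L.Nonempty ∧ ∃ S : Set (Set (Fin n → ℝ)), S ⊆ A ∧ S.Finite ∧ L = ⋂₀ S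

/-- The complement in `L` of the union of the proper linear subsets of `L`. -/
def stratum (A : Set (Set (Fin n → ℝ))) (L : Set (Fin n → ℝ)) : Set (Fin n → ℝ) :=
  L \ ⋃₀ {L' | IsFlat A L' ∧ L' ⊂ L}

/-- `C` is an `(n - c)`-chamber of `A`: a connected component of the stratum of a linear subset
of codimension `c`. -/
def IsChamber (A : Set (Set (Fin n → ℝ))) (c : ℕ) (C : Set (Fin n → ℝ)) : Prop :=
  ∃ L, IsFlat A L ∧ Module.finrank ℝ (vectorSpan ℝ L) + c = n ∧
    ∃ x ∈ stratum A L, C = connectedComponentIn (stratum A L) x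

/-- The set of `(n - c)`-chambers. -/
def Ch (A : Set (Set (Fin n → ℝ))) (c : ℕ) : Type :=
  {C : Set (Fin n → ℝ) // IsChamber A c C}

/-- `H` separates `P` from `Q`: every segment from a point of `P` to a point of `Q` meets `H`. -/
def Separates (H P Q : Set (Fin n → ℝ)) : Prop :=
  ∀ x ∈ P, ∀ y ∈ Q, (segment ℝ x y ∩ H).Nonempty

/-! ## The Salvetti 2-complex -/

/-- The arrow (oriented 1-cell) attached to an `n`-chamber `src` and an `(n-1)`-chamber `wall`
in its closure; `tgt` is the other `n`-chamber whose closure contains `wall`. -/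
@[ext] structure Arrow (A : Set (Set (Fin n → ℝ))) where
  src : Ch A 0
  wall : Ch A 1
  tgt : Ch A 0
  ne : src ≠ tgt
  src_wall : wall.1 ⊆ closure src.1
  tgt_wall : wall.1 ⊆ closure tgt.1

/-- `p` is an oriented path (a list of composable arrows) from `u` to `v`. -/
def IsPath {A : Set (Set (Fin n → ℝ))} (u : Ch A 0) : List (Arrow A) → Ch A 0 → Prop
  | [], v => u = v
  | e :: p, v => e.src = u ∧ IsPath e.tgt p v

/-- `p` is an oriented path from `u` to `v` with the least possible number of arrows. -/
def IsShortestPath {A : Set (Set (Fin n → ℝ))} (u : Ch A 0) (p : List (Arrow A)) (v : Ch A 0) :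
    Prop :=
  IsPath u p v ∧ ∀ q, IsPath u q v → p.length ≤ q.length

/-- The 2-cell attached to an `n`-chamber `src` and an `(n-2)`-chamber `face` in its closure.
`tgt` is the `n`-chamber on the opposite side of `src` with respect to `face`, and `lower`, `upper`
are the two shortest paths from `src` to `tgt`. Since there is no canonical order on the two paths,
each 2-cell is recorded twice, once for each order; the two copies are identified below. -/
@[ext] structure Disc (A : Set (Set (Fin n → ℝ))) where
  src : Ch A 0
  face : Ch A 2
  tgt : Ch A 0
  src_face : face.1 ⊆ closure src.1
  tgt_face : face.1 ⊆ closure tgt.1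
  opposite : ∀ H ∈ A, face.1 ⊆ H → Separates H src.1 tgt.1
  lower : List (Arrow A)
  upper : List (Arrow A)
  lower_shortest : IsShortestPath src lower tgt
  upper_shortest : IsShortestPath src upper tgt
  lower_ne_upper : lower ≠ upper

/-- The same 2-cell with the opposite order of its two boundary paths. -/
def Disc.swap {A : Set (Set (Fin n → ℝ))} (F : Disc A) : Disc A where
  src := F.src
  face := F.face
  tgt := F.tgt
  src_face := F.src_face
  tgt_face := F.tgt_face
  opposite := F.opposite
  lower := F.upper
  upper := F.lower
  lower_shortest := F.upper_shortest
  upper_shortest := F.lower_shortest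
  lower_ne_upper := F.lower_ne_upper.symm

/-- The closed unit disc. -/
abbrev D2 : Type := Metric.closedBall (0 : ℂ) 1

/-- Complex conjugation on the closed unit disc. -/
def D2.conj (z : D2) : D2 :=
  ⟨(starRingEnd ℂ) z.1, by
    have h : ‖z.1‖ ≤ 1 := mem_closedBall_zero_iff.1 z.2
    exact mem_closedBall_zero_iff.2 (by rwa [RCLike.norm_conj])⟩

/-- The disjoint union of the closed cells: a point for each `n`-chamber, a unit interval for each
arrow, a closed unit disc for each 2-cell (with an order of its boundary paths). -/
abbrev Cells (A : Set (Set (Fin n → ℝ))) : Type :=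
  (Σ _ : Ch A 0, Unit) ⊕ (Σ _ : Arrow A, unitInterval) ⊕ (Σ _ : Disc A, D2)

/-- The 0-cell of `u`. -/
abbrev vertexPt {A : Set (Set (Fin n → ℝ))} (u : Ch A 0) : Cells A := Sum.inl ⟨u, ()⟩

/-- The point with parameter `t` of the closed 1-cell of `e`. -/
abbrev arrowPt {A : Set (Set (Fin n → ℝ))} (e : Arrow A) (t : unitInterval) : Cells A :=
  Sum.inr (Sum.inl ⟨e, t⟩)

/-- The point `z` of the closed 2-cell of `F`. -/
abbrev discPt {A : Set (Set (Fin n → ℝ))} (F : Disc A) (z : D2) : Cells A :=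
  Sum.inr (Sum.inr ⟨F, z⟩)

/-- The attaching maps. The interval of an arrow runs from its source to its target. The lower
(upper) half circle of a disc, parametrised from `-1` to `1` by `(Re z + 1) / 2 ∈ [0, 1]`, runs
through the arrows of the path `lower` (`upper`), each with the same amount of time. -/
inductive Glue {A : Set (Set (Fin n → ℝ))} : Cells A → Cells A → Prop
  | src (e : Arrow A) : Glue (arrowPt e 0) (vertexPt e.src)
  | tgt (e : Arrow A) : Glue (arrowPt e 1) (vertexPt e.tgt)
  | lower (F : Disc A) (z : D2) (hz : ‖z.1‖ = 1) (him : z.1.im ≤ 0)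
      (k : Fin F.lower.length) (t : unitInterval)
      (ht : (z.1.re + 1) / 2 * F.lower.length = k + t) :
      Glue (discPt F z) (arrowPt (F.lower.get k) t)
  | upper (F : Disc A) (z : D2) (hz : ‖z.1‖ = 1) (him : 0 ≤ z.1.im)
      (k : Fin F.upper.length) (t : unitInterval)
      (ht : (z.1.re + 1) / 2 * F.upper.length = k + t) :
      Glue (discPt F z) (arrowPt (F.upper.get k) t)
  | swap (F : Disc A) (z : D2) : Glue (discPt F z) (discPt F.swap z.conj)

/-- The 2-skeleton `X₂` of the Salvetti complex of `A`. -/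
def X2 (A : Set (Set (Fin n → ℝ))) : Type := Quot (Glue (A := A))

instance (A : Set (Set (Fin n → ℝ))) : TopologicalSpace (X2 A) :=
  inferInstanceAs (TopologicalSpace (Quot _))

end Salvetti

/-! ## The `F_C`-arrangement and the action of `μ₂ⁿ` -/

namespace FCArrangement

open Salvetti

variable {n : ℕ}

/-- The hyperplane `ε₁ x₁ + ⋯ + εₙ xₙ = 1` in `ℝⁿ`. -/
def H (ε : Fin n → ℤˣ) : Set (Fin n → ℝ) := {x | ∑ i, ((ε i : ℤ) : ℝ) * x i = 1}

/-- The coordinate hyperplane `xᵢ = 0` in `ℝⁿ`. -/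
def L (i : Fin n) : Set (Fin n → ℝ) := {x | x i = 0}

/-- The `n`-dimensional `F_C`-arrangement. -/
def FC (n : ℕ) : Set (Set (Fin n → ℝ)) := Set.range H ∪ Set.range L

/-- The group `μ₂ⁿ = {1, -1}ⁿ`; it acts on `ℝⁿ` coordinatewise (`smul_apply` below). -/
abbrev Mu (n : ℕ) : Type := Fin n → ℤˣ

lemma smul_apply (g : Mu n) (x : Fin n → ℝ) (i : Fin n) :
    (g • x) i = ((g i : ℤ) : ℝ) * x i := by
  simp [Units.smul_def]

instance : ContinuousConstSMul (Mu n) (Fin n → ℝ) where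
  continuous_const_smul g := by
    refine continuous_pi fun i => ?_
    simp only [smul_apply]
    fun_prop

/-- The action of `g` on `ℝⁿ` as a linear map. -/
def linMap (g : Mu n) : (Fin n → ℝ) →ₗ[ℝ] (Fin n → ℝ) where
  toFun x := g • x
  map_add' x y := by ext i; simp only [smul_apply, Pi.add_apply]; ring
  map_smul' c x := by
    ext i; simp only [smul_apply, Pi.smul_apply, smul_eq_mul, RingHom.id_apply]; ring

lemma linMap_injective (g : Mu n) : Function.Injective (linMap g) :=
  MulAction.injective (β := Fin n → ℝ) g

lemma smul_mem_FC (g : Mu n) {K : Set (Fin n → ℝ)} (hK : K ∈ FC n) : g • K ∈ FC n := by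
  have key (i : Fin n) : (((g⁻¹ : Mu n) i : ℤ) : ℝ) = ((g i : ℤ) : ℝ) := by
    rcases Int.units_eq_one_or (g i) with h | h <;> simp [h]
  rcases hK with ⟨ε, rfl⟩ | ⟨i, rfl⟩
  · refine Or.inl ⟨g * ε, ?_⟩
    ext x
    simp only [Set.mem_smul_set_iff_inv_smul_mem, H, Set.mem_ofPred_eq, smul_apply, key,
      Pi.mul_apply, Units.val_mul, Int.cast_mul]
    rw [Finset.sum_congr rfl fun i _ => ?_]
    ring
  · refine Or.inr ⟨i, ?_⟩
    ext x
    rw [Set.mem_smul_set_iff_inv_smul_mem]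
    change x i = 0 ↔ (g⁻¹ • x) i = 0
    rw [smul_apply, key]
    simp

lemma isFlat_smul (g : Mu n) {K : Set (Fin n → ℝ)} (hK : IsFlat (FC n) K) :
    IsFlat (FC n) (g • K) := by
  obtain ⟨hne, S, hS, hfin, rfl⟩ := hK
  refine ⟨hne.smul_set, g • S, ?_, hfin.smul_set, ?_⟩
  · rintro _ ⟨K, hK, rfl⟩
    exact smul_mem_FC g (hS hK)
  · ext x
    simp only [Set.mem_smul_set_iff_inv_smul_mem, Set.mem_sInter]
    constructor
    · intro h K hK
      have := h _ hK
      rwa [Set.mem_smul_set_iff_inv_smul_mem, inv_inv, smul_inv_smul] at this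
    · intro h K hK
      have := h (g • K) (by simpa using hK)
      rwa [Set.mem_smul_set_iff_inv_smul_mem] at this

lemma smul_stratum (g : Mu n) (K : Set (Fin n → ℝ)) :
    g • stratum (FC n) K = stratum (FC n) (g • K) := by
  have key (g : Mu n) (K : Set (Fin n → ℝ)) :
      g • stratum (FC n) K ⊆ stratum (FC n) (g • K) := by
    rintro _ ⟨x, ⟨hx, hx'⟩, rfl⟩
    refine ⟨Set.smul_mem_smul_set hx, ?_⟩
    rintro ⟨K', ⟨hK', hlt⟩, hxK'⟩
    refine hx' ⟨g⁻¹ • K', ⟨isFlat_smul _ hK', ?_⟩, ?_⟩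
    · rw [ssubset_iff_subset_not_subset] at hlt ⊢
      have h1 : g⁻¹ • K' ⊆ K ↔ K' ⊆ g • K := by
        rw [Set.smul_set_subset_iff_subset_inv_smul_set, inv_inv]
      have h2 : K ⊆ g⁻¹ • K' ↔ g • K ⊆ K' := by
        rw [Set.subset_smul_set_iff, inv_inv]
      rwa [h1, h2]
    · rwa [Set.mem_smul_set_iff_inv_smul_mem, inv_inv]
  refine (key g K).antisymm ?_
  have := key g⁻¹ (g • K)
  rwa [inv_smul_smul, Set.smul_set_subset_iff_subset_inv_smul_set, inv_inv] at this

lemma isChamber_smul (g : Mu n) {c : ℕ} {C : Set (Fin n → ℝ)} (hC : IsChamber (FC n) c C) :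
    IsChamber (FC n) c (g • C) := by
  obtain ⟨K, hK, hdim, x, hx, rfl⟩ := hC
  refine ⟨g • K, isFlat_smul g hK, ?_, g • x, ?_, ?_⟩
  · have h1 : vectorSpan ℝ (g • K) = (vectorSpan ℝ K).map (linMap g) :=
      ((linMap g).toAffineMap.map_vectorSpan (s := K)).symm
    rw [h1]
    refine Eq.trans (congrArg (· + c) ?_) hdim
    exact (Submodule.equivMapOfInjective _ (linMap_injective g) _).finrank_eq.symm
  · rw [← smul_stratum]
    exact Set.smul_mem_smul_set hx
  · rw [← smul_stratum]
    exact (Homeomorph.smul g).image_connectedComponentIn hx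

instance (c : ℕ) : MulAction (Mu n) (Ch (FC n) c) where
  smul g C := ⟨g • C.1, isChamber_smul g C.2⟩
  one_smul C := Subtype.ext (one_smul _ C.1)
  mul_smul g h C := Subtype.ext (mul_smul g h C.1)

lemma val_smul (g : Mu n) {c : ℕ} (C : Ch (FC n) c) : (g • C).1 = g • C.1 := rfl

lemma smul_subset_closure (g : Mu n) {P Q : Set (Fin n → ℝ)} (h : P ⊆ closure Q) :
    g • P ⊆ closure (g • Q) := by
  rintro _ ⟨x, hx, rfl⟩
  exact (Homeomorph.smul g).continuous.continuousOn.image_closure ⟨x, h hx, rfl⟩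

lemma separates_smul (g : Mu n) {K P Q : Set (Fin n → ℝ)} (h : Separates (g⁻¹ • K) P Q) :
    Separates K (g • P) (g • Q) := by
  rintro _ ⟨x, hx, rfl⟩ _ ⟨y, hy, rfl⟩
  obtain ⟨z, hz, hzK⟩ := h x hx y hy
  refine ⟨g • z, ?_, ?_⟩
  · have := Set.mem_image_of_mem (linMap g) hz
    rwa [← LinearMap.coe_toAffineMap, image_segment] at this
  · rwa [Set.mem_smul_set_iff_inv_smul_mem, inv_inv] at hzK

instance : MulAction (Mu n) (Arrow (FC n)) where
  smul g e :=
    { src := g • e.src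
      wall := g • e.wall
      tgt := g • e.tgt
      ne := fun h => e.ne (MulAction.injective g h)
      src_wall := smul_subset_closure g e.src_wall
      tgt_wall := smul_subset_closure g e.tgt_wall }
  one_smul e := Arrow.ext (one_smul _ e.src) (one_smul _ e.wall) (one_smul _ e.tgt)
  mul_smul g h e := Arrow.ext (mul_smul g h e.src) (mul_smul g h e.wall) (mul_smul g h e.tgt)

lemma isPath_smul (g : Mu n) {u v : Ch (FC n) 0} {p : List (Arrow (FC n))} (h : IsPath u p v) :
    IsPath (g • u) (p.map (g • ·)) (g • v) := by
  induction p generalizing u with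
  | nil => exact congrArg (g • ·) h
  | cons e p ih => exact ⟨congrArg (g • ·) h.1, ih h.2⟩

lemma isShortestPath_smul (g : Mu n) {u v : Ch (FC n) 0} {p : List (Arrow (FC n))}
    (h : IsShortestPath u p v) : IsShortestPath (g • u) (p.map (g • ·)) (g • v) := by
  refine ⟨isPath_smul g h.1, fun q hq => ?_⟩
  have := h.2 _ (by simpa using isPath_smul g⁻¹ hq)
  simpa using this

instance : MulAction (Mu n) (Disc (FC n)) where
  smul g F :=
    { src := g • F.src
      face := g • F.face
      tgt := g • F.tgt
      src_face := smul_subset_closure g F.src_face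
      tgt_face := smul_subset_closure g F.tgt_face
      opposite := fun K hK h => separates_smul g
        (F.opposite _ (smul_mem_FC g⁻¹ hK) (Set.smul_set_subset_iff_subset_inv_smul_set.1 h))
      lower := F.lower.map (g • ·)
      upper := F.upper.map (g • ·)
      lower_shortest := isShortestPath_smul g F.lower_shortest
      upper_shortest := isShortestPath_smul g F.upper_shortest
      lower_ne_upper := fun h =>
        F.lower_ne_upper (List.map_injective_iff.2 (MulAction.injective g) h) }
  one_smul F := Disc.ext (one_smul _ F.src) (one_smul _ F.face) (one_smul _ F.tgt)
    (by change F.lower.map _ = _; simp) (by change F.upper.map _ = _; simp)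
  mul_smul g h F := Disc.ext (mul_smul g h F.src) (mul_smul g h F.face) (mul_smul g h F.tgt)
    (by change F.lower.map _ = (F.lower.map _).map _; simp [mul_smul])
    (by change F.upper.map _ = (F.upper.map _).map _; simp [mul_smul])

/-- The cellular action of `μ₂ⁿ` on the disjoint union of the closed cells. -/
def smulCells (g : Mu n) : Cells (FC n) → Cells (FC n)
  | Sum.inl ⟨u, _⟩ => vertexPt (g • u)
  | Sum.inr (Sum.inl ⟨e, t⟩) => arrowPt (g • e) t
  | Sum.inr (Sum.inr ⟨F, z⟩) => discPt (g • F) z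

lemma glue_smul (g : Mu n) {a b : Cells (FC n)} (h : Glue a b) :
    Glue (smulCells g a) (smulCells g b) := by
  cases h with
  | src e => exact Glue.src (g • e)
  | tgt e => exact Glue.tgt (g • e)
  | lower F z hz him k t ht =>
    have hl : (g • F).lower.length = F.lower.length := List.length_map _
    have := Glue.lower (g • F) z hz him (k.cast hl.symm) t 
      (by simpa [hl] using ht)
    have he : (g • F).lower.get (k.cast hl.symm) = g • F.lower.get k := by
      change (F.lower.map (g • ·)).get _ = _
      simp
    rwa [he] at this
  | upper F z hz him k t ht =>
    have hl : (g • F).upper.length = F.upper.length := List.length_map _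
    have := Glue.upper (g • F) z hz him (k.cast hl.symm) t 
      (by simpa [hl] using ht)
    have he : (g • F).upper.get (k.cast hl.symm) = g • F.upper.get k := by
      change (F.upper.map (g • ·)).get _ = _
      simp
    rwa [he] at this
  | swap F z => exact Glue.swap (g • F) z

/-- The action of `μ₂ⁿ` on `X₂`. -/
instance : MulAction (Mu n) (X2 (FC n)) where
  smul g := Quot.map (smulCells g) fun _ _ => glue_smul g
  one_smul x := by
    induction x using Quot.ind with
    | mk a =>
      refine congrArg (Quot.mk _) ?_
      rcases a with ⟨u, _⟩ | ⟨e, t⟩ | ⟨F, z⟩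
      · simp [smulCells]
      · simp [smulCells]
      · simp [smulCells]
  mul_smul g h x := by
    induction x using Quot.ind with
    | mk a =>
      refine congrArg (Quot.mk _) ?_
      rcases a with ⟨u, _⟩ | ⟨e, t⟩ | ⟨F, z⟩
      · simp [smulCells, mul_smul]
      · simp [smulCells, mul_smul]
      · simp [smulCells, mul_smul]

/-- The quotient space of `X₂` by `μ₂ⁿ`, with the quotient topology. -/
def X2bar (n : ℕ) : Type := Quotient (MulAction.orbitRel (Mu n) (X2 (FC n)))

instance (n : ℕ) : TopologicalSpace (X2bar n) :=
  inferInstanceAs (TopologicalSpace (Quotient _))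

/-- The image in the quotient of a point of a closed cell of `X₂`. -/
def X2bar.mk (a : Cells (FC n)) : X2bar n :=
  Quotient.mk (MulAction.orbitRel (Mu n) (X2 (FC n))) (Quot.mk _ a)

/-! ## The spanning complex -/

/-- The closed positive orthant. -/
def orthant (n : ℕ) : Set (Fin n → ℝ) := {x | ∀ i, 0 ≤ x i}

/-- The height of a chamber: the number of hyperplanes `H ε` separating the origin from it. -/
def height (u : Ch (FC n) 0) : ℕ :=
  {K : Set (Fin n → ℝ) | (∃ ε, K = H ε) ∧ Separates K {0} u.1}.ncard

/-- Spanning 1-cells: they lie over the positive orthant, their wall is in some `H ε`, and they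
increase the height by one. -/
def IsSpanningArrow (e : Arrow (FC n)) : Prop :=
  e.src.1 ⊆ orthant n ∧ e.wall.1 ⊆ orthant n ∧ (∃ ε, e.wall.1 ⊆ H ε) ∧
    height e.src + 1 = height e.tgt

/-- Spanning 2-cells: they lie over the positive orthant, their `(n-2)`-chamber is in
`H ε ∩ H ε'` for some `ε`, `ε'` with at least two different entries (so that it is in no coordinate
hyperplane), and they start at the lowest of the `n`-chambers around it. -/
def IsSpanningDisc (F : Disc (FC n)) : Prop :=
  F.src.1 ⊆ orthant n ∧ F.face.1 ⊆ orthant n ∧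
    (∃ ε ε' : Fin n → ℤˣ, 2 ≤ {i | ε i ≠ ε' i}.ncard ∧ F.face.1 ⊆ H ε ∩ H ε') ∧
    ∀ u : Ch (FC n) 0, F.face.1 ⊆ closure u.1 → height F.src ≤ height u

/-- The spanning complex: the union of the closed spanning 1-cells and 2-cells. -/
def spanningComplex (n : ℕ) : Set (X2bar n) :=
  {x | (∃ e, IsSpanningArrow e ∧ ∃ t, x = X2bar.mk (arrowPt e t)) ∨
    ∃ F, IsSpanningDisc F ∧ ∃ z, x = X2bar.mk (discPt F z)}

/-- The relation that identifies all points of the spanning complex with one new point. -/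
inductive Collapse : X2bar n ⊕ Unit → X2bar n ⊕ Unit → Prop
  | mk (x : X2bar n) (hx : x ∈ spanningComplex n) : Collapse (Sum.inl x) (Sum.inr ())

/-- The space obtained from the quotient space by collapsing the spanning complex to a point. -/
def X2s (n : ℕ) : Type := Quot (Collapse (n := n))

instance (n : ℕ) : TopologicalSpace (X2s n) :=
  inferInstanceAs (TopologicalSpace (Quot _))

/-- The point `s` to which the spanning complex is collapsed. -/
def X2s.base (n : ℕ) : X2s n := Quot.mk _ (Sum.inr ())

/-- The image in the collapsed space of a point of a closed cell of `X₂`. -/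
def X2s.mk (a : Cells (FC n)) : X2s n := Quot.mk _ (Sum.inl (X2bar.mk a))

/-! ## The generators and the relations -/

/-- The chamber of all `x` with positive coordinates and `∑ xᵢ < 1`. -/
def sigma0 (n : ℕ) : Set (Fin n → ℝ) := {x | (∀ i, 0 < x i) ∧ ∑ i, x i < 1}

/-- The wall of `sigma0` in the hyperplane `∑ xᵢ = 1`. -/
def tau0 (n : ℕ) : Set (Fin n → ℝ) := {x | (∀ i, 0 < x i) ∧ ∑ i, x i = 1}

/-- The wall of `sigma0` in the coordinate hyperplane `xᵢ = 0`. -/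
def tau (i : Fin n) : Set (Fin n → ℝ) :=
  {x | (∀ j, j ≠ i → 0 < x j) ∧ x i = 0 ∧ ∑ j, x j < 1}

/-- `c` is the class of the loop at `s` that runs once through the 1-cell of `e`, in the direction
of the arrow. -/
def IsLoopClass (e : Arrow (FC n)) (c : FundamentalGroup (X2s n) (X2s.base n)) : Prop :=
  ∃ p : Path (X2s.base n) (X2s.base n),
    (∀ t, p t = X2s.mk (arrowPt e t)) ∧ c = FundamentalGroup.fromPath (Path.Homotopic.Quotient.mk p)

/-- `γ 0` is the class of the arrow into `sigma0` through `tau0`, and `γ i`, for `1 ≤ i ≤ n`, is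
the class of the arrow out of `sigma0` through the wall in the `i`-th coordinate hyperplane. -/
def IsStandard (γ : Fin (n + 1) → FundamentalGroup (X2s n) (X2s.base n)) : Prop :=
  (∃ e : Arrow (FC n), e.tgt.1 = sigma0 n ∧ e.wall.1 = tau0 n ∧ IsLoopClass e (γ 0)) ∧
  ∀ i : Fin n, ∃ e : Arrow (FC n), e.src.1 = sigma0 n ∧ e.wall.1 = tau i ∧ IsLoopClass e (γ i.succ)

/-- The word `m_ε`: the product, in increasing order, of the letters `i` with `ε i = -1`. -/
def word (ε : Fin n → ℤˣ) : FreeGroup (Fin (n + 1)) :=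
  (((List.finRange n).filter fun i => ε i = -1).map fun i => FreeGroup.of i.succ).prod

/-- The commutator of two words. -/
def comm (a b : FreeGroup (Fin (n + 1))) : FreeGroup (Fin (n + 1)) := a * b * a⁻¹ * b⁻¹

/-- The defining relators, in the free group on letters `0, …, n`. -/
inductive Rel (n : ℕ) : FreeGroup (Fin (n + 1)) → Prop
  | comm (i j : Fin n) : Rel n (comm (FreeGroup.of i.succ) (FreeGroup.of j.succ))
  | braid (i : Fin n) : Rel n ((FreeGroup.of 0 * FreeGroup.of i.succ) ^ 2 *
      ((FreeGroup.of i.succ * FreeGroup.of 0) ^ 2)⁻¹)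
  | conj (ε ε' : Fin n → ℤˣ) (h : (H ε ∩ H ε' ∩ {x | ∀ i, 0 < x i}).Nonempty) :
      Rel n (comm ((word ε)⁻¹ * FreeGroup.of 0 * word ε) ((word ε')⁻¹ * FreeGroup.of 0 * word ε'))

end FCArrangement

end

/-!
# The fundamental group of the collapsed quotient of the Salvetti complex

Every chamber is an end of a translate of a spanning arrow (`exists_isUp`), so all vertices are
collapsed, and the space is a 2-complex with one vertex (`realization`). Its fundamental group is
generated by the loops of the arrows, subject to the relations of the 2-cells; translates of an
arrow give the same loop, and translates of spanning arrows give trivial loops. This is proved in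
elementary terms, for a space described by a `Realization` of a `Shape`:

* the edge loops generate (`eq_top_of_loop_mem`), since each path is homotopic to a composition of
  paths within closed cells (`cellPath`);
* they satisfy the relations of the discs (`prod_word`);
* conversely, a family of elements of a group which satisfies these relations is the image of the
  edge loops under a homomorphism (`exists_hom`), namely the monodromy of a covering space with
  fibre the group, trivial over three open sets (`exists_monodromy_hom`).

It remains to simplify this presentation. Chambers are described by their sign vectors, and an arrow
is determined by its source and the index of the hyperplane which it crosses (`arrow_ext`). The faces
of codimension two are of three types (`FaceType`): in two hyperplanes `H ε`, `H δ`; in two coordinate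
hyperplanes; or in the coordinate hyperplane of `i` and the hyperplanes of two sign vectors which
differ at `i` only. The boundary paths of a 2-cell cross each hyperplane through its face once
(`idx_of_shortest`).

*The relations suffice.* In the presented group put `D ε = m_ε⁻¹ γ₀ m_ε` (`conjWrd`). Label an arrow
which crosses the `i`-th coordinate hyperplane by `γ_i`, an arrow away from the origin across some
`H ε` by `1`, and an arrow towards the origin by `D ε`, if the translate of the arrow which starts in
the positive orthant crosses `H ε`. These labels satisfy the relations of all
2-cells (`labelRel_of_rel`, `LabelRel.prod_eq`), so that they define a homomorphism from the
fundamental group to the presented group.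

*The relations hold, and the generators generate.* Consider any labelling of the arrows which is
compatible with the cells (`Labelling`), such as the one by loops. Two walls in the same hyperplane
within the positive orthant are joined by a generic segment in the hyperplane. It passes through
faces of codimension two only (`exists_adjacent`), and there the relation of a 2-cell shows that the
label does not change, as the other arrows in its boundary are translates of spanning ones
(`Labelling.wallLabel_const`). So the labelling is given by elements `D ε` and `c i` as above
(`Labelling.eq_label`). The faces in a coordinate hyperplane show that `D (flip i ε)` is the
conjugate of `D ε` by `c i`, whence `D ε` is the conjugate of `D 1` by the value of `m_ε`
(`down_eq_conjWrd`). With this the 2-cells give the relations of the presentation (`Labelling.rel`),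
and all labels are in the subgroup generated by `D 1` and the `c i` (`Labelling.mem`).

The two homomorphisms are inverse to each other, since they are so on generators.
-/

open Topology Set unitInterval MulOpposite
open scoped Pointwise

noncomputable section


/-! ### Homomorphisms out of the fundamental group from locally constant transition functions -/

section Monodromy

open Bundle

variable {X ι G : Type} [TopologicalSpace X] [Group G]

/-- `w` is a flat section along `γ` of the principal bundle which is trivial over each `U i`, with
transition functions `(f i)⁻¹ * f j`, written in the (discontinuous) global coordinate in which the
flat sections over `U i` are the functions `g * (f i)⁻¹`. -/
def IsFlatAlong (U : ι → Set X) (f : ι → X → G) (γ : I → X) (w : I → G) : Prop :=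
  ∀ t, ∃ i, γ t ∈ U i ∧ ∀ᶠ t' in 𝓝 t, w t' * f i (γ t') = w t * f i (γ t)

/-- An open cover `U` and functions `f i` with values in a group `G` such that the quotients
`(f i)⁻¹ * f j` are locally constant on overlaps define a covering space with fibre `G`; its
monodromy is a homomorphism to `G`, computed on a loop by any flat section along the loop. -/
theorem exists_monodromy_hom (s : X) (U : ι → Set X) (hU : ∀ i, IsOpen (U i))
    (hcov : ∀ x, ∃ i, x ∈ U i) (f : ι → X → G)
    (hf : ∀ i j, ∀ x ∈ U i ∩ U j, ∀ᶠ y in 𝓝 x, (f i y)⁻¹ * f j y = (f i x)⁻¹ * f j x) :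
    ∃ φ : (FundamentalGroup X s)ᵐᵒᵖ →* G, ∀ (p : Path s s) (w : I → G),
      IsFlatAlong U f p w → w 0 = 1 →
        φ (op (FundamentalGroup.fromPath (Path.Homotopic.Quotient.mk p))) = w 1 := by
  classical
  let _ : TopologicalSpace G := ⊥
  have : DiscreteTopology G := ⟨rfl⟩
  choose idx hidx using hcov
  let Z : FiberBundleCore ι X G :=
    { baseSet := U
      isOpen_baseSet := hU
      indexAt := idx
      mem_baseSet_at := hidx
      coordChange := fun i j x v => v * ((f i x)⁻¹ * f j x)
      coordChange_self := fun i x _ v => by simp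
      continuousOn_coordChange := by
        rintro i j ⟨x, v⟩ ⟨hx, -⟩
        have h1 : ContinuousAt (fun y => (f i y)⁻¹ * f j y) x :=
          tendsto_nhds_of_eventually_eq (hf i j x hx)
        have h2 : ContinuousAt (fun p : X × G => p.2 * ((f i p.1)⁻¹ * f j p.1)) (x, v) :=
          ContinuousAt.mul continuousAt_snd
            (ContinuousAt.comp (f := Prod.fst) (x := (x, v)) h1 continuousAt_fst)
        exact h2.continuousWithinAt
      coordChange_comp := fun i j k x _ v => by group }
  let E := TotalSpace G Z.Fiber
  have cov : IsCoveringMap (π G Z.Fiber) := FiberBundle.isCoveringMap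
  -- the global coordinate on the total space, and the point with a given coordinate
  let what : E → G := fun e => (id e.2 : G) * (f (idx e.1) e.1)⁻¹
  let pt : X → G → E := fun x g => ⟨x, (g * f (idx x) x : G)⟩
  have what_pt : ∀ x g, what (pt x g) = g := fun x g => by
    change g * f (idx x) x * (f (idx x) x)⁻¹ = g
    group
  have pt_what : ∀ e, pt e.1 (what e) = e := fun ⟨x, v⟩ => by
    change (⟨x, ((id v : G) * (f (idx x) x)⁻¹ * f (idx x) x : G)⟩ : E) = ⟨x, v⟩
    rw [inv_mul_cancel_right]
    rfl
  have triv : ∀ x (e : E), ((trivializationAt G Z.Fiber x) e).2 = what e * f (idx x) e.1 := by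
    rintro x ⟨y, v⟩
    exact (mul_assoc (id v : G) _ _).symm
  have key : ∀ (Γ : I → E), Continuous Γ ↔ Continuous (fun t => (Γ t).1) ∧
      ∀ t, ∀ᶠ t' in 𝓝 t, what (Γ t') * f (idx (Γ t).1) (Γ t').1 =
        what (Γ t) * f (idx (Γ t).1) (Γ t).1 := by
    intro Γ
    rw [continuous_iff_continuousAt, continuous_iff_continuousAt, ← forall_and]
    refine forall_congr' fun t => ?_
    rw [FiberBundle.continuousAt_totalSpace (F := G) (E := Z.Fiber)]
    simp only [triv]
    refine and_congr Iff.rfl ?_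
    rw [ContinuousAt, nhds_discrete G, Filter.tendsto_pure]
  have lift : ∀ (γ : C(I, X)) (w : I → G), IsFlatAlong U f γ w →
      Continuous (fun t => pt (γ t) (w t)) := by
    intro γ w hw
    rw [key]
    refine ⟨γ.continuous, fun t => ?_⟩
    simp only [what_pt]
    obtain ⟨i, hi, hwi⟩ := hw t
    have h2 := γ.continuous.continuousAt.eventually (hf i (idx (γ t)) (γ t) ⟨hi, hidx _⟩)
    filter_upwards [hwi, h2] with t' h1 h2
    change w t' * f (idx (γ t)) (γ t') = w t * f (idx (γ t)) (γ t)
    calc w t' * f (idx (γ t)) (γ t')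
        = w t' * f i (γ t') * ((f i (γ t'))⁻¹ * f (idx (γ t)) (γ t')) := by group
      _ = w t * f (idx (γ t)) (γ t) := by rw [h1, h2]; group
  let fib : G → (π G Z.Fiber ⁻¹' {s}) := fun g => ⟨pt s g, rfl⟩
  have fib_surj : ∀ e : (π G Z.Fiber ⁻¹' {s}), fib (what e.1) = e := by
    rintro ⟨e, he⟩
    apply Subtype.ext
    have h : e.1 = s := he
    subst h
    exact pt_what e
  have mono : ∀ (p : Path s s) (w : I → G), IsFlatAlong U f p w →
      cov.monodromy (Path.Homotopic.Quotient.mk p) (fib (w 0)) = fib (w 1) := by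
    intro p w hw
    have hl := (cov.eq_liftPath_iff (γ := p.toContinuousMap) (e := pt s (w 0))
      (γ_0 := p.source) (Γ := fun t => pt (p t) (w t))).2
      ⟨lift p.toContinuousMap w hw, rfl, by simp⟩
    apply Subtype.ext
    have := congrFun hl 1
    refine this.symm.trans ?_
    change pt (p 1) (w 1) = pt s (w 1)
    rw [p.target]
  have exw : ∀ (p : Path s s) (g : G), ∃ w : I → G, IsFlatAlong U f p w ∧ w 0 = g := by
    intro p g
    let Γ := cov.liftPath p.toContinuousMap (pt s g) p.source
    have hΓ : ∀ t, (Γ t).1 = p t := fun t =>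
      congrFun (cov.liftPath_lifts p.toContinuousMap (pt s g) p.source) t
    have h0 : Γ 0 = pt s g := cov.liftPath_zero _ _ _
    refine ⟨fun t => what (Γ t), fun t => ⟨idx (p t), hidx _, ?_⟩, ?_⟩
    · have := ((key Γ).1 Γ.continuous).2 t
      simpa only [hΓ] using this
    · simp only [h0, what_pt]
  let φ : (FundamentalGroup X s)ᵐᵒᵖ → G := fun q =>
    what (cov.monodromy (FundamentalGroup.toPath q.unop) (fib 1)).1
  have φ_mk : ∀ (p : Path s s) (w : I → G), IsFlatAlong U f p w → w 0 = 1 →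
      φ (op (FundamentalGroup.fromPath (Path.Homotopic.Quotient.mk p))) = w 1 := by
    intro p w hw h0
    have := mono p w hw
    rw [h0] at this
    change what (cov.monodromy (Path.Homotopic.Quotient.mk p) (fib 1)).1 = w 1
    rw [this]
    exact what_pt _ _
  refine ⟨MonoidHom.mk' φ ?_, φ_mk⟩
  rintro ⟨q⟩ ⟨q'⟩
  obtain ⟨p, rfl⟩ := Path.Homotopic.Quotient.mk_surjective q
  obtain ⟨p', rfl⟩ := Path.Homotopic.Quotient.mk_surjective q'
  obtain ⟨w, hw, hw0⟩ := exw p 1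
  obtain ⟨w', hw', hw0'⟩ := exw p' 1
  have e1 := φ_mk p w hw hw0
  have e2 := φ_mk p' w' hw' hw0'
  refine Eq.trans ?_ (congrArg₂ (· * ·) e1 e2).symm
  change what (cov.monodromy ((Path.Homotopic.Quotient.mk p).trans
    (Path.Homotopic.Quotient.mk p')) (fib 1)).1 = _
  rw [cov.monodromy_trans_apply]
  have m1 := mono p w hw
  rw [hw0] at m1
  have m2 := mono p' (fun t => w 1 * w' t) (fun t => by
    obtain ⟨i, hi, h⟩ := hw' t
    refine ⟨i, hi, ?_⟩
    filter_upwards [h] with t' h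
    rw [mul_assoc, h, mul_assoc])
  simp only [hw0', mul_one] at m2
  rw [m1, m2]
  exact what_pt _ _

end Monodromy

/-! ### The closed unit disc and its boundary circle -/

namespace TwoComplex

open Salvetti (D2)

/-- `OnHalf false` and `OnHalf true` are the closed lower and upper half circles. -/
def OnHalf (h : Bool) (z : D2) : Prop :=
  ‖z.1‖ = 1 ∧ (if h then 0 ≤ z.1.im else z.1.im ≤ 0)

/-- The parameter in `[0, 1]` of a point of either half circle, running from `-1` to `1`. -/
def pos (z : D2) : ℝ := (z.1.re + 1) / 2

lemma D2.norm_le (z : D2) : ‖z.1‖ ≤ 1 := mem_closedBall_zero_iff.1 z.2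

lemma D2.abs_re_le (z : D2) : |z.1.re| ≤ 1 := (Complex.abs_re_le_norm _).trans (D2.norm_le z)

lemma pos_mem (z : D2) : pos z ∈ Icc (0 : ℝ) 1 := by
  have := abs_le.1 (D2.abs_re_le z)
  constructor <;> unfold pos <;> linarith [this.1, this.2]

lemma onHalf_or {z : D2} (hz : ‖z.1‖ = 1) : OnHalf true z ∨ OnHalf false z := by
  rcases le_total 0 z.1.im with h | h
  · exact Or.inl ⟨hz, by simpa using h⟩
  · exact Or.inr ⟨hz, by simpa using h⟩

lemma norm_conj_D2 (z : D2) : ‖z.conj.1‖ = ‖z.1‖ := RCLike.norm_conj z.1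

lemma onHalf_conj {h : Bool} {z : D2} (hz : OnHalf h z) : OnHalf (!h) z.conj := by
  refine ⟨(norm_conj_D2 z).trans hz.1, ?_⟩
  have := hz.2
  cases h <;> simpa [Salvetti.D2.conj] using this

lemma pos_conj (z : D2) : pos z.conj = pos z := by simp [pos, Salvetti.D2.conj]

/-- The point of the lower or upper half circle with parameter `u`. -/
def arc (h : Bool) (u : I) : D2 :=
  ⟨⟨2 * u - 1, (if h then 1 else -1) * √(1 - (2 * u - 1) ^ 2)⟩, by
    rw [mem_closedBall_zero_iff, ← sq_le_one_iff₀ (norm_nonneg _), ← Complex.normSq_eq_norm_sq,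
      Complex.normSq_mk]
    have hu : 0 ≤ 1 - (2 * (u : ℝ) - 1) ^ 2 := by nlinarith [u.2.1, u.2.2]
    have hs := Real.mul_self_sqrt hu
    cases h <;> simp <;> nlinarith⟩

lemma onHalf_arc (h : Bool) (u : I) : OnHalf h (arc h u) := by
  have hu : 0 ≤ 1 - (2 * (u : ℝ) - 1) ^ 2 := by nlinarith [u.2.1, u.2.2]
  have hs := Real.mul_self_sqrt hu
  constructor
  · rw [← pow_eq_one_iff_of_nonneg (norm_nonneg _) two_ne_zero, ← Complex.normSq_eq_norm_sq]
    cases h <;> simp [arc, Complex.normSq_mk] <;> nlinarith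
  · have := Real.sqrt_nonneg (1 - (2 * (u : ℝ) - 1) ^ 2)
    cases h <;> simp [arc]

lemma pos_arc (h : Bool) (u : I) : pos (arc h u) = u := by simp [pos, arc]

lemma continuous_arc (h : Bool) : Continuous (arc h) := by
  refine Continuous.subtype_mk ?_ _
  have : (fun u : I => (⟨2 * u - 1, (if h then 1 else -1) * √(1 - (2 * u - 1) ^ 2)⟩ : ℂ)) =
      fun u : I => ((2 * u - 1 : ℝ) : ℂ) +
        (((if h then 1 else -1) * √(1 - (2 * (u : ℝ) - 1) ^ 2) : ℝ) : ℂ) * Complex.I := by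
    funext u
    apply Complex.ext <;> simp
  rw [this]
  fun_prop

lemma arc_pos {h : Bool} {z : D2} (hz : OnHalf h z) : arc h ⟨pos z, pos_mem z⟩ = z := by
  apply Subtype.ext
  obtain ⟨h1, h2⟩ := hz
  have hn : z.1.re * z.1.re + z.1.im * z.1.im = 1 := by
    rw [← Complex.normSq_apply, Complex.normSq_eq_norm_sq, h1, one_pow]
  have e : 1 - (2 * pos z - 1) ^ 2 = z.1.im ^ 2 := by unfold pos; nlinarith
  apply Complex.ext
  · simp [arc, pos]; ring
  · simp only [arc, e, Real.sqrt_sq_eq_abs]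
    cases h <;> simp at h2 ⊢
    · rw [abs_of_nonpos h2]; ring
    · exact h2

/-- The radial projection of the disc to its boundary circle, with the junk value `0` at `0`. -/
def rad (z : D2) : D2 :=
  ⟨(‖z.1‖⁻¹ : ℝ) * z.1, by
    rw [mem_closedBall_zero_iff, norm_mul, Complex.norm_real, norm_inv, norm_norm]
    exact inv_mul_le_one⟩

/-- The centre of the disc. -/
def ctr : D2 := ⟨0, by simp⟩

lemma norm_ne_zero_of_ne_ctr {z : D2} (hz : z ≠ ctr) : ‖z.1‖ ≠ 0 := fun h =>
  hz (Subtype.ext (norm_eq_zero.1 h))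

lemma norm_rad {z : D2} (hz : z ≠ ctr) : ‖(rad z).1‖ = 1 := by
  simp only [rad, norm_mul, Complex.norm_real, norm_inv, norm_norm]
  exact inv_mul_cancel₀ (norm_ne_zero_of_ne_ctr hz)

lemma ne_ctr_of_norm {z : D2} (hz : ‖z.1‖ = 1) : z ≠ ctr := by
  rintro rfl
  simp [ctr] at hz

lemma rad_of_norm {z : D2} (hz : ‖z.1‖ = 1) : rad z = z := by
  apply Subtype.ext
  simp [rad, hz]

lemma rad_conj (z : D2) : rad z.conj = (rad z).conj := by
  apply Subtype.ext
  simp [rad, Salvetti.D2.conj]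

lemma conj_eq_ctr {z : D2} : z.conj = ctr ↔ z = ctr := by
  rw [Subtype.ext_iff, Subtype.ext_iff]
  exact map_eq_zero (starRingEnd ℂ)

lemma continuousOn_rad : ContinuousOn rad {z | z ≠ ctr} := by
  rw [Topology.IsInducing.subtypeVal.continuousOn_iff]
  have : ContinuousOn (fun z : D2 => ((‖z.1‖⁻¹ : ℝ) : ℂ) * z.1) {z | z ≠ ctr} := by
    refine ContinuousOn.mul ?_ continuous_subtype_val.continuousOn
    refine Complex.continuous_ofReal.comp_continuousOn ?_
    exact (continuous_norm.comp continuous_subtype_val).continuousOn.inv₀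
      fun z hz => norm_ne_zero_of_ne_ctr hz
  exact this

/-- The point which divides the segment from `z` to `w` in the ratio `u : 1 - u`. -/
def mix (z w : D2) (u : I) : D2 :=
  ⟨(1 - u : ℝ) • z.1 + (u : ℝ) • w.1,
    (convex_closedBall (0 : ℂ) 1) z.2 w.2 (by linarith [u.2.2]) u.2.1 (by ring)⟩

lemma continuous_mix : Continuous fun p : (D2 × D2) × I => mix p.1.1 p.1.2 p.2 := by
  refine Continuous.subtype_mk ?_ _
  fun_prop

lemma mix_zero (z w : D2) : mix z w 0 = z := Subtype.ext (by simp [mix])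

lemma mix_one (z w : D2) : mix z w 1 = w := Subtype.ext (by simp [mix])

lemma mix_self (z : D2) (u : I) : mix z z u = z := Subtype.ext (by
  simp only [mix, ← add_smul]; simp)

lemma mix_conj (z w : D2) (u : I) : (mix z w u).conj = mix z.conj w.conj u := Subtype.ext (by
  simp [mix, Salvetti.D2.conj])

instance : SimplyConnectedSpace D2 :=
  haveI := (convex_closedBall (0 : ℂ) 1).contractibleSpace ⟨0, by simp⟩
  SimplyConnectedSpace.ofContractible _

instance : SimplyConnectedSpace I :=
  haveI := (convex_Icc (0 : ℝ) 1).contractibleSpace ⟨0, by simp⟩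
  SimplyConnectedSpace.ofContractible _

/-- The parameter `(k + t) / m` of the point `t` of the `k`-th of `m` equal parts of `[0, 1]`. -/
def part (m k : ℕ) (t : I) : I := projIcc 0 1 zero_le_one ((k + t) / m : ℝ)

lemma continuous_part (m k : ℕ) : Continuous (part m k) := by
  unfold part
  fun_prop

lemma coe_part {m k : ℕ} (hk : k < m) (t : I) : (part m k t : ℝ) = (k + t) / m := by
  have hm : (0 : ℝ) < m := by exact_mod_cast (Nat.zero_le k).trans_lt hk
  have hk' : (k : ℝ) + 1 ≤ m := by exact_mod_cast hk
  rw [part, projIcc_of_mem]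
  exact ⟨div_nonneg (add_nonneg (Nat.cast_nonneg _) t.2.1) hm.le,
    (div_le_one hm).2 (by linarith [t.2.2])⟩

lemma part_mul {m k : ℕ} (hk : k < m) (t : I) : (part m k t : ℝ) * m = k + t := by
  have hm : (m : ℝ) ≠ 0 := by
    have := (Nat.zero_le k).trans_lt hk
    positivity
  rw [coe_part hk]
  field_simp

lemma exists_part {m : ℕ} (hm : 0 < m) {p : ℝ} (hp : p ∈ Icc (0 : ℝ) 1) :
    ∃ k, k < m ∧ ∃ t : I, p * m = k + t := by
  have hm' : (0 : ℝ) < m := by exact_mod_cast hm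
  have h0 : 0 ≤ p * m := mul_nonneg hp.1 hm'.le
  by_cases h : ⌊p * m⌋₊ < m
  · refine ⟨_, h, ⟨p * m - ⌊p * m⌋₊, ?_, ?_⟩, by ring⟩
    · linarith [Nat.floor_le h0]
    · linarith [Nat.lt_floor_add_one (p * m)]
  · have h1 : p * m = m := by
      refine le_antisymm (by nlinarith [hp.2]) ?_
      exact (Nat.le_floor_iff h0).1 (not_lt.1 h)
    refine ⟨m - 1, by omega, 1, ?_⟩
    rw [h1, Nat.cast_sub (by omega)]
    simp

/-- A map on a subset of the circle is continuous if it is so on each of the arcs into which the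
two half circles are divided. -/
lemma continuousOn_circle {T : Type} [TopologicalSpace T] (m : Bool → ℕ) (hm : ∀ h, 0 < m h)
    (H : D2 → T) (B : Set D2) (hB : ∀ z ∈ B, ‖z.1‖ = 1)
    (hH : ∀ h k, k < m h → ContinuousOn (fun t => H (arc h (part (m h) k t)))
      {t | arc h (part (m h) k t) ∈ B}) : ContinuousOn H B := by
  let κ : (Σ h, Fin (m h)) → I → D2 := fun i t => arc i.1 (part (m i.1) i.2 t)
  have hκ : ∀ i, IsClosedEmbedding (κ i) := fun i => by
    refine ((continuous_arc _).comp (continuous_part _ _)).isClosedEmbedding ?_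
    intro t t' htt'
    have h1 := congrArg pos (show arc _ _ = arc _ _ from htt')
    rw [pos_arc, pos_arc] at h1
    have h2 := part_mul i.2.2 t
    rw [h1, part_mul i.2.2 t'] at h2
    exact Subtype.ext (by linarith)
  have hcov : B = ⋃ i, B ∩ range (κ i) := by
    rw [← inter_iUnion]
    refine (inter_eq_left.2 fun z hz => ?_).symm
    have key : ∀ h, OnHalf h z → z ∈ ⋃ i, range (κ i) := by
      intro h hh
      obtain ⟨k, hk, t, ht⟩ := exists_part (hm h) (pos_mem z)
      refine mem_iUnion.2 ⟨⟨h, ⟨k, hk⟩⟩, t, ?_⟩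
      have : part (m h) k t = ⟨pos z, pos_mem z⟩ := by
        apply Subtype.ext
        have hm' : (m h : ℝ) ≠ 0 := by have := hm h; positivity
        exact mul_right_cancel₀ hm' ((part_mul hk t).trans ht.symm)
      change arc h (part (m h) k t) = z
      rw [this, arc_pos hh]
    rcases onHalf_or (hB z hz) with h | h
    · exact key _ h
    · exact key _ h
  intro z hz
  rw [ContinuousWithinAt, hcov, nhdsWithin_iUnion, Filter.tendsto_iSup]
  intro i
  change ContinuousWithinAt H (B ∩ range (κ i)) z
  by_cases hi : z ∈ range (κ i)
  · have : ContinuousOn H (κ i '' (κ i ⁻¹' B)) :=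
      (hκ i).isInducing.continuousOn_image_iff.2 (hH i.1 i.2 i.2.2)
    rw [image_preimage_eq_inter_range] at this
    exact this z ⟨hz, hi⟩
  · refine continuousWithinAt_of_notMem_closure fun h => hi ?_
    exact (hκ i).isClosed_range.closure_subset_iff.2 inter_subset_right h

end TwoComplex

/-! ### Two-dimensional complexes with one vertex -/

namespace TwoComplex

open Salvetti (D2)

/-- The combinatorial data of a 2-complex with one vertex, allowing for redundancies: some cells
are trivial (they are collapsed to the vertex), cells are identified along symmetries, and each disc
is listed together with its mirror image. `word F false` and `word F true` are the edge paths along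
which the lower and the upper half circle of the disc `F` are attached. -/
structure Shape where
  Edge : Type
  Disc : Type
  Sym : Type
  actE : Sym → Edge → Edge
  actD : Sym → Disc → Disc
  swap : Disc → Disc
  word : Disc → Bool → List Edge
  trivE : Edge → Prop
  trivD : Disc → Prop
  word_ne_nil : ∀ F h, word F h ≠ []
  word_swap : ∀ F h, word (swap F) h = word F (!h)
  word_act : ∀ m F h, word (actD m F) h = (word F h).map (actE m)
  trivE_act : ∀ m e, trivE (actE m e) ↔ trivE e
  trivD_act : ∀ m F, trivD (actD m F) ↔ trivD F
  trivD_swap : ∀ F, trivD (swap F) ↔ trivD F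
  trivE_of_mem : ∀ F h e, trivD F → e ∈ word F h → trivE e

namespace Shape

variable {K : Shape} {T : Type}

/-- A function on the closed 1-cells which descends to the 1-skeleton and has the value `c` at the
vertex. -/
structure EdgeCompat (K : Shape) (c : T) (a : K.Edge → I → T) : Prop where
  zero : ∀ e, a e 0 = c
  one : ∀ e, a e 1 = c
  triv : ∀ e t, K.trivE e → a e t = c
  act : ∀ m e t, a (K.actE m e) t = a e t

/-- A function on the closed cells which descends to the complex. -/
structure Compat (K : Shape) (c : T) (a : K.Edge → I → T) (b : K.Disc → D2 → T) : Prop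
    extends EdgeCompat K c a where
  trivD : ∀ F z, K.trivD F → b F z = c
  actD : ∀ m F z, b (K.actD m F) z = b F z
  swap : ∀ F z, b (K.swap F) z.conj = b F z
  bdry : ∀ F h z k (hk : k < (K.word F h).length) (t : I), OnHalf h z →
    pos z * (K.word F h).length = k + t → b F z = a (K.word F h)[k] t

/-- The function on `[0, 1]` which runs through the functions `a e`, for the letters `e` of `w`,
each with the same amount of time. -/
def runValue {E : Type} (c : T) (a : E → I → T) (w : List E) (p : ℝ) : T :=
  if h : ⌊p * w.length⌋₊ < w.length then
    a w[⌊p * w.length⌋₊] ⟨Int.fract (p * w.length), Int.fract_nonneg _, (Int.fract_lt_one _).le⟩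
  else c

lemma runValue_eq {E : Type} {c : T} {a : E → I → T} (h0 : ∀ e, a e 0 = c) (h1 : ∀ e, a e 1 = c)
    {w : List E} {p : ℝ} {k : ℕ} (hk : k < w.length) {t : I} (ht : p * w.length = k + t) :
    runValue c a w p = a w[k] t := by
  unfold runValue
  rcases eq_or_lt_of_le t.2.2 with h | h
  · have ht1 : t = 1 := Subtype.ext h
    have hp : p * w.length = ((k + 1 : ℕ) : ℝ) := by rw [ht, h]; push_cast; ring
    have hfl : ⌊p * w.length⌋₊ = k + 1 := by rw [hp]; exact Nat.floor_natCast _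
    subst ht1
    rw [h1]
    split_ifs with hl
    · refine Eq.trans (congrArg _ ?_) (h0 _)
      apply Subtype.ext
      change Int.fract (p * w.length) = 0
      rw [hp]
      exact Int.fract_natCast _
    · rfl
  · have hfl : ⌊p * w.length⌋₊ = k := by
      rw [ht, add_comm, Nat.floor_add_natCast t.2.1, Nat.floor_eq_zero.2 h, zero_add]
    have hfr : Int.fract (p * w.length) = t := by
      rw [ht, Int.fract_natCast_add, Int.fract_eq_self.2 ⟨t.2.1, h⟩]
    rw [dif_pos (hfl.trans_lt hk)]
    congr 1
    · simp only [hfl]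
    · exact Subtype.ext hfr

lemma runValue_map {E : Type} (c : T) (a : E → I → T) (f : E → E) (hf : ∀ e t, a (f e) t = a e t)
    (w : List E) (p : ℝ) : runValue c a (w.map f) p = runValue c a w p := by
  unfold runValue
  simp only [List.length_map, List.getElem_map, hf]

/-- The function on the boundary circle of a disc attached along `W false` and `W true`. -/
def circleValue {E : Type} (c : T) (a : E → I → T) (W : Bool → List E) (z : D2) : T :=
  if 0 ≤ z.1.im then runValue c a (W true) (pos z) else runValue c a (W false) (pos z)

lemma circleValue_eq {E : Type} {c : T} {a : E → I → T} (h0 : ∀ e, a e 0 = c)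
    (h1 : ∀ e, a e 1 = c) {W : Bool → List E} (hW : ∀ h, W h ≠ []) {h : Bool} {z : D2}
    (hz : OnHalf h z) : circleValue c a W z = runValue c a (W h) (pos z) := by
  unfold circleValue
  cases h
  · split_ifs with him
    · -- the two half circles meet at `-1` and `1` only, where both functions have the value `c`
      have him0 : z.1.im = 0 := le_antisymm (by simpa using hz.2) him
      have hre : z.1.re * z.1.re = 1 := by
        have : z.1.re * z.1.re + z.1.im * z.1.im = 1 := by
          rw [← Complex.normSq_apply, Complex.normSq_eq_norm_sq, hz.1, one_pow]
        rwa [him0, mul_zero, add_zero] at this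
      have key : ∀ h, runValue c a (W h) (pos z) = c := by
        intro h
        have hl : 0 < (W h).length := List.length_pos_iff.2 (hW h)
        rcases mul_self_eq_one_iff.1 hre with hr | hr
        · rw [runValue_eq h0 h1 (k := (W h).length - 1) (t := 1) (by omega), h1]
          rw [pos, hr, Nat.cast_sub (by omega)]
          simp
        · rw [runValue_eq h0 h1 (k := 0) (t := 0) hl, h0]
          rw [pos, hr]
          simp
      rw [key, key]
    · rfl
  · rw [if_pos (by simpa using hz.2)]

/-- A function on the 1-skeleton, extended to the discs by means of the radial projection. -/
def radialExt (K : Shape) (c : T) (a : K.Edge → I → T) (F : K.Disc) (z : D2) : T :=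
  open Classical in
  if K.trivD F ∨ z = ctr then c else circleValue c a (K.word F) (rad z)

lemma radialExt_of_triv {c : T} {a : K.Edge → I → T} {F : K.Disc} {z : D2}
    (h : K.trivD F ∨ z = ctr) : K.radialExt c a F z = c := if_pos h

lemma radialExt_of_not {c : T} {a : K.Edge → I → T} {F : K.Disc} {z : D2}
    (h : ¬ (K.trivD F ∨ z = ctr)) :
    K.radialExt c a F z = circleValue c a (K.word F) (rad z) := if_neg h

lemma EdgeCompat.radialExt {c : T} {a : K.Edge → I → T} (H : K.EdgeCompat c a) :
    K.Compat c a (K.radialExt c a) where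
  __ := H
  trivD F z hF := radialExt_of_triv (Or.inl hF)
  actD m F z := by
    by_cases h : K.trivD F ∨ z = ctr
    · rw [radialExt_of_triv h, radialExt_of_triv (by rwa [K.trivD_act])]
    · rw [radialExt_of_not h, radialExt_of_not (by rwa [K.trivD_act])]
      simp only [circleValue, K.word_act, runValue_map c a _ (H.act m)]
  swap F z := by
    by_cases h : K.trivD F ∨ z = ctr
    · rw [radialExt_of_triv h, radialExt_of_triv (by rwa [K.trivD_swap, conj_eq_ctr])]
    · rw [radialExt_of_not h, radialExt_of_not (by rwa [K.trivD_swap, conj_eq_ctr])]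
      have hz := norm_rad (not_or.1 h).2
      have key : ∀ b, OnHalf b (rad z) → circleValue c a (K.word (K.swap F)) (rad z.conj) =
          circleValue c a (K.word F) (rad z) := by
        intro b hb
        rw [circleValue_eq H.zero H.one (K.word_ne_nil F) hb, rad_conj,
          circleValue_eq H.zero H.one (K.word_ne_nil _) (onHalf_conj hb), K.word_swap, pos_conj,
          Bool.not_not]
      rcases onHalf_or hz with hb | hb
      · exact key _ hb
      · exact key _ hb
  bdry F h z k hk t hz ht := by
    by_cases hF : K.trivD F
    · rw [H.triv _ _ (K.trivE_of_mem F h _ hF (List.getElem_mem hk))]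
      exact (radialExt_of_triv (Or.inl hF)).symm ▸ rfl
    · have hc : ¬ (K.trivD F ∨ z = ctr) := not_or.2 ⟨hF, ne_ctr_of_norm hz.1⟩
      rw [radialExt_of_not hc, rad_of_norm hz.1,
        circleValue_eq H.zero H.one (K.word_ne_nil F) hz, runValue_eq H.zero H.one hk ht]

end Shape

/-- A space `X` with a point `s` which is the 2-complex described by `K`: the closed cells map to
`X`, functions on the closed cells that respect the attaching maps descend to `X`, and `X` carries
the quotient topology. -/
structure Realization (K : Shape) (X : Type) [TopologicalSpace X] (s : X) where
  edge : K.Edge → C(I, X)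
  disc : K.Disc → C(D2, X)
  compat : K.Compat s (fun e t => edge e t) (fun F z => disc F z)
  surj : ∀ x, x = s ∨ (∃ e t, x = edge e t) ∨ ∃ F z, x = disc F z
  isOpen : ∀ U : Set X, (∀ e, IsOpen (edge e ⁻¹' U)) → (∀ F, IsOpen (disc F ⁻¹' U)) → IsOpen U
  lift : ∀ {T : Type} {c : T} {a : K.Edge → I → T} {b : K.Disc → D2 → T}, K.Compat c a b →
    ∃ h : X → T, h s = c ∧ (∀ e t, h (edge e t) = a e t) ∧ ∀ F z, h (disc F z) = b F z

namespace Realization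

variable {K : Shape} {X : Type} [TopologicalSpace X] {s : X} (R : Realization K X s)
variable {T : Type}

include R in
lemma disc_triv {F : K.Disc} (hF : K.trivD F) (z : D2) : R.disc F z = s := R.compat.trivD F z hF

lemma exists_edge_of_norm (F : K.Disc) {z : D2} (hz : ‖z.1‖ = 1) :
    ∃ e t, R.disc F z = R.edge e t := by
  have key : ∀ h, OnHalf h z → ∃ e t, R.disc F z = R.edge e t := by
    intro h hh
    obtain ⟨k, hk, t, ht⟩ := exists_part (List.length_pos_iff.2 (K.word_ne_nil F h)) (pos_mem z)
    exact ⟨_, _, R.compat.bdry F h z k hk t hh ht⟩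
  rcases onHalf_or hz with h | h
  · exact key _ h
  · exact key _ h

/-- The value of `h` at a point of a disc depends only on the radial projection of the point. -/
def IsRadial (h : X → T) : Prop := ∀ F z, z ≠ ctr → h (R.disc F z) = h (R.disc F (rad z))

/-- A function on the 1-skeleton extends to a radial function on the complex. -/
lemma exists_radial {c : T} {a : K.Edge → I → T} (H : K.EdgeCompat c a) :
    ∃ h : X → T, h s = c ∧ (∀ e t, h (R.edge e t) = a e t) ∧ R.IsRadial h := by
  obtain ⟨h, h1, h2, h3⟩ := R.lift H.radialExt
  refine ⟨h, h1, h2, fun F z hz => ?_⟩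
  have hr := norm_rad hz
  have hr' : rad z ≠ ctr := ne_ctr_of_norm hr
  rw [h3, h3]
  by_cases hF : K.trivD F
  · rw [Shape.radialExt_of_triv (Or.inl hF), Shape.radialExt_of_triv (Or.inl hF)]
  · rw [Shape.radialExt_of_not (not_or.2 ⟨hF, hz⟩), Shape.radialExt_of_not (not_or.2 ⟨hF, hr'⟩),
      rad_of_norm hr]

lemma exists_punctured : ∃ V : Set X, s ∈ V ∧ (∀ e t, R.edge e t ∈ V) ∧
    ∀ F z, R.disc F z ∈ V ↔ K.trivD F ∨ z ≠ ctr := by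
  have hc : K.Compat True (fun _ _ => True) (fun F z => K.trivD F ∨ z ≠ ctr) :=
    { zero := fun _ => rfl
      one := fun _ => rfl
      triv := fun _ _ _ => rfl
      act := fun _ _ _ => rfl
      trivD := fun F z h => by simp [h]
      actD := fun m F z => by simp only [K.trivD_act]
      swap := fun F z => by simp only [K.trivD_swap, ne_eq, conj_eq_ctr]
      bdry := fun F h z k hk t hz _ => by simp [ne_ctr_of_norm hz.1] }
  obtain ⟨V, h1, h2, h3⟩ := R.lift hc
  exact ⟨{x | V x}, by simp [h1], fun e t => by simp [h2], fun F z => by simp [h3]⟩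

/-- The complement of the centres of the nontrivial discs. It retracts to the 1-skeleton. -/
def punctured : Set X := R.exists_punctured.choose

lemma base_mem_punctured : s ∈ R.punctured := R.exists_punctured.choose_spec.1

lemma edge_mem_punctured (e : K.Edge) (t : I) : R.edge e t ∈ R.punctured :=
  R.exists_punctured.choose_spec.2.1 e t

lemma disc_mem_punctured (F : K.Disc) (z : D2) :
    R.disc F z ∈ R.punctured ↔ K.trivD F ∨ z ≠ ctr := R.exists_punctured.choose_spec.2.2 F z

lemma isOpen_punctured : IsOpen R.punctured := by
  refine R.isOpen _ (fun e => ?_) (fun F => ?_)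
  · have : R.edge e ⁻¹' R.punctured = univ := eq_univ_of_forall fun t => R.edge_mem_punctured e t
    rw [this]; exact isOpen_univ
  · by_cases hF : K.trivD F
    · have : R.disc F ⁻¹' R.punctured = univ :=
        eq_univ_of_forall fun z => (R.disc_mem_punctured F z).2 (Or.inl hF)
      rw [this]; exact isOpen_univ
    · have : R.disc F ⁻¹' R.punctured = {ctr}ᶜ := by
        ext z
        simp [R.disc_mem_punctured, hF]
      rw [this]
      exact isOpen_compl_singleton

lemma eq_edge_of_mem_punctured {x : X} (hx : x ∈ R.punctured) :
    x = s ∨ (∃ e t, x = R.edge e t) ∨ ∃ F z, z ≠ ctr ∧ ¬ K.trivD F ∧ x = R.disc F z := by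
  rcases R.surj x with h | h | ⟨F, z, rfl⟩
  · exact Or.inl h
  · exact Or.inr (Or.inl h)
  · by_cases hF : K.trivD F
    · exact Or.inl (R.disc_triv hF z)
    · refine Or.inr (Or.inr ⟨F, z, ?_, hF, rfl⟩)
      simpa [hF] using (R.disc_mem_punctured F z).1 hx

lemma continuousOn_of_cells [TopologicalSpace T] {h : X → T} {O : Set X} (hO : IsOpen O)
    (he : ∀ e, ContinuousOn (fun t => h (R.edge e t)) (R.edge e ⁻¹' O))
    (hd : ∀ F, ¬ K.trivD F → ContinuousOn (fun z => h (R.disc F z)) (R.disc F ⁻¹' O)) :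
    ContinuousOn h O := by
  rw [continuousOn_open_iff hO]
  intro t ht
  refine R.isOpen _ (fun e => ?_) (fun F => ?_)
  · exact (continuousOn_open_iff (hO.preimage (R.edge e).continuous)).1 (he e) t ht
  · have : ContinuousOn (fun z => h (R.disc F z)) (R.disc F ⁻¹' O) := by
      by_cases hF : K.trivD F
      · simp only [R.disc_triv hF]
        exact continuousOn_const
      · exact hd F hF
    exact (continuousOn_open_iff (hO.preimage (R.disc F).continuous)).1 this t ht

/-- Continuity of a function on an open subset of a nontrivial disc, given by a function of the
radial projection. -/
lemma continuousOn_disc_of_arcs [TopologicalSpace T] (F : K.Disc) (H : D2 → T) (P : D2 → Prop)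
    (hH : ∀ h k, k < (K.word F h).length →
      ContinuousOn (fun t => H (arc h (part (K.word F h).length k t)))
        {t | P (arc h (part (K.word F h).length k t))}) :
    ContinuousOn (fun z => H (rad z)) {z | z ≠ ctr ∧ P (rad z)} := by
  have h1 := continuousOn_circle (fun h => (K.word F h).length)
    (fun h => List.length_pos_iff.2 (K.word_ne_nil F h)) H {z | ‖z.1‖ = 1 ∧ P z} (fun z hz => hz.1)
    (fun h k hk => (hH h k hk).mono fun t ht => ht.2)
  exact h1.comp (continuousOn_rad.mono fun z hz => hz.1) fun z hz => ⟨norm_rad hz.1, hz.2⟩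

lemma disc_arc (F : K.Disc) {h : Bool} {k : ℕ} (hk : k < (K.word F h).length) (t : I) :
    R.disc F (arc h (part (K.word F h).length k t)) = R.edge (K.word F h)[k] t :=
  R.compat.bdry F h _ k hk t (onHalf_arc _ _) (by rw [pos_arc, part_mul hk])

/-- A radial function is continuous if it is so on the edges. -/
lemma IsRadial.continuousOn [TopologicalSpace T] {h : X → T} (hr : R.IsRadial h) {O : Set X}
    (hO : IsOpen O) (hOr : R.IsRadial O) (hOV : O ⊆ R.punctured)
    (he : ∀ e, ContinuousOn (fun t => h (R.edge e t)) (R.edge e ⁻¹' O)) : ContinuousOn h O := by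
  refine R.continuousOn_of_cells hO he fun F hF => ?_
  have h1 := continuousOn_disc_of_arcs F (fun z => h (R.disc F z)) (fun z => R.disc F z ∈ O)
    (fun b k hk => by
      simp only [R.disc_arc F hk]
      exact he _)
  have h0 : ∀ z, R.disc F z ∈ O → z ≠ ctr := fun z hz => by
    simpa [hF] using (R.disc_mem_punctured F z).1 (hOV hz)
  refine (h1.congr fun z hz => hr F z hz.1).mono fun z hz => ⟨h0 z hz, ?_⟩
  exact (iff_of_eq (hOr F z (h0 z hz))).1 hz

lemma isRadial_punctured : R.IsRadial (fun x => x ∈ R.punctured) := fun F z hz => by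
  simp [R.disc_mem_punctured, hz, ne_ctr_of_norm (norm_rad hz)]

/-- The part of the punctured complex in which a radial predicate holds is open if it is so on the
edges. -/
lemma IsRadial.isOpen {P : X → Prop} (hP : R.IsRadial P)
    (he : ∀ e, IsOpen {t | P (R.edge e t)}) : IsOpen {x | x ∈ R.punctured ∧ P x} := by
  have h1 : ContinuousOn P R.punctured := IsRadial.continuousOn R hP R.isOpen_punctured
    R.isRadial_punctured subset_rfl fun e => (continuous_Prop.2 (he e)).continuousOn
  have h2 := h1.isOpen_inter_preimage R.isOpen_punctured (isOpen_singleton_true)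
  have h3 : {x | x ∈ R.punctured ∧ P x} = R.punctured ∩ P ⁻¹' {True} := by
    ext x; simp
  rwa [h3]

end Realization

end TwoComplex

namespace TwoComplex

open Salvetti (D2)

/-! ### Homomorphisms out of the fundamental group of a complex with one vertex -/

/-- The midpoint of the unit interval. -/
def half : I := ⟨1 / 2, by norm_num, by norm_num⟩

lemma half_ne_zero : (0 : I) ≠ half := fun h => by simpa [half] using congrArg Subtype.val h

lemma half_ne_one : (1 : I) ≠ half := fun h => by
  have := congrArg Subtype.val h
  norm_num [half] at this

lemma lt_or_gt_of_ne_half {t : I} (h : t ≠ half) : (t : ℝ) < 1 / 2 ∨ (1 / 2 : ℝ) < t :=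
  lt_or_gt_of_ne fun h' => h (Subtype.ext h')

namespace Shape

variable {K : Shape} {G : Type} [Group G]

/-- The product of the values of `g` on those letters of `w` whose midpoint has been passed at the
time `p`. -/
def prefixProd {E : Type} (g : E → G) (w : List E) (p : ℝ) : G :=
  ((w.map g).take ⌊p * w.length + 1 / 2⌋₊).prod

lemma prefixProd_eq {E : Type} (g : E → G) {w : List E} {p : ℝ} {k : ℕ} (hk : k < w.length)
    {t : I} (ht : p * w.length = k + t) :
    prefixProd g w p = ((w.map g).take k).prod * (if (t : ℝ) < 1 / 2 then 1 else g w[k]) := by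
  have h0 := t.2.1
  have h1 := t.2.2
  unfold prefixProd
  split_ifs with h
  · have : ⌊p * w.length + 1 / 2⌋₊ = k := by
      rw [ht, Nat.floor_eq_iff (by positivity)]
      constructor <;> linarith
    rw [this, mul_one]
  · have : ⌊p * w.length + 1 / 2⌋₊ = k + 1 := by
      rw [ht, Nat.floor_eq_iff (by positivity)]
      push_cast
      constructor <;> linarith
    rw [this, List.prod_take_succ _ _ (by simpa using hk), List.getElem_map]

lemma prefixProd_zero {E : Type} (g : E → G) (w : List E) : prefixProd g w 0 = 1 := by
  have : ⌊(1 / 2 : ℝ)⌋₊ = 0 := Nat.floor_eq_zero.2 (by norm_num)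
  rw [prefixProd, zero_mul, zero_add, this]
  simp

lemma prefixProd_one {E : Type} (g : E → G) (w : List E) : prefixProd g w 1 = (w.map g).prod := by
  have : ⌊(1 : ℝ) * w.length + 1 / 2⌋₊ = w.length := by
    rw [Nat.floor_eq_iff (by positivity)]
    constructor <;> linarith
  rw [prefixProd, this, List.take_of_length_le (by simp)]

/-- The holonomy along the boundary circle of a disc, starting from `-1`. -/
def circleProd {E : Type} (g : E → G) (W : Bool → List E) (z : D2) : G :=
  if 0 ≤ z.1.im then prefixProd g (W true) (pos z) else prefixProd g (W false) (pos z)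

lemma circleProd_eq {E : Type} {g : E → G} {W : Bool → List E}
    (hW : ((W false).map g).prod = ((W true).map g).prod) {h : Bool} {z : D2}
    (hz : OnHalf h z) : circleProd g W z = prefixProd g (W h) (pos z) := by
  unfold circleProd
  cases h
  · split_ifs with him
    · have him0 : z.1.im = 0 := le_antisymm (by simpa using hz.2) him
      have hre : z.1.re * z.1.re = 1 := by
        have : z.1.re * z.1.re + z.1.im * z.1.im = 1 := by
          rw [← Complex.normSq_apply, Complex.normSq_eq_norm_sq, hz.1, one_pow]
        rwa [him0, mul_zero, add_zero] at this
      rcases mul_self_eq_one_iff.1 hre with hr | hr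
      · have : pos z = 1 := by rw [pos, hr]; norm_num
        rw [this, prefixProd_one, prefixProd_one, hW]
      · have : pos z = 0 := by rw [pos, hr]; norm_num
        rw [this, prefixProd_zero, prefixProd_zero]
    · rfl
  · rw [if_pos (by simpa using hz.2)]

/-- The inverse of the holonomy along the boundary, extended radially to the open discs. -/
def discProd (K : Shape) (g : K.Edge → G) (F : K.Disc) (z : D2) : G :=
  open Classical in
  if K.trivD F ∨ z = ctr ∨ ‖z.1‖ = 1 then 1 else (circleProd g (K.word F) (rad z))⁻¹

lemma compat_discProd (g : K.Edge → G) (hact : ∀ m e, g (K.actE m e) = g e)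
    (hrel : ∀ F, ((K.word F false).map g).prod = ((K.word F true).map g).prod) :
    K.Compat 1 (fun _ _ => 1) (K.discProd g) where
  zero _ := rfl
  one _ := rfl
  triv _ _ _ := rfl
  act _ _ _ := rfl
  trivD F z hF := if_pos (Or.inl hF)
  actD m F z := by
    by_cases h : K.trivD F ∨ z = ctr ∨ ‖z.1‖ = 1
    · exact (if_pos (by rwa [K.trivD_act])).trans (if_pos h).symm
    refine (if_neg (by rwa [K.trivD_act])).trans (Eq.trans ?_ (if_neg h).symm)
    have : g ∘ K.actE m = g := funext fun e => hact m e
    simp only [circleProd, prefixProd, K.word_act, List.map_map, this, List.length_map]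
  swap F z := by
    by_cases h : K.trivD F ∨ z = ctr ∨ ‖z.1‖ = 1
    · exact (if_pos (by rwa [K.trivD_swap, conj_eq_ctr, norm_conj_D2])).trans (if_pos h).symm
    · refine (if_neg (by rwa [K.trivD_swap, conj_eq_ctr, norm_conj_D2])).trans
        (Eq.trans ?_ (if_neg h).symm)
      have hz := norm_rad (not_or.1 (not_or.1 h).2).1
      have key : ∀ b, OnHalf b (rad z) → circleProd g (K.word (K.swap F)) (rad z.conj) =
          circleProd g (K.word F) (rad z) := by
        intro b hb
        rw [circleProd_eq (hrel F) hb, rad_conj, circleProd_eq (hrel _) (onHalf_conj hb),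
          K.word_swap, pos_conj, Bool.not_not]
      rcases onHalf_or hz with hb | hb
      · rw [key _ hb]
      · rw [key _ hb]
  bdry F h z k hk t hz _ := if_pos (Or.inr (Or.inr hz.1))

end Shape

namespace Realization

variable {K : Shape} {X : Type} [TopologicalSpace X] {s : X} (R : Realization K X s)

/-- The class of the loop given by an edge. -/
def loop (e : K.Edge) : FundamentalGroup X s :=
  FundamentalGroup.fromPath (Path.Homotopic.Quotient.mk
    ⟨R.edge e, R.compat.zero e, R.compat.one e⟩)

lemma edgeCompat_vertexStar :
    K.EdgeCompat True (fun e t => K.trivE e ∨ t ≠ half) where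
  zero e := by simp [half_ne_zero]
  one e := by simp [half_ne_one]
  triv e t h := by simp [h]
  act m e t := by simp [K.trivE_act]

lemma edgeCompat_edgeStar :
    K.EdgeCompat False (fun e t => ¬ K.trivE e ∧ t ≠ 0 ∧ t ≠ 1) where
  zero e := by simp
  one e := by simp
  triv e t h := by simp [h]
  act m e t := by simp [K.trivE_act]

lemma compat_openDisc :
    K.Compat False (fun _ _ => False) (fun F z => ¬ K.trivD F ∧ ‖z.1‖ ≠ 1) where
  zero _ := rfl
  one _ := rfl
  triv _ _ _ := rfl
  act _ _ _ := rfl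
  trivD F z h := by simp [h]
  actD m F z := by simp only [K.trivD_act]
  swap F z := by simp only [K.trivD_swap, norm_conj_D2]
  bdry F h z k hk t hz _ := by simp [hz.1]

/-- The radial predicate which holds on the 1-skeleton away from the midpoints of the nontrivial
edges. -/
def nearVertex : X → Prop := (R.exists_radial edgeCompat_vertexStar).choose

/-- The radial predicate which holds on the 1-skeleton at the inner points of nontrivial edges. -/
def nearEdge : X → Prop := (R.exists_radial edgeCompat_edgeStar).choose

lemma nearVertex_spec : R.nearVertex s = True ∧
    (∀ e t, R.nearVertex (R.edge e t) = (K.trivE e ∨ t ≠ half)) ∧ R.IsRadial R.nearVertex :=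
  (R.exists_radial edgeCompat_vertexStar).choose_spec

lemma nearEdge_spec : R.nearEdge s = False ∧
    (∀ e t, R.nearEdge (R.edge e t) = (¬ K.trivE e ∧ t ≠ 0 ∧ t ≠ 1)) ∧ R.IsRadial R.nearEdge :=
  (R.exists_radial edgeCompat_edgeStar).choose_spec

/-- An open neighbourhood of the vertex: points whose radial projection is not the midpoint of
a nontrivial edge. -/
def vertexStar : Set X := {x | x ∈ R.punctured ∧ R.nearVertex x}

/-- The points whose radial projection is in an open nontrivial edge. -/
def edgeStar : Set X := {x | x ∈ R.punctured ∧ R.nearEdge x}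

/-- The union of the open nontrivial discs. -/
def openDiscs : Set X := {x | (R.lift compat_openDisc).choose x}

lemma base_mem_vertexStar : s ∈ R.vertexStar :=
  ⟨R.base_mem_punctured, by rw [R.nearVertex_spec.1]; trivial⟩

lemma edge_mem_vertexStar {e : K.Edge} {t : I} :
    R.edge e t ∈ R.vertexStar ↔ K.trivE e ∨ t ≠ half :=
  ⟨fun h => (iff_of_eq (R.nearVertex_spec.2.1 e t)).1 h.2,
    fun h => ⟨R.edge_mem_punctured e t, (iff_of_eq (R.nearVertex_spec.2.1 e t)).2 h⟩⟩

lemma edge_mem_edgeStar {e : K.Edge} {t : I} :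
    R.edge e t ∈ R.edgeStar ↔ ¬ K.trivE e ∧ t ≠ 0 ∧ t ≠ 1 :=
  ⟨fun h => (iff_of_eq (R.nearEdge_spec.2.1 e t)).1 h.2,
    fun h => ⟨R.edge_mem_punctured e t, (iff_of_eq (R.nearEdge_spec.2.1 e t)).2 h⟩⟩

lemma edge_notMem_openDiscs (e : K.Edge) (t : I) : R.edge e t ∉ R.openDiscs := fun h =>
  (iff_of_eq ((R.lift compat_openDisc).choose_spec.2.1 e t)).1 h

lemma disc_mem_openDiscs {F : K.Disc} {z : D2} :
    R.disc F z ∈ R.openDiscs ↔ ¬ K.trivD F ∧ ‖z.1‖ ≠ 1 :=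
  iff_of_eq ((R.lift compat_openDisc).choose_spec.2.2 F z)

lemma isOpen_vertexStar : IsOpen R.vertexStar := by
  refine R.nearVertex_spec.2.2.isOpen _ fun e => ?_
  simp only [R.nearVertex_spec.2.1]
  by_cases h : K.trivE e
  · simp [h]
  · simp only [h, false_or]
    exact isOpen_ne

lemma isOpen_edgeStar : IsOpen R.edgeStar := by
  refine R.nearEdge_spec.2.2.isOpen _ fun e => ?_
  simp only [R.nearEdge_spec.2.1]
  by_cases h : K.trivE e
  · simp [h]
  · simp only [h, not_false_eq_true, true_and]
    exact isOpen_ne.inter isOpen_ne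

lemma isOpen_openDiscs : IsOpen R.openDiscs := by
  refine R.isOpen _ (fun e => ?_) (fun F => ?_)
  · have : R.edge e ⁻¹' R.openDiscs = ∅ :=
      eq_empty_of_forall_notMem fun t => R.edge_notMem_openDiscs e t
    rw [this]; exact isOpen_empty
  · by_cases hF : K.trivD F
    · have : R.disc F ⁻¹' R.openDiscs = ∅ := eq_empty_of_forall_notMem fun z h =>
        (R.disc_mem_openDiscs.1 h).1 hF
      rw [this]; exact isOpen_empty
    · have : R.disc F ⁻¹' R.openDiscs = {z | ‖z.1‖ ≠ 1} := by
        ext z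
        simp [R.disc_mem_openDiscs, hF]
      rw [this]
      exact isOpen_ne.preimage (continuous_norm.comp continuous_subtype_val)

lemma isRadial_vertexStar : R.IsRadial (fun x => x ∈ R.vertexStar) := fun F z hz =>
  congrArg₂ And (R.isRadial_punctured F z hz) (R.nearVertex_spec.2.2 F z hz)

lemma isRadial_edgeStar : R.IsRadial (fun x => x ∈ R.edgeStar) := fun F z hz =>
  congrArg₂ And (R.isRadial_punctured F z hz) (R.nearEdge_spec.2.2 F z hz)

lemma mem_star (x : X) : x ∈ R.vertexStar ∨ x ∈ R.edgeStar ∨ x ∈ R.openDiscs := by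
  have he : ∀ e t, R.edge e t ∈ R.vertexStar ∨ R.edge e t ∈ R.edgeStar := by
    intro e t
    by_cases h : K.trivE e ∨ t ≠ half
    · exact Or.inl (R.edge_mem_vertexStar.2 h)
    · push Not at h
      refine Or.inr (R.edge_mem_edgeStar.2 ⟨h.1, ?_, ?_⟩)
      · rw [h.2]; exact half_ne_zero.symm
      · rw [h.2]; exact half_ne_one.symm
  rcases R.surj x with rfl | ⟨e, t, rfl⟩ | ⟨F, z, rfl⟩
  · exact Or.inl R.base_mem_vertexStar
  · exact (he e t).imp_right Or.inl
  · by_cases hF : K.trivD F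
    · rw [R.disc_triv hF]
      exact Or.inl R.base_mem_vertexStar
    · by_cases hz : ‖z.1‖ = 1
      · obtain ⟨e, t, h⟩ := R.exists_edge_of_norm F hz
        rw [h]
        exact (he e t).imp_right Or.inl
      · exact Or.inr (Or.inr (R.disc_mem_openDiscs.2 ⟨hF, hz⟩))

lemma eventually_eq_of_continuousOn {Y G : Type} [TopologicalSpace Y] {f : Y → G} {O : Set Y}
    (hO : IsOpen O) (hf : letI : TopologicalSpace G := ⊥; ContinuousOn f O) {y : Y} (hy : y ∈ O) :
    ∀ᶠ y' in 𝓝 y, f y' = f y := by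
  let _ : TopologicalSpace G := ⊥
  have : DiscreteTopology G := ⟨rfl⟩
  have h : ContinuousAt f y := ContinuousOn.continuousAt hf (hO.mem_nhds hy)
  rwa [ContinuousAt, nhds_discrete G, Filter.tendsto_pure] at h

lemma continuousOn_bot_of_eventually {Y G : Type} [TopologicalSpace Y] {f : Y → G} {O : Set Y}
    (hf : ∀ y ∈ O, ∀ᶠ y' in 𝓝 y, f y' = f y) :
    letI : TopologicalSpace G := ⊥; ContinuousOn f O := by
  let _ : TopologicalSpace G := ⊥
  intro y hy
  exact (tendsto_nhds_of_eventually_eq (hf y hy)).mono_left nhdsWithin_le_nhds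

lemma eventually_lt_half {t : I} (ht : (t : ℝ) < 1 / 2) : ∀ᶠ t' in 𝓝 t, ((t' : I) : ℝ) < 1 / 2 :=
  continuous_subtype_val.continuousAt.eventually (eventually_lt_nhds ht)

lemma eventually_gt_half {t : I} (ht : (1 / 2 : ℝ) < t) :
    ∀ᶠ t' in 𝓝 t, (1 / 2 : ℝ) < ((t' : I) : ℝ) :=
  continuous_subtype_val.continuousAt.eventually (eventually_gt_nhds ht)

/-- A function on the edges with values in a group, trivial on trivial edges, invariant under the
symmetries, and with equal products along the two boundary paths of each disc, extends to
a homomorphism on the fundamental group. It is the monodromy of the covering with fibre `G` which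
is trivial over `vertexStar`, `edgeStar` and `openDiscs`. -/
theorem exists_hom {G : Type} [Group G] (g : K.Edge → G) (hact : ∀ m e, g (K.actE m e) = g e)
    (htriv : ∀ e, K.trivE e → g e = 1)
    (hrel : ∀ F, ((K.word F false).map g).prod = ((K.word F true).map g).prod) :
    ∃ φ : (FundamentalGroup X s)ᵐᵒᵖ →* G, ∀ e, φ (op (R.loop e)) = g e := by
  classical
  -- `a` is locally constant on an open edge except at the midpoint, which is not in `vertexStar`,
  -- where it jumps by `(g e)⁻¹`; its value at the end is immaterial, but has to be `1` to descend
  let a : K.Edge → I → G := fun e t =>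
    if K.trivE e ∨ (t : ℝ) < 1 / 2 ∨ t = 1 then 1 else (g e)⁻¹
  have ha : K.EdgeCompat 1 a :=
    { zero := fun e => if_pos (Or.inr (Or.inl (by simp)))
      one := fun e => if_pos (Or.inr (Or.inr rfl))
      triv := fun e t h => if_pos (Or.inl h)
      act := fun m e t => by simp only [a, K.trivE_act, hact] }
  obtain ⟨f₁, f₁s, f₁e, f₁r⟩ := R.exists_radial ha
  obtain ⟨f₂, f₂s, f₂e, f₂d⟩ := R.lift (Shape.compat_discProd g hact hrel)
  have ha' : ∀ e (t : I), t ≠ 1 → a e t = if (t : ℝ) < 1 / 2 then 1 else (g e)⁻¹ := by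
    intro e t ht
    by_cases h : K.trivE e
    · simp [a, h, htriv e h]
    · simp [a, h, ht]
  have hf₂ : ∀ F z, R.disc F z ∈ R.openDiscs → z ≠ ctr →
      f₂ (R.disc F z) = (Shape.circleProd g (K.word F) (rad z))⁻¹ := by
    intro F z h hz
    obtain ⟨h1, h2⟩ := R.disc_mem_openDiscs.1 h
    rw [f₂d, Shape.discProd, if_neg (by simp [h1, h2, hz])]
  have hne : ∀ F z, ¬ K.trivD F → R.disc F z ∈ R.punctured → z ≠ ctr := fun F z hF h => by
    simpa [hF] using (R.disc_mem_punctured F z).1 h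
  let _ : TopologicalSpace G := ⊥
  have : DiscreteTopology G := ⟨rfl⟩
  -- the transition functions are locally constant
  have c01 : ContinuousOn f₁ (R.vertexStar ∩ R.edgeStar) := by
    refine IsRadial.continuousOn R f₁r (R.isOpen_vertexStar.inter R.isOpen_edgeStar)
      (fun F z hz => ?_) (fun x hx => hx.1.1) (fun e => ?_)
    · exact congrArg₂ And (R.isRadial_vertexStar F z hz) (R.isRadial_edgeStar F z hz)
    · refine continuousOn_bot_of_eventually fun t ht => ?_
      obtain ⟨h1, -, h3⟩ := R.edge_mem_edgeStar.1 ht.2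
      have h4 : t ≠ half := (R.edge_mem_vertexStar.1 ht.1).resolve_left h1
      rcases lt_or_gt_of_ne_half h4 with h5 | h5
      · filter_upwards [eventually_lt_half h5, isOpen_ne.mem_nhds h3] with t' h6 h7
        rw [f₁e, f₁e, ha' _ _ h3, ha' _ _ h7, if_pos h5, if_pos h6]
      · filter_upwards [eventually_gt_half h5, isOpen_ne.mem_nhds h3] with t' h6 h7
        rw [f₁e, f₁e, ha' _ _ h3, ha' _ _ h7, if_neg h5.not_gt, if_neg h6.not_gt]
  have c20 : ContinuousOn (fun x => (f₂ x)⁻¹) (R.openDiscs ∩ R.vertexStar) := by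
    refine R.continuousOn_of_cells (R.isOpen_openDiscs.inter R.isOpen_vertexStar)
      (fun e t ht => absurd ht.1 (R.edge_notMem_openDiscs e t)) fun F hF => ?_
    have h1 := continuousOn_disc_of_arcs F (Shape.circleProd g (K.word F))
      (fun z => R.disc F z ∈ R.vertexStar) (fun b k hk => by
        simp only [R.disc_arc F hk, R.edge_mem_vertexStar]
        refine continuousOn_bot_of_eventually fun t ht => ?_
        have h2 : ∀ t : I, _ := fun t =>
          (Shape.circleProd_eq (hrel F) (onHalf_arc b (part (K.word F b).length k t))).trans
            (Shape.prefixProd_eq g hk (by rw [pos_arc, part_mul hk]))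
        simp only [h2]
        rcases ht with ht | ht
        · simp [htriv _ ht]
        · rcases lt_or_gt_of_ne_half ht with h5 | h5
          · filter_upwards [eventually_lt_half h5] with t' h6
            rw [if_pos h5, if_pos h6]
          · filter_upwards [eventually_gt_half h5] with t' h6
            rw [if_neg h5.not_gt, if_neg h6.not_gt])
    refine (h1.mono fun z hz => ?_).congr fun z hz => ?_
    · have hz0 := hne F z hF hz.2.1
      exact ⟨hz0, (iff_of_eq (R.isRadial_vertexStar F z hz0)).1 hz.2⟩
    · rw [hf₂ F z hz.1 (hne F z hF hz.2.1), inv_inv]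
  have c21 : ContinuousOn (fun x => (f₂ x)⁻¹ * f₁ x) (R.openDiscs ∩ R.edgeStar) := by
    refine R.continuousOn_of_cells (R.isOpen_openDiscs.inter R.isOpen_edgeStar)
      (fun e t ht => absurd ht.1 (R.edge_notMem_openDiscs e t)) fun F hF => ?_
    have h1 := continuousOn_disc_of_arcs F
      (fun z => Shape.circleProd g (K.word F) z * f₁ (R.disc F z))
      (fun z => R.disc F z ∈ R.edgeStar) (fun b k hk => by
        simp only [R.disc_arc F hk, R.edge_mem_edgeStar]
        have h2 : ∀ t : I, _ := fun t =>
          (Shape.circleProd_eq (hrel F) (onHalf_arc b (part (K.word F b).length k t))).trans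
            (Shape.prefixProd_eq g hk (by rw [pos_arc, part_mul hk]))
        refine (continuousOn_const (c := (((K.word F b).map g).take k).prod)).congr fun t ht => ?_
        simp only [h2, f₁e, ha' _ _ ht.2.2]
        split_ifs <;> simp)
    refine (h1.mono fun z hz => ?_).congr fun z hz => ?_
    · have hz0 := hne F z hF hz.2.1
      exact ⟨hz0, (iff_of_eq (R.isRadial_edgeStar F z hz0)).1 hz.2⟩
    · have hz0 := hne F z hF hz.2.1
      simp only
      rw [hf₂ F z hz.1 hz0, inv_inv, f₁r F z hz0]
  -- flat sections are constant over `vertexStar`, constant multiples of `f₁⁻¹` over `edgeStar`, and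
  -- constant multiples of the holonomy `f₂⁻¹` over `openDiscs`
  let U : Fin 3 → Set X := ![R.vertexStar, R.edgeStar, R.openDiscs]
  let f : Fin 3 → X → G := ![fun _ => 1, f₁, f₂]
  have hU : ∀ i, IsOpen (U i) := by
    intro i
    fin_cases i
    exacts [R.isOpen_vertexStar, R.isOpen_edgeStar, R.isOpen_openDiscs]
  have hcov : ∀ x, ∃ i, x ∈ U i := by
    intro x
    rcases R.mem_star x with h | h | h
    exacts [⟨0, h⟩, ⟨1, h⟩, ⟨2, h⟩]
  have hcont : ∀ i j, ContinuousOn (fun x => (f i x)⁻¹ * f j x) (U i ∩ U j) := by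
    have hsymm : ∀ i j, ContinuousOn (fun x => (f i x)⁻¹ * f j x) (U i ∩ U j) →
        ContinuousOn (fun x => (f j x)⁻¹ * f i x) (U j ∩ U i) := by
      intro i j h
      rw [inter_comm]
      refine h.inv.congr fun x _ => ?_
      simp
    have hself : ∀ i, ContinuousOn (fun x => (f i x)⁻¹ * f i x) (U i ∩ U i) := by
      intro i
      simp only [inv_mul_cancel]
      exact continuousOn_const
    have h01 : ContinuousOn (fun x => (f 0 x)⁻¹ * f 1 x) (U 0 ∩ U 1) :=
      c01.congr fun x _ => by simp [f]
    have h20 : ContinuousOn (fun x => (f 2 x)⁻¹ * f 0 x) (U 2 ∩ U 0) :=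
      c20.congr fun x _ => by simp [f]
    have h21 : ContinuousOn (fun x => (f 2 x)⁻¹ * f 1 x) (U 2 ∩ U 1) :=
      c21.congr fun x _ => by simp [f]
    intro i j
    fin_cases i <;> fin_cases j
    exacts [hself 0, h01, hsymm _ _ h20, hsymm _ _ h01, hself 1, hsymm _ _ h21, h20, h21, hself 2]
  obtain ⟨φ, hφ⟩ := exists_monodromy_hom s U hU hcov f fun i j x hx =>
    eventually_eq_of_continuousOn ((hU i).inter (hU j)) (hcont i j) hx
  refine ⟨φ, fun e => ?_⟩
  -- a flat section along an edge jumps from `1` to `g e` at the midpoint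
  by_cases he : K.trivE e
  · rw [htriv e he]
    refine hφ ⟨R.edge e, R.compat.zero e, R.compat.one e⟩ (fun _ => 1) (fun t => ⟨0, ?_, ?_⟩) rfl
    · exact R.edge_mem_vertexStar.2 (Or.inl he)
    · exact Filter.Eventually.of_forall fun _ => rfl
  · refine (hφ ⟨R.edge e, R.compat.zero e, R.compat.one e⟩
      (fun t => if (t : ℝ) < 1 / 2 then 1 else g e) (fun t => ?_) (if_pos (by simp))).trans
      (if_neg (by norm_num))
    by_cases ht : t = half
    · subst ht
      refine ⟨1, R.edge_mem_edgeStar.2 ⟨he, half_ne_zero.symm, half_ne_one.symm⟩, ?_⟩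
      have key : ∀ t : I, t ≠ 1 → (if (t : ℝ) < 1 / 2 then 1 else g e) * f 1 (R.edge e t) = 1 := by
        intro t ht
        change _ * f₁ (R.edge e t) = 1
        rw [f₁e, ha' e t ht]
        split_ifs <;> simp
      filter_upwards [isOpen_ne.mem_nhds half_ne_one.symm] with t' ht'
      exact (key t' ht').trans (key half half_ne_one.symm).symm
    · refine ⟨0, R.edge_mem_vertexStar.2 (Or.inr ht), ?_⟩
      rcases lt_or_gt_of_ne_half ht with h5 | h5
      · filter_upwards [eventually_lt_half h5] with t' h6
        change _ * (1 : G) = _ * 1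
        rw [if_pos h5, if_pos h6]
      · filter_upwards [eventually_gt_half h5] with t' h6
        change _ * (1 : G) = _ * 1
        rw [if_neg h5.not_gt, if_neg h6.not_gt]

end Realization

end TwoComplex

namespace TwoComplex

open Salvetti (D2)

/-! ### Generation of the fundamental group by the edge loops -/

/-- The affine path in the unit interval from `t` to `t'`. -/
def line (t t' : I) : C(I, I) where
  toFun u := ⟨(1 - u) * t + u * t',
    (convex_Icc (0 : ℝ) 1) t.2 t'.2 (by linarith [u.2.2]) u.2.1 (by ring)⟩
  continuous_toFun := by
    refine Continuous.subtype_mk ?_ _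
    fun_prop

lemma coe_line (t t' u : I) : (line t t' u : ℝ) = (1 - u) * t + u * t' := rfl

lemma line_zero (t t' : I) : line t t' 0 = t := Subtype.ext (by simp [coe_line])

lemma line_one (t t' : I) : line t t' 1 = t' := Subtype.ext (by simp [coe_line])

lemma line_self (t u : I) : line t t u = t := Subtype.ext (by rw [coe_line]; ring)

lemma continuous_line : Continuous fun p : (I × I) × I => line p.1.1 p.1.2 p.2 := by
  refine Continuous.subtype_mk ?_ _
  fun_prop

instance : SimplyConnectedSpace (I × I) :=
  haveI : ContractibleSpace (I × I) := by
    refine (contractible_iff_id_nullhomotopic _).2 ⟨(0, 0), ⟨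
      { toFun := fun p => (line p.2.1 0 p.1, line p.2.2 0 p.1)
        continuous_toFun := ?_
        map_zero_left := fun x => by simp [line_zero]
        map_one_left := fun x => by simp [line_one] }⟩⟩
    exact (continuous_line.comp (g := fun p : (I × I) × I => line p.1.1 p.1.2 p.2)
      (f := fun p : I × (I × I) => ((p.2.1, 0), p.1)) (by fun_prop)).prodMk
      (continuous_line.comp (g := fun p : (I × I) × I => line p.1.1 p.1.2 p.2)
      (f := fun p : I × (I × I) => ((p.2.2, 0), p.1)) (by fun_prop))
  SimplyConnectedSpace.ofContractible _

open Path.Homotopic (Quotient)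

section Seg

variable {X A B : Type} [TopologicalSpace X] [TopologicalSpace A] [TopologicalSpace B]
  [SimplyConnectedSpace A] [SimplyConnectedSpace B]

/-- The class of the image under `f` of any path from `a` to `b` in the simply connected
space `A`. -/
def seg (f : C(A, X)) (a b : A) : Path.Homotopic.Quotient (f a) (f b) :=
  (Path.Homotopic.Quotient.mk (PathConnectedSpace.somePath a b)).map f

lemma map_eq_seg (f : C(A, X)) {a b : A} (q : Path.Homotopic.Quotient a b) :
    q.map f = seg f a b := by
  rw [seg, Subsingleton.elim q]

lemma seg_trans (f : C(A, X)) (a b c : A) : (seg f a b).trans (seg f b c) = seg f a c := by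
  rw [← map_eq_seg f ((Path.Homotopic.Quotient.mk (PathConnectedSpace.somePath a b)).trans
    (Path.Homotopic.Quotient.mk (PathConnectedSpace.somePath b c)))]
  unfold seg
  rw [← Path.Homotopic.Quotient.mk_trans, ← Path.Homotopic.Quotient.mk_map,
    ← Path.Homotopic.Quotient.mk_map, ← Path.Homotopic.Quotient.mk_map, Path.map_trans,
    Path.Homotopic.Quotient.mk_trans]

lemma seg_self (f : C(A, X)) (a : A) : seg f a a = Path.Homotopic.Quotient.refl (f a) := by
  rw [← map_eq_seg f (Path.Homotopic.Quotient.refl a)]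
  rfl

lemma seg_comp (f : C(A, X)) (k : C(B, A)) (b b' : B) :
    seg (f.comp k) b b' = seg f (k b) (k b') := by
  rw [← map_eq_seg f ((Path.Homotopic.Quotient.mk (PathConnectedSpace.somePath b b')).map k)]
  exact Path.Homotopic.Quotient.map_comp

lemma seg_const (x : X) (a b : A) :
    seg (ContinuousMap.const A x) a b = Path.Homotopic.Quotient.refl x := by
  unfold seg
  rw [← Path.Homotopic.Quotient.mk_map]
  exact congrArg Path.Homotopic.Quotient.mk (Path.ext (funext fun _ => rfl))

lemma seg_path (f : C(I, X)) : seg f 0 1 = Path.Homotopic.Quotient.mk ⟨f, rfl, rfl⟩ := by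
  rw [← map_eq_seg f (Path.Homotopic.Quotient.mk (⟨ContinuousMap.id I, rfl, rfl⟩ : Path (0 : I) 1))]
  rfl

lemma seg_path' {x y : X} (p : Path x y) :
    seg p.toContinuousMap 0 1 = (Path.Homotopic.Quotient.mk p).cast p.source p.target := by
  rw [seg_path]
  rfl

lemma cast_trans {x y z x' y' z' : X} (p : Path.Homotopic.Quotient x y)
    (q : Path.Homotopic.Quotient y z) (hx : x' = x) (hy : y' = y) (hz : z' = z) :
    (p.cast hx hy).trans (q.cast hy hz) = (p.trans q).cast hx hz := by
  subst hx hy hz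
  simp

end Seg

namespace Realization

variable {K : Shape} {X : Type} [TopologicalSpace X] {s : X} (R : Realization K X s)

/-- The homotopy classes of paths that are composed of paths within closed cells. -/
inductive CellPath : ∀ {x y : X}, Path.Homotopic.Quotient x y → Prop
  | refl (x : X) : CellPath (Path.Homotopic.Quotient.refl x)
  | edge (e : K.Edge) (t t' : I) : CellPath (seg (R.edge e) t t')
  | disc (F : K.Disc) (z z' : D2) : CellPath (seg (R.disc F) z z')
  | trans {x y z : X} {p : Path.Homotopic.Quotient x y} {q : Path.Homotopic.Quotient y z} :
      CellPath p → CellPath q → CellPath (p.trans q)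

variable {R} in
lemma CellPath.cast {x y x' y' : X} {p : Path.Homotopic.Quotient x y} (hp : R.CellPath p)
    (hx : x' = x) (hy : y' = y) : R.CellPath (p.cast hx hy) := by
  subst hx hy
  simpa using hp

/-- The path given by `f` is homotopic to a composition of paths within closed cells. -/
def Cellular (f : C(I, X)) : Prop := ∀ t t', R.CellPath (seg f t t')

lemma cellular_const (x : X) : R.Cellular (ContinuousMap.const I x) := fun t t' => by
  rw [seg_const]
  exact CellPath.refl _

lemma cellular_edge (e : K.Edge) (k : C(I, I)) : R.Cellular ((R.edge e).comp k) := fun t t' => by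
  rw [seg_comp]
  exact CellPath.edge _ _ _

lemma cellular_disc (F : K.Disc) (k : C(I, D2)) : R.Cellular ((R.disc F).comp k) := fun t t' => by
  rw [seg_comp]
  exact CellPath.disc _ _ _

lemma cellular_of_locConst {f : C(I, X)} (hf : ∀ t, ∀ᶠ t' in 𝓝 t, f t' = f t) : R.Cellular f := by
  have h := (IsLocallyConstant.iff_eventually_eq f).2 hf
  have : f = ContinuousMap.const I (f 0) := by
    ext t
    exact h.apply_eq_of_isPreconnected isPreconnected_univ (mem_univ _) (mem_univ _)
  rw [this]
  exact R.cellular_const _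

/-- The path at the beginning of a homotopy is cellular if the path at its end and the tracks of
the homotopy are. -/
lemma cellular_of_homotopy (Φ : C(I, C(I, X))) (h1 : ∀ t, R.Cellular (Φ t))
    {f g : C(I, X)} (hf : ∀ t, f t = Φ t 0) (hg : ∀ t, g t = Φ t 1) (hgc : R.Cellular g) :
    R.Cellular f := by
  intro t t'
  let Ψ : C(I × I, X) := Φ.uncurry
  have e1 : f = Ψ.comp ⟨fun t => (t, 0), by fun_prop⟩ := by ext t; exact hf t
  have e2 : g = Ψ.comp ⟨fun t => (t, 1), by fun_prop⟩ := by ext t; exact hg t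
  have e3 : ∀ t, Φ t = Ψ.comp ⟨fun u => (t, u), by fun_prop⟩ := fun t => by ext u; rfl
  have k1 := h1 t 0 1
  have k2 := h1 t' 1 0
  have k3 := hgc t t'
  rw [e3, seg_comp] at k1 k2
  rw [e2, seg_comp] at k3
  rw [e1, seg_comp]
  have k13 : R.CellPath ((seg Ψ (t, 0) (t, 1)).trans (seg Ψ (t, 1) (t', 1))) := k1.trans k3
  have : R.CellPath (((seg Ψ (t, 0) (t, 1)).trans (seg Ψ (t, 1) (t', 1))).trans
    (seg Ψ (t', 1) (t', 0))) := k13.trans k2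
  rw [seg_trans, seg_trans] at this
  exact this

/-- Paths in an open set `O` are cellular up to a deformation of `O`, with cellular tracks, to
a set of isolated points. -/
lemma cellular_of_contraction {O : Set X} (h : X → C(I, X))
    (hc : ContinuousOn h O) (ε : X → X) (hε : ∀ x ∈ O, h x 1 = ε x)
    (hεc : ∀ x ∈ O, ∀ᶠ y in 𝓝 x, ε y = ε x) (ht : ∀ x ∈ O, R.Cellular (h x))
    {f g : C(I, X)} (hf : ∀ t, f t ∈ O) (hg : ∀ t, g t = h (f t) 0) : R.Cellular g := by
  have hΦ : Continuous fun t => h (f t) := hc.comp_continuous f.continuous hf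
  have hΦ1 : Continuous fun t => h (f t) 1 := (continuous_eval_const 1).comp hΦ
  refine R.cellular_of_homotopy ⟨_, hΦ⟩ (fun t => ht _ (hf t)) hg (g := ⟨_, hΦ1⟩)
    (fun t => rfl) (R.cellular_of_locConst fun t => ?_)
  filter_upwards [f.continuous.continuousAt.eventually (hεc _ (hf t))] with t' ht'
  change h (f t') 1 = h (f t) 1
  rw [hε _ (hf t'), hε _ (hf t), ht']

/-- The radial push-off of the punctured discs to their boundaries. -/
lemma exists_pushOff : ∃ ρ : X → C(I, X), (∀ x ∈ R.punctured, ρ x 0 = x) ∧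
    (∀ x ∈ R.punctured, R.Cellular (ρ x)) ∧ ContinuousOn ρ R.punctured ∧
    ρ s 1 = s ∧ (∀ e t, ρ (R.edge e t) 1 = R.edge e t) ∧
    ∀ F z, ¬ K.trivD F → ρ (R.disc F z) 1 = R.disc F (rad z) := by
  classical
  let b : K.Disc → D2 → C(I, X) := fun F z =>
    if K.trivD F then ContinuousMap.const I s else
      (R.disc F).comp ⟨fun u => mix z (rad z) u,
        continuous_mix.comp (f := fun u : I => ((z, rad z), u)) (by fun_prop)⟩
  have hb : K.Compat (ContinuousMap.const I s) (fun e t => ContinuousMap.const I (R.edge e t)) b :=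
    { zero := fun e => by rw [R.compat.zero]
      one := fun e => by rw [R.compat.one]
      triv := fun e t he => by rw [R.compat.triv e t he]
      act := fun m e t => by rw [R.compat.act m e t]
      trivD := fun F z hF => if_pos hF
      actD := fun m F z => by
        simp only [b, K.trivD_act]
        congr 2
        ext z
        exact R.compat.actD m F z
      swap := fun F z => by
        simp only [b, K.trivD_swap]
        split_ifs with h
        · rfl
        · ext u
          change R.disc _ (mix _ _ u) = R.disc _ (mix _ _ u)
          rw [rad_conj, ← mix_conj]
          exact R.compat.swap F _
      bdry := fun F h z k hk t hz ht => by
        ext u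
        have e1 := R.compat.bdry F h z k hk t hz ht
        refine Eq.trans ?_ e1
        simp only [b]
        split_ifs with hF
        · exact (R.disc_triv hF z).symm
        · change R.disc F (mix z (rad z) u) = _
          rw [rad_of_norm hz.1, mix_self] }
  obtain ⟨ρ, ρs, ρe, ρd⟩ := R.lift hb
  have ρd' : ∀ F z, ¬ K.trivD F → ρ (R.disc F z) = (R.disc F).comp ⟨fun u => mix z (rad z) u,
        continuous_mix.comp (f := fun u : I => ((z, rad z), u)) (by fun_prop)⟩ := fun F z h =>
    (ρd F z).trans (if_neg h)
  refine ⟨ρ, fun x hx => ?_, fun x hx => ?_, ?_, ?_, ?_, ?_⟩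
  · rcases R.eq_edge_of_mem_punctured hx with rfl | ⟨e, t, rfl⟩ | ⟨F, z, hz, hF, rfl⟩
    · rw [ρs]; rfl
    · rw [ρe]; rfl
    · rw [ρd' F z hF]
      change R.disc F (mix _ _ 0) = _
      rw [mix_zero]
  · rcases R.eq_edge_of_mem_punctured hx with rfl | ⟨e, t, rfl⟩ | ⟨F, z, hz, hF, rfl⟩
    · rw [ρs]; exact R.cellular_const _
    · rw [ρe]; exact R.cellular_const _
    · rw [ρd' F z hF]; exact R.cellular_disc _ _
  · refine R.continuousOn_of_cells R.isOpen_punctured (fun e => ?_) (fun F hF => ?_)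
    · simp only [ρe]
      refine Continuous.continuousOn (ContinuousMap.continuous_of_continuous_uncurry _ ?_)
      exact (R.edge e).continuous.comp continuous_fst
    · simp only [ρd' F _ hF]
      refine ContinuousMap.continuousOn_of_continuousOn_uncurry _ ?_
      have h1 : ContinuousOn (fun p : D2 × I => mix p.1 (rad p.1) p.2) ({z | z ≠ ctr} ×ˢ univ) := by
        refine continuous_mix.comp_continuousOn (s := {z | z ≠ ctr} ×ˢ univ)
          (f := fun p : D2 × I => ((p.1, rad p.1), p.2)) ?_
        exact (continuousOn_fst.prodMk (continuousOn_rad.comp continuousOn_fst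
          fun p hp => hp.1)).prodMk continuousOn_snd
      refine ((R.disc F).continuous.comp_continuousOn h1).mono ?_
      rintro ⟨z, u⟩ ⟨hz, -⟩
      refine ⟨?_, mem_univ _⟩
      simpa [hF] using (R.disc_mem_punctured F z).1 hz
  · rw [ρs]; rfl
  · intro e t
    rw [ρe]; rfl
  · intro F z hF
    rw [ρd' F z hF]
    change R.disc F (mix _ _ 1) = _
    rw [mix_one]

lemma IsRadial.eventually_eq {T : Type} {h : X → T} (hr : R.IsRadial h) {O : Set X}
    (hO : IsOpen O) (hOr : R.IsRadial O) (hOV : O ⊆ R.punctured)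
    (he : ∀ e, ∃ c, ∀ t, R.edge e t ∈ O → h (R.edge e t) = c) :
    ∀ x ∈ O, ∀ᶠ y in 𝓝 x, h y = h x := by
  refine fun x hx => eventually_eq_of_continuousOn hO ?_ hx
  let _ : TopologicalSpace T := ⊥
  refine hr.continuousOn R hO hOr hOV fun e => ?_
  obtain ⟨c, hc⟩ := he e
  exact (continuousOn_const (c := c)).congr hc

lemma eventually_eq_of_discs {T : Type} {h : X → T}
    (hd : ∀ F, ∃ c, ∀ z, R.disc F z ∈ R.openDiscs → h (R.disc F z) = c) :
    ∀ x ∈ R.openDiscs, ∀ᶠ y in 𝓝 x, h y = h x := by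
  refine fun x hx => eventually_eq_of_continuousOn R.isOpen_openDiscs ?_ hx
  let _ : TopologicalSpace T := ⊥
  refine R.continuousOn_of_cells R.isOpen_openDiscs
    (fun e t ht => absurd ht (R.edge_notMem_openDiscs e t)) fun F hF => ?_
  obtain ⟨c, hc⟩ := hd F
  exact (continuousOn_const (c := c)).congr hc

lemma continuous_comp_line (e : K.Edge) (t' : I) :
    Continuous fun t => (R.edge e).comp (line t t') := by
  refine ContinuousMap.continuous_of_continuous_uncurry _ ?_
  exact (R.edge e).continuous.comp (continuous_line.comp
    (f := fun p : I × I => ((p.1, t'), p.2)) (by fun_prop))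

/-- Paths whose radial projection is in an open subset of the 1-skeleton are cellular if this
subset can be deformed to isolated points. -/
lemma cellular_of_radial {O : Set X} (hO : IsOpen O) (hOr : R.IsRadial O) (hOV : O ⊆ R.punctured)
    {h : X → C(I, X)} (hr : R.IsRadial h)
    (hs : s ∈ O → h s = ContinuousMap.const I s)
    (he0 : ∀ e t, h (R.edge e t) 0 = R.edge e t)
    (hec : ∀ e t, R.Cellular (h (R.edge e t)))
    (hc : ∀ e, ContinuousOn (fun t => h (R.edge e t)) (R.edge e ⁻¹' O))
    {ε : X → X} (εr : R.IsRadial ε) (εs : ε s = s)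
    (εe : ∀ e t, R.edge e t ∈ O → h (R.edge e t) 1 = ε (R.edge e t))
    (εc : ∀ x ∈ O, ∀ᶠ y in 𝓝 x, ε y = ε x)
    {f : C(I, X)} (hf : ∀ t, f t ∈ O) : R.Cellular f := by
  obtain ⟨ρ, ρ0, ρc, ρk, ρs, ρe, ρd⟩ := R.exists_pushOff
  have hdisc : ∀ F z, R.disc F z ∈ O → z ≠ ctr → ∃ e t, R.disc F (rad z) = R.edge e t ∧
      R.edge e t ∈ O := by
    intro F z hz hz0
    obtain ⟨e, t, h⟩ := R.exists_edge_of_norm F (norm_rad hz0)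
    exact ⟨e, t, h, h ▸ (iff_of_eq (hOr F z hz0)).1 hz⟩
  have hk : Continuous fun t => ρ (f t) := ρk.comp_continuous f.continuous fun t => hOV (hf t)
  have hk1 : Continuous fun t => ρ (f t) 1 := (continuous_eval_const 1).comp hk
  refine R.cellular_of_homotopy ⟨_, hk⟩ (fun t => ρc _ (hOV (hf t)))
    (fun t => (ρ0 _ (hOV (hf t))).symm) (g := ⟨_, hk1⟩) (fun t => rfl) ?_
  refine R.cellular_of_contraction h (hr.continuousOn R hO hOr hOV hc) ε ?_ εc ?_ hf ?_
  · intro x hx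
    rcases R.eq_edge_of_mem_punctured (hOV hx) with rfl | ⟨e, t, rfl⟩ | ⟨F, z, hz, hF, rfl⟩
    · rw [hs hx, εs]; rfl
    · exact εe e t hx
    · obtain ⟨e, t, h1, h2⟩ := hdisc F z hx hz
      rw [hr F z hz, εr F z hz, h1, εe e t h2]
  · intro x hx
    rcases R.eq_edge_of_mem_punctured (hOV hx) with rfl | ⟨e, t, rfl⟩ | ⟨F, z, hz, hF, rfl⟩
    · rw [hs hx]; exact R.cellular_const _
    · exact hec e t
    · obtain ⟨e, t, h1, h2⟩ := hdisc F z hx hz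
      rw [hr F z hz, h1]
      exact hec e t
  · intro t
    change ρ (f t) 1 = h (f t) 0
    have hx := hf t
    generalize f t = x at hx
    rcases R.eq_edge_of_mem_punctured (hOV hx) with rfl | ⟨e, t, rfl⟩ | ⟨F, z, hz, hF, rfl⟩
    · rw [hs hx, ρs]; rfl
    · rw [ρe, he0]
    · obtain ⟨e, t, h1, h2⟩ := hdisc F z hx hz
      rw [hr F z hz, h1, he0, ρd F z hF, h1]

/-- The part of the 1-skeleton near the vertex contracts to the vertex along the edges. -/
lemma cellular_vertexStar {f : C(I, X)} (hf : ∀ t, f t ∈ R.vertexStar) : R.Cellular f := by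
  classical
  let a : K.Edge → I → C(I, X) := fun e t =>
    if K.trivE e then ContinuousMap.const I s else
      if (t : ℝ) < 1 / 2 then (R.edge e).comp (line t 0) else (R.edge e).comp (line t 1)
  have ha : K.EdgeCompat (ContinuousMap.const I s) a :=
    { zero := fun e => by
        simp only [a]
        split_ifs with h1 h2
        · rfl
        · ext u
          exact (congrArg _ (line_self 0 u)).trans (R.compat.zero e)
        · exact absurd (by simp) h2
      one := fun e => by
        simp only [a]
        split_ifs with h1 h2
        · rfl
        · norm_num at h2
        · ext u
          exact (congrArg _ (line_self 1 u)).trans (R.compat.one e)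
      triv := fun e t h => if_pos h
      act := fun m e t => by
        have : R.edge (K.actE m e) = R.edge e := by ext t; exact R.compat.act m e t
        simp only [a, K.trivE_act, this] }
  obtain ⟨h, hs, he, hr⟩ := R.exists_radial ha
  refine R.cellular_of_radial R.isOpen_vertexStar R.isRadial_vertexStar (fun x hx => hx.1) hr
    (fun _ => hs) (fun e t => ?_) (fun e t => ?_) (fun e => ?_) (ε := fun _ => s)
    (fun _ _ _ => rfl) rfl (fun e t _ => ?_) (fun _ _ => Filter.Eventually.of_forall fun _ => rfl)
    hf
  · rw [he]
    simp only [a]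
    split_ifs with h1 h2
    · exact (R.compat.triv e t h1).symm
    · exact congrArg _ (line_zero t 0)
    · exact congrArg _ (line_zero t 1)
  · rw [he]
    simp only [a]
    split_ifs with h1 h2
    · exact R.cellular_const _
    · exact R.cellular_edge _ _
    · exact R.cellular_edge _ _
  · simp only [he]
    by_cases h1 : K.trivE e
    · simp only [a, h1, if_true]
      exact continuousOn_const
    · intro t ht
      have h4 : t ≠ half := (R.edge_mem_vertexStar.1 ht).resolve_left h1
      refine ContinuousAt.continuousWithinAt ?_
      rcases lt_or_gt_of_ne_half h4 with h5 | h5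
      · refine (R.continuous_comp_line e 0).continuousAt.congr ?_
        filter_upwards [eventually_lt_half h5] with t' h6
        exact ((if_neg h1).trans (if_pos h6)).symm
      · refine (R.continuous_comp_line e 1).continuousAt.congr ?_
        filter_upwards [eventually_gt_half h5] with t' h6
        exact ((if_neg h1).trans (if_neg h6.not_gt)).symm
  · rw [he]
    simp only [a]
    split_ifs with h1 h2
    · rfl
    · exact (congrArg _ (line_one t 0)).trans (R.compat.zero e)
    · exact (congrArg _ (line_one t 1)).trans (R.compat.one e)

/-- The open edges contract to their midpoints. -/
lemma cellular_edgeStar {f : C(I, X)} (hf : ∀ t, f t ∈ R.edgeStar) : R.Cellular f := by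
  classical
  let a : K.Edge → I → C(I, X) := fun e t =>
    if K.trivE e ∨ t = 0 ∨ t = 1 then ContinuousMap.const I s else (R.edge e).comp (line t half)
  have ha : K.EdgeCompat (ContinuousMap.const I s) a :=
    { zero := fun e => if_pos (Or.inr (Or.inl rfl))
      one := fun e => if_pos (Or.inr (Or.inr rfl))
      triv := fun e t h => if_pos (Or.inl h)
      act := fun m e t => by
        have : R.edge (K.actE m e) = R.edge e := by ext t; exact R.compat.act m e t
        simp only [a, K.trivE_act, this] }
  let d : K.Edge → I → X := fun e t =>
    if K.trivE e ∨ t = 0 ∨ t = 1 then s else R.edge e half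
  have hd : K.EdgeCompat s d :=
    { zero := fun e => if_pos (Or.inr (Or.inl rfl))
      one := fun e => if_pos (Or.inr (Or.inr rfl))
      triv := fun e t h => if_pos (Or.inl h)
      act := fun m e t => by
        have : R.edge (K.actE m e) = R.edge e := by ext t; exact R.compat.act m e t
        simp only [d, K.trivE_act, this] }
  obtain ⟨h, hs, he, hr⟩ := R.exists_radial ha
  obtain ⟨ε, εs, εe, εr⟩ := R.exists_radial hd
  have hO : ∀ e t, R.edge e t ∈ R.edgeStar → ¬ (K.trivE e ∨ t = 0 ∨ t = 1) := fun e t ht => by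
    obtain ⟨h1, h2, h3⟩ := R.edge_mem_edgeStar.1 ht
    simp [h1, h2, h3]
  refine R.cellular_of_radial R.isOpen_edgeStar R.isRadial_edgeStar (fun x hx => hx.1) hr
    (fun _ => hs) (fun e t => ?_) (fun e t => ?_) (fun e => ?_) εr εs (fun e t ht => ?_)
    (εr.eventually_eq R R.isOpen_edgeStar R.isRadial_edgeStar (fun x hx => hx.1) fun e =>
      ⟨R.edge e half, fun t ht => (εe e t).trans (if_neg (hO e t ht))⟩) hf
  · rw [he]
    simp only [a]
    split_ifs with h1
    · rcases h1 with h1 | rfl | rfl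
      · exact (R.compat.triv e t h1).symm
      · exact (R.compat.zero e).symm
      · exact (R.compat.one e).symm
    · exact congrArg _ (line_zero t half)
  · rw [he]
    simp only [a]
    split_ifs with h1
    · exact R.cellular_const _
    · exact R.cellular_edge _ _
  · simp only [he]
    exact (R.continuous_comp_line e half).continuousOn.congr fun t ht => if_neg (hO e t ht)
  · rw [he, εe]
    simp only [a, d, if_neg (hO e t ht)]
    exact congrArg _ (line_one t half)

/-- The open discs contract to their centres. -/
lemma cellular_openDiscs {f : C(I, X)} (hf : ∀ t, f t ∈ R.openDiscs) : R.Cellular f := by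
  classical
  let k : D2 → C(I, D2) := fun z => ⟨fun u => mix z ctr u,
        continuous_mix.comp (f := fun u : I => ((z, ctr), u)) (by fun_prop)⟩
  let b : K.Disc → D2 → C(I, X) := fun F z =>
    if K.trivD F ∨ ‖z.1‖ = 1 then ContinuousMap.const I s else (R.disc F).comp (k z)
  have hactD : ∀ m F, R.disc (K.actD m F) = R.disc F := fun m F => by
    ext z; exact R.compat.actD m F z
  have hctr : ctr.conj = ctr := conj_eq_ctr.2 rfl
  have hb : K.Compat (ContinuousMap.const I s) (fun _ _ => ContinuousMap.const I s) b :=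
    { zero := fun _ => rfl
      one := fun _ => rfl
      triv := fun _ _ _ => rfl
      act := fun _ _ _ => rfl
      trivD := fun F z h => if_pos (Or.inl h)
      actD := fun m F z => by simp only [b, K.trivD_act, hactD]
      swap := fun F z => by
        simp only [b, K.trivD_swap, norm_conj_D2]
        split_ifs with h
        · rfl
        · ext u
          change R.disc _ (mix _ _ u) = R.disc _ (mix _ _ u)
          have := mix_conj z ctr u
          rw [hctr] at this
          rw [← this]
          exact R.compat.swap F _
      bdry := fun F h z k hk t hz _ => if_pos (Or.inr hz.1) }
  let d : K.Disc → D2 → X := fun F z => if K.trivD F ∨ ‖z.1‖ = 1 then s else R.disc F ctr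
  have hd : K.Compat s (fun _ _ => s) d :=
    { zero := fun _ => rfl
      one := fun _ => rfl
      triv := fun _ _ _ => rfl
      act := fun _ _ _ => rfl
      trivD := fun F z h => if_pos (Or.inl h)
      actD := fun m F z => by simp only [d, K.trivD_act, hactD]
      swap := fun F z => by
        simp only [d, K.trivD_swap, norm_conj_D2]
        have : R.disc (K.swap F) ctr = R.disc F ctr := by
          have := R.compat.swap F ctr
          rwa [hctr] at this
        rw [this]
      bdry := fun F h z k hk t hz _ => if_pos (Or.inr hz.1) }
  obtain ⟨h, hs, he, hh⟩ := R.lift hb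
  obtain ⟨ε, εs, εe, εd⟩ := R.lift hd
  have hO : ∀ F z, R.disc F z ∈ R.openDiscs → ¬ (K.trivD F ∨ ‖z.1‖ = 1) := fun F z hz => by
    obtain ⟨h1, h2⟩ := R.disc_mem_openDiscs.1 hz
    simp [h1, h2]
  have hx : ∀ x ∈ R.openDiscs, ∃ F z, x = R.disc F z := by
    intro x hx
    rcases R.surj x with rfl | ⟨e, t, rfl⟩ | h
    · exact absurd hx ((iff_of_eq (R.lift compat_openDisc).choose_spec.1).1)
    · exact absurd hx (R.edge_notMem_openDiscs e t)
    · exact h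
  refine R.cellular_of_contraction h ?_ ε ?_ ?_ ?_ hf ?_
  · refine R.continuousOn_of_cells R.isOpen_openDiscs
      (fun e t ht => absurd ht (R.edge_notMem_openDiscs e t)) fun F hF => ?_
    simp only [hh]
    have h1 : Continuous fun z => (R.disc F).comp (k z) := by
      refine ContinuousMap.continuous_of_continuous_uncurry _ ?_
      exact (R.disc F).continuous.comp (continuous_mix.comp
        (f := fun p : D2 × I => ((p.1, ctr), p.2)) (by fun_prop))
    exact h1.continuousOn.congr fun z hz => if_neg (hO F z hz)
  · intro x hx'
    obtain ⟨F, z, rfl⟩ := hx x hx'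
    rw [hh, εd]
    simp only [b, d, if_neg (hO F z hx')]
    exact congrArg _ (mix_one z ctr)
  · exact R.eventually_eq_of_discs fun F =>
      ⟨R.disc F ctr, fun z hz => (εd F z).trans (if_neg (hO F z hz))⟩
  · intro x hx'
    obtain ⟨F, z, rfl⟩ := hx x hx'
    rw [hh]
    simp only [b, if_neg (hO F z hx')]
    exact R.cellular_disc _ _
  · intro t
    have hx' := hf t
    generalize f t = x at hx'
    obtain ⟨F, z, rfl⟩ := hx x hx'
    rw [hh]
    simp only [b, if_neg (hO F z hx')]
    exact (congrArg (R.disc F) (mix_zero z ctr)).symm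

/-- The points of a path which can be reached by a `CellPath` along it form a clopen set, as the complex
is covered by `vertexStar`, `edgeStar` and `openDiscs`. -/
theorem cellular (f : C(I, X)) : R.Cellular f := by
  have hloc : ∀ t₀ : I, ∀ᶠ p in 𝓝 t₀ ×ˢ 𝓝 t₀, R.CellPath (seg f p.1 p.2) := by
    intro t₀
    obtain ⟨O, hO, ht₀, hf⟩ : ∃ O : Set X, IsOpen O ∧ f t₀ ∈ O ∧
        ∀ f : C(I, X), (∀ t, f t ∈ O) → R.Cellular f := by
      rcases R.mem_star (f t₀) with h | h | h
      · exact ⟨_, R.isOpen_vertexStar, h, fun f => R.cellular_vertexStar⟩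
      · exact ⟨_, R.isOpen_edgeStar, h, fun f => R.cellular_edgeStar⟩
      · exact ⟨_, R.isOpen_openDiscs, h, fun f => R.cellular_openDiscs⟩
    obtain ⟨δ, hδ, hball⟩ := Metric.isOpen_iff.1 (hO.preimage f.continuous) t₀ ht₀
    have hb := Metric.ball_mem_nhds t₀ hδ
    refine Filter.mem_of_superset (Filter.prod_mem_prod hb hb) ?_
    rintro ⟨t, t'⟩ ⟨ht, ht'⟩
    have h1 := hf (f.comp (line t t')) (fun u => hball (by
      have h2 := (convex_ball (t₀ : ℝ) δ) (x := (t : ℝ)) ht (y := (t' : ℝ)) ht'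
        (a := 1 - u) (b := u) (by linarith [u.2.2]) u.2.1 (by ring)
      exact h2)) 0 1
    rw [seg_comp] at h1
    have h3 := h1.cast (congrArg f (line_zero t t').symm) (congrArg f (line_one t t').symm)
    have : ∀ a b, a = t → b = t' → ∀ (h : f t = f a) (h' : f t' = f b),
        seg f t t' = (seg f a b).cast h h' := by
      rintro a b rfl rfl _ _
      simp
    rw [← this _ _ (line_zero t t') (line_one t t')] at h3
    exact h3
  intro t t'
  let S : Set I := {u | R.CellPath (seg f t u)}
  have hS : IsClopen S := by
    have key : ∀ u₀ : I, ∃ N ∈ 𝓝 u₀, ∀ u ∈ N, ∀ u' ∈ N, u ∈ S → u' ∈ S := by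
      intro u₀
      obtain ⟨N₁, h1, N₂, h2, h12⟩ := Filter.mem_prod_iff.1 (hloc u₀)
      refine ⟨N₁ ∩ N₂, Filter.inter_mem h1 h2, fun u hu u' hu' h => ?_⟩
      have h3 : R.CellPath (seg f u u') := h12 (mk_mem_prod hu.1 hu'.2)
      have := CellPath.trans h h3
      rwa [seg_trans] at this
    constructor
    · rw [← isOpen_compl_iff, isOpen_iff_mem_nhds]
      intro u₀ hu₀
      obtain ⟨N, hN, h⟩ := key u₀
      filter_upwards [hN] with u hu hu'
      exact hu₀ (h u hu u₀ (mem_of_mem_nhds hN) hu')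
    · rw [isOpen_iff_mem_nhds]
      intro u₀ hu₀
      obtain ⟨N, hN, h⟩ := key u₀
      filter_upwards [hN] with u hu
      exact h u₀ (mem_of_mem_nhds hN) u hu hu₀
  have : S = univ := hS.eq_univ ⟨t, by
    change R.CellPath (seg f t t)
    rw [seg_self]
    exact CellPath.refl _⟩
  exact (this ▸ mem_univ t' : t' ∈ S)

/-- Every path is homotopic to a composition of paths within closed cells. -/
theorem cellPath {x y : X} (p : Path.Homotopic.Quotient x y) : R.CellPath p := by
  obtain ⟨p, rfl⟩ := Path.Homotopic.Quotient.mk_surjective p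
  have h := R.cellular p.toContinuousMap 0 1
  rw [seg_path'] at h
  have := h.cast p.source.symm p.target.symm
  rwa [Path.Homotopic.Quotient.cast_cast, Path.Homotopic.Quotient.cast_rfl_rfl] at this

end Realization

end TwoComplex

namespace TwoComplex

open Salvetti (D2)

/-! ### Relations between the edge loops, and generation by them -/

section Cls

variable {X A B : Type} [TopologicalSpace X] [TopologicalSpace A] [TopologicalSpace B]
  [SimplyConnectedSpace A] [SimplyConnectedSpace B] {s : X}

/-- The class of the image of any path from `a` to `b`, if `f` maps both points to `s`. -/
def cls (f : C(A, X)) {a b : A} (ha : f a = s) (hb : f b = s) : FundamentalGroup X s :=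
  FundamentalGroup.fromPath ((seg f a b).cast ha.symm hb.symm)

lemma cls_mul (f : C(A, X)) {a b c : A} (ha : f a = s) (hb : f b = s) (hc : f c = s) :
    cls f hb hc * cls f ha hb = cls f ha hc := by
  rw [FundamentalGroup.mul_def]
  exact (cast_trans _ _ _ _ _).trans (congrArg (fun q => Path.Homotopic.Quotient.cast q _ _)
    (seg_trans f a b c))

lemma cls_comp (f : C(A, X)) (k : C(B, A)) {b b' : B} (hb : f (k b) = s) (hb' : f (k b') = s) :
    cls (f.comp k) (a := b) (b := b') hb hb' = cls f hb hb' := by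
  unfold cls
  rw [seg_comp]

lemma cls_self (f : C(A, X)) {a : A} (ha : f a = s) : cls f ha ha = 1 := by
  unfold cls
  rw [seg_self]
  subst ha
  simp only [Path.Homotopic.Quotient.cast_rfl_rfl]
  rfl

/-- The classes of paths to `f a` which run through a loop in `P` and then through the image
of a path from `a₀` to `a`. -/
def coset (P : Subgroup (FundamentalGroup X s)) (f : C(A, X)) (a₀ a : A) :
    Set (Σ x, Path.Homotopic.Quotient s x) :=
  {y | ∃ (h : f a₀ = s) (p : FundamentalGroup X s), p ∈ P ∧
    y = ⟨f a, (FundamentalGroup.toPath p).trans ((seg f a₀ a).cast h.symm rfl)⟩}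

variable (P : Subgroup (FundamentalGroup X s))

lemma cast_right_trans {x y z : X} {x' y' : X} (p : Path.Homotopic.Quotient x y)
    (q : Path.Homotopic.Quotient y z) (hx : x' = x) (hy : y' = y) :
    (p.cast hx hy).trans (q.cast hy rfl) = (p.trans q).cast hx rfl := cast_trans p q hx hy rfl

/-- If the loop from `a₀` to `a₁` is in `P`, the paths through `f a₁` can be rerouted through
`f a₀`. -/
lemma coset_subset (f : C(A, X)) {a₀ a₁ : A} (h₀ : f a₀ = s) (h₁ : f a₁ = s)
    (h : cls f h₀ h₁ ∈ P) (a : A) : coset P f a₁ a ⊆ coset P f a₀ a := by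
  rintro _ ⟨h₁', p, hp, rfl⟩
  refine ⟨h₀, (cls f h₀ h₁)⁻¹ * p, P.mul_mem (P.inv_mem h) hp, ?_⟩
  congr 1
  have e2 : (seg f a₁ a).cast h₁.symm rfl = (FundamentalGroup.toPath (cls f h₁ h₀)).trans
      ((seg f a₀ a).cast h₀.symm rfl) := by
    rw [← seg_trans f a₁ a₀ a]
    exact (cast_right_trans (seg f a₁ a₀) (seg f a₀ a) h₁.symm h₀.symm).symm
  have e1 : (cls f h₀ h₁)⁻¹ = cls f h₁ h₀ := by
    rw [inv_eq_iff_mul_eq_one, cls_mul, cls_self]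
  rw [e2, e1]
  exact (Path.Homotopic.Quotient.trans_assoc _ _ _).symm

lemma coset_eq (f : C(A, X)) {a₀ a₁ : A} (h₀ : f a₀ = s) (h₁ : f a₁ = s)
    (h : cls f h₀ h₁ ∈ P) (a : A) : coset P f a₀ a = coset P f a₁ a := by
  refine Subset.antisymm (coset_subset P f h₁ h₀ ?_ a) (coset_subset P f h₀ h₁ h a)
  have : cls f h₁ h₀ = (cls f h₀ h₁)⁻¹ := by
    rw [eq_comm, inv_eq_iff_mul_eq_one, cls_mul, cls_self]
  rw [this]
  exact P.inv_mem h

lemma coset_comp (f : C(A, X)) (k : C(B, A)) (b₀ b : B) :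
    coset P (f.comp k) b₀ b = coset P f (k b₀) (k b) := by
  unfold coset
  rw [seg_comp]
  rfl

lemma coset_base (f : C(A, X)) {a₀ a : A} (h₀ : f a₀ = s) (h : f a = s) (hP : cls f h₀ h ∈ P) :
    coset P f a₀ a = {y | ∃ p ∈ P, y = ⟨s, FundamentalGroup.toPath p⟩} := by
  rw [coset_eq P f h₀ h hP]
  ext y
  have key : ∀ p : FundamentalGroup X s, (⟨f a, (FundamentalGroup.toPath p).trans
      ((seg f a a).cast h.symm rfl)⟩ : Σ x, Path.Homotopic.Quotient s x) =
        ⟨s, FundamentalGroup.toPath p⟩ := by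
    intro p
    rw [seg_self]
    clear hP
    subst h
    simp
  constructor
  · rintro ⟨_, p, hp, rfl⟩
    exact ⟨p, hp, key p⟩
  · rintro ⟨p, hp, rfl⟩
    exact ⟨h, p, hp, (key p).symm⟩

/-- Paths within the cell respect the cosets. -/
lemma mem_coset_iff (f : C(A, X)) {a₀ a b : A} (κ : Path.Homotopic.Quotient s (f a)) :
    (⟨f a, κ⟩ : Σ x, Path.Homotopic.Quotient s x) ∈ coset P f a₀ a ↔
      ⟨f b, κ.trans (seg f a b)⟩ ∈ coset P f a₀ b := by
  have key : ∀ {a b : A} (κ : Path.Homotopic.Quotient s (f a)),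
      (⟨f a, κ⟩ : Σ x, Path.Homotopic.Quotient s x) ∈ coset P f a₀ a →
        ⟨f b, κ.trans (seg f a b)⟩ ∈ coset P f a₀ b := by
    rintro a b κ ⟨h, p, hp, e⟩
    have e' := eq_of_heq (Sigma.mk.inj e).2
    refine ⟨h, p, hp, ?_⟩
    rw [e', Path.Homotopic.Quotient.trans_assoc]
    congr 2
    rw [← seg_trans f a₀ a b]
    exact cast_right_trans (seg f a₀ a) (seg f a b) h.symm rfl
  refine ⟨key κ, fun h => ?_⟩
  have := key (b := a) _ h
  rwa [Path.Homotopic.Quotient.trans_assoc, seg_trans, seg_self,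
    Path.Homotopic.Quotient.trans_refl] at this

end Cls

/-- The end point `k / m` of the parts of the unit interval. -/
def node (m k : ℕ) : I := projIcc 0 1 zero_le_one ((k : ℝ) / m)

lemma part_zero (m k : ℕ) : part m k 0 = node m k := by simp [part, node]

lemma part_one (m k : ℕ) : part m k 1 = node m (k + 1) := by simp [part, node]

lemma node_zero (m : ℕ) : node m 0 = 0 := by
  simp [node]

lemma node_self {m : ℕ} (hm : 0 < m) : node m m = 1 := by
  have : (m : ℝ) ≠ 0 := by positivity
  rw [node, div_self this]
  exact projIcc_right _

lemma arc_zero (h : Bool) : arc h 0 = arc false 0 := by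
  apply Subtype.ext
  apply Complex.ext <;> simp [arc]

lemma arc_one (h : Bool) : arc h 1 = arc false 1 := by
  apply Subtype.ext
  have : (2 : ℝ) - 1 = 1 := by norm_num
  apply Complex.ext <;> simp [arc, this]

namespace Realization

variable {K : Shape} {X : Type} [TopologicalSpace X] {s : X} (R : Realization K X s)

lemma loop_eq_cls (e : K.Edge) :
    R.loop e = cls (R.edge e) (a := 0) (b := 1) (R.compat.zero e) (R.compat.one e) := by
  unfold cls
  rw [seg_path]
  rfl

lemma loop_act (m : K.Sym) (e : K.Edge) : R.loop (K.actE m e) = R.loop e := by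
  have : R.edge (K.actE m e) = R.edge e := by ext t; exact R.compat.act m e t
  unfold loop
  simp only [this]

lemma loop_triv {e : K.Edge} (he : K.trivE e) : R.loop e = 1 := by
  rw [loop]
  have : (⟨R.edge e, R.compat.zero e, R.compat.one e⟩ : Path s s) = Path.refl s := by
    ext t
    exact R.compat.triv e t he
  rw [this]
  rfl

lemma disc_node (F : K.Disc) (h : Bool) {k : ℕ} (hk : k ≤ (K.word F h).length) :
    R.disc F (arc h (node (K.word F h).length k)) = s := by
  rcases hk.lt_or_eq with hk | rfl
  · rw [← part_zero, R.disc_arc F hk]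
    exact R.compat.zero _
  · have h0 : 0 < (K.word F h).length := List.length_pos_iff.2 (K.word_ne_nil F h)
    have h1 : (K.word F h).length - 1 + 1 = (K.word F h).length := by omega
    have h2 := part_one (K.word F h).length ((K.word F h).length - 1)
    rw [h1] at h2
    rw [← h2, R.disc_arc F (by omega)]
    exact R.compat.one _

/-- The `k`-th part of a half circle of a disc is the `k`-th edge of its boundary path. -/
lemma disc_comp_arc (F : K.Disc) (h : Bool) {k : ℕ} (hk : k < (K.word F h).length) :
    (R.disc F).comp ⟨fun t => arc h (part (K.word F h).length k t),
      (continuous_arc h).comp (continuous_part _ _)⟩ = R.edge (K.word F h)[k] := by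
  ext t
  exact R.disc_arc F hk t

lemma cls_disc_node_succ (F : K.Disc) (h : Bool) {k : ℕ} (hk : k < (K.word F h).length) :
    cls (R.disc F) (R.disc_node F h hk.le) (R.disc_node F h hk) = R.loop (K.word F h)[k] := by
  have e := R.disc_comp_arc F h hk
  have key : ∀ (f : C(I, X)) (h0 : f 0 = s) (h1 : f 1 = s), f = R.edge (K.word F h)[k] →
      cls f h0 h1 = R.loop (K.word F h)[k] := by
    rintro _ h0 h1 rfl
    rw [R.loop_eq_cls]
  rw [← key _ (by rw [e]; exact R.compat.zero _) (by rw [e]; exact R.compat.one _) e]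
  have : ∀ (a b a' b' : D2) (ha : R.disc F a = s) (hb : R.disc F b = s) (ha' : R.disc F a' = s)
      (hb' : R.disc F b' = s), a = a' → b = b' → cls (R.disc F) ha hb = cls (R.disc F) ha' hb' := by
    rintro a b _ _ _ _ _ _ rfl rfl
    rfl
  refine (this _ _ _ _ _ _ ?_ ?_ ?_ ?_).trans (cls_comp (R.disc F) _ _ _).symm
  · exact (R.disc_arc F hk 0).trans (R.compat.zero _)
  · exact (R.disc_arc F hk 1).trans (R.compat.one _)
  · exact congrArg _ (part_zero _ _).symm
  · exact congrArg _ (part_one _ _).symm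

lemma op_cls_disc_node (F : K.Disc) (h : Bool) {k : ℕ} (hk : k ≤ (K.word F h).length) :
    op (cls (R.disc F) (R.disc_node F h (Nat.zero_le _)) (R.disc_node F h hk)) =
      (((K.word F h).map fun e => op (R.loop e)).take k).prod := by
  induction k with
  | zero => rw [cls_self]; simp
  | succ k ih =>
    rw [← cls_mul (R.disc F) _ (R.disc_node F h (Nat.le_of_succ_le hk)) _, op_mul,
      ih (Nat.le_of_succ_le hk),
      R.cls_disc_node_succ F h hk, List.prod_take_succ _ _ (by simpa using hk), List.getElem_map]

lemma disc_start (F : K.Disc) : R.disc F (arc false 0) = s := by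
  rw [← node_zero]
  exact R.disc_node F false (Nat.zero_le _)

lemma disc_end (F : K.Disc) : R.disc F (arc false 1) = s := by
  rw [← node_self (List.length_pos_iff.2 (K.word_ne_nil F false))]
  exact R.disc_node F false le_rfl

lemma prod_word_eq_cls (F : K.Disc) (h : Bool) :
    ((K.word F h).map fun e => op (R.loop e)).prod =
      op (cls (R.disc F) (R.disc_start F) (R.disc_end F)) := by
  have h0 : 0 < (K.word F h).length := List.length_pos_iff.2 (K.word_ne_nil F h)
  have := R.op_cls_disc_node F h le_rfl
  rw [List.take_of_length_le (by simp)] at this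
  rw [← this]
  congr 1
  have key : ∀ (a b a' b' : D2) (ha : R.disc F a = s) (hb : R.disc F b = s) (ha' : R.disc F a' = s)
      (hb' : R.disc F b' = s), a = a' → b = b' → cls (R.disc F) ha hb = cls (R.disc F) ha' hb' := by
    rintro a b _ _ _ _ _ _ rfl rfl
    rfl
  refine key _ _ _ _ _ _ _ _ ?_ ?_
  · rw [node_zero, arc_zero]
  · rw [node_self h0, arc_one]

/-- The relations given by the discs. -/
theorem prod_word (F : K.Disc) : ((K.word F false).map fun e => op (R.loop e)).prod =
    ((K.word F true).map fun e => op (R.loop e)).prod := by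
  rw [R.prod_word_eq_cls, R.prod_word_eq_cls]

/-- A subgroup which contains the edge loops is everything: the cosets of the paths within cells,
starting at the vertex, descend to a coset for each point of the complex, which is preserved by
`CellPath`s. -/
theorem eq_top_of_loop_mem (P : Subgroup (FundamentalGroup X s)) (hP : ∀ e, R.loop e ∈ P) :
    P = ⊤ := by
  have hnode : ∀ (F : K.Disc) (h : Bool) {k : ℕ} (hk : k ≤ (K.word F h).length),
      cls (R.disc F) (R.disc_node F h (Nat.zero_le _)) (R.disc_node F h hk) ∈ P := by
    intro F h k hk
    induction k with
    | zero => rw [cls_self]; exact P.one_mem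
    | succ k ih =>
      rw [← cls_mul (R.disc F) _ (R.disc_node F h (Nat.le_of_succ_le hk)) _,
        R.cls_disc_node_succ F h hk]
      exact P.mul_mem (hP _) (ih (Nat.le_of_succ_le hk))
  have hedge : ∀ m e, R.edge (K.actE m e) = R.edge e := fun m e => by
    ext t; exact R.compat.act m e t
  have harc : ∀ F h, coset P (R.disc F) (arc false 0) =
      coset P (R.disc F) (arc h (node (K.word F h).length 0)) := by
    intro F h
    rw [node_zero, arc_zero h]
  have hc : K.Compat {y | ∃ p ∈ P, y = ⟨s, FundamentalGroup.toPath p⟩}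
      (fun e t => coset P (R.edge e) 0 t) (fun F z => coset P (R.disc F) (arc false 0) z) :=
    { zero := fun e => coset_base P (R.edge e) (R.compat.zero e) (R.compat.zero e) (by
        rw [cls_self]; exact P.one_mem)
      one := fun e => coset_base P (R.edge e) (R.compat.zero e) (R.compat.one e) (by
        rw [← R.loop_eq_cls]; exact hP e)
      triv := fun e t he => coset_base P (R.edge e) (R.compat.zero e) (R.compat.triv e t he) (by
        have key : ∀ (f : C(I, X)) (h0 : f 0 = s) (h1 : f t = s), f = ContinuousMap.const I s →
            cls f h0 h1 ∈ P := by
          rintro _ h0 h1 rfl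
          unfold cls
          rw [seg_const]
          exact P.one_mem
        exact key _ _ _ (by ext t; exact R.compat.triv e t he))
      act := fun m e t => by rw [hedge]
      trivD := fun F z hF => coset_base P (R.disc F) (R.disc_start F) (R.disc_triv hF z) (by
        have key : ∀ (f : C(D2, X)) (h0 : f (arc false 0) = s) (h1 : f z = s),
            f = ContinuousMap.const D2 s → cls f h0 h1 ∈ P := by
          rintro _ h0 h1 rfl
          unfold cls
          rw [seg_const]
          exact P.one_mem
        exact key _ _ _ (by ext z; exact R.disc_triv hF z))
      actD := fun m F z => by
        have : R.disc (K.actD m F) = R.disc F := by ext z; exact R.compat.actD m F z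
        rw [this]
      swap := fun F z => by
        let τ : C(D2, D2) := ⟨Salvetti.D2.conj,
          Continuous.subtype_mk (Complex.continuous_conj.comp continuous_subtype_val) _⟩
        have h1 : (R.disc (K.swap F)).comp τ = R.disc F := by ext z; exact R.compat.swap F z
        have h2 : τ (arc false 0) = arc false 0 := by
          change (arc false 0).conj = arc false 0
          apply Subtype.ext
          apply Complex.ext <;> simp [arc, Salvetti.D2.conj]
        have h3 := coset_comp P (R.disc (K.swap F)) τ (arc false 0) z
        rw [h1, h2] at h3
        exact h3.symm
      bdry := fun F h z k hk t hz ht => by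
        have h1 : z = arc h (part (K.word F h).length k t) := by
          rw [← arc_pos hz]
          congr 1
          apply Subtype.ext
          have hm : ((K.word F h).length : ℝ) ≠ 0 := by
            have := (Nat.zero_le k).trans_lt hk
            positivity
          exact mul_right_cancel₀ hm (ht.trans (part_mul hk t).symm)
        have h3 := coset_comp P (R.disc F) ⟨fun t => arc h (part (K.word F h).length k t),
          (continuous_arc h).comp (continuous_part _ _)⟩ 0 t
        rw [R.disc_comp_arc F h hk] at h3
        refine Eq.trans ?_ h3.symm
        rw [harc F h, coset_eq P (R.disc F) _ _ (hnode F h hk.le) z, h1]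
        congr 1
        exact congrArg _ (part_zero _ _).symm }
  obtain ⟨c, cs, ce, cd⟩ := R.lift hc
  have key : ∀ {x y : X} (q : Path.Homotopic.Quotient x y), R.CellPath q →
      ∀ κ : Path.Homotopic.Quotient s x, (⟨x, κ⟩ : Σ x, Path.Homotopic.Quotient s x) ∈ c x ↔
        ⟨y, κ.trans q⟩ ∈ c y := by
    intro x y q hq
    induction hq with
    | refl x => intro κ; rw [Path.Homotopic.Quotient.trans_refl]
    | edge e t t' => intro κ; rw [ce, ce]; exact mem_coset_iff P (R.edge e) κ
    | disc F z z' => intro κ; rw [cd, cd]; exact mem_coset_iff P (R.disc F) κ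
    | trans _ _ ih1 ih2 =>
      intro κ
      rw [ih1, ih2, Path.Homotopic.Quotient.trans_assoc]
  rw [eq_top_iff]
  rintro q -
  have h1 := (key (FundamentalGroup.toPath q) (R.cellPath _) (Path.Homotopic.Quotient.refl s)).1
    (by rw [cs]; exact ⟨1, P.one_mem, rfl⟩)
  rw [Path.Homotopic.Quotient.refl_trans, cs] at h1
  obtain ⟨p, hp, e⟩ := h1
  have e' := eq_of_heq (Sigma.mk.inj e).2
  have e2 : q = p := e'
  rwa [e2]

end Realization

end TwoComplex

/-! ### Sign vectors of the chambers -/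

namespace FCArrangement

open Salvetti

variable {n : ℕ}

/-- The index set of the hyperplanes of the arrangement. -/
abbrev Idx (n : ℕ) : Type := Mu n ⊕ Fin n

/-- The linear part of the equation of a hyperplane. -/
def lin : Idx n → (Fin n → ℝ) →ₗ[ℝ] ℝ
  | Sum.inl ε => ∑ i, ((ε i : ℤ) : ℝ) • LinearMap.proj i
  | Sum.inr i => LinearMap.proj i

/-- The constant in the equation of a hyperplane. -/
def cst : Idx n → ℝ
  | Sum.inl _ => 1
  | Sum.inr _ => 0

/-- The affine function which defines a hyperplane. -/
def ev (j : Idx n) (x : Fin n → ℝ) : ℝ := lin j x - cst j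

lemma lin_inl (ε : Mu n) (x : Fin n → ℝ) :
    lin (Sum.inl ε) x = ∑ i, ((ε i : ℤ) : ℝ) * x i := by
  simp [lin]

lemma lin_inr (i : Fin n) (x : Fin n → ℝ) : lin (Sum.inr i) x = x i := rfl

lemma ev_inl (ε : Mu n) (x : Fin n → ℝ) :
    ev (Sum.inl ε) x = (∑ i, ((ε i : ℤ) : ℝ) * x i) - 1 := by
  rw [ev, lin_inl]; rfl

lemma ev_inr (i : Fin n) (x : Fin n → ℝ) : ev (Sum.inr i) x = x i := by
  simp [ev, lin, cst]

lemma lin_inl_single (ε : Mu n) (i : Fin n) (c : ℝ) :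
    lin (Sum.inl ε) (Pi.single i c) = ((ε i : ℤ) : ℝ) * c := by
  classical
  rw [lin_inl, Finset.sum_eq_single i] <;> simp +contextual

lemma ev_add_smul (j : Idx n) (x v : Fin n → ℝ) (t : ℝ) :
    ev j (x + t • v) = ev j x + t * lin j v := by
  simp only [ev, map_add, map_smul, smul_eq_mul]; ring

lemma ev_combo (j : Idx n) (x y : Fin n → ℝ) (t : ℝ) :
    ev j ((1 - t) • x + t • y) = (1 - t) * ev j x + t * ev j y := by
  simp only [ev, map_add, map_smul, smul_eq_mul]; ring

lemma continuous_ev (j : Idx n) : Continuous (ev j) :=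
  (LinearMap.continuous_of_finiteDimensional (lin j)).sub continuous_const

/-- The hyperplane with a given index. -/
def hyp (j : Idx n) : Set (Fin n → ℝ) := {x | ev j x = 0}

lemma hyp_inl (ε : Mu n) : hyp (Sum.inl ε) = H ε := by
  ext x
  simp only [hyp, H, mem_ofPred_eq, ev_inl, sub_eq_zero]

lemma hyp_inr (i : Fin n) : hyp (Sum.inr i) = L i := by
  ext x
  simp only [hyp, L, mem_ofPred_eq, ev_inr]

lemma hyp_mem (j : Idx n) : hyp j ∈ FC n := by
  rcases j with ε | i
  · exact Or.inl ⟨ε, (hyp_inl ε).symm⟩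
  · exact Or.inr ⟨i, (hyp_inr i).symm⟩

lemma exists_hyp_of_mem {A : Set (Fin n → ℝ)} (hA : A ∈ FC n) : ∃ j, A = hyp j := by
  rcases hA with ⟨ε, rfl⟩ | ⟨i, rfl⟩
  · exact ⟨Sum.inl ε, (hyp_inl ε).symm⟩
  · exact ⟨Sum.inr i, (hyp_inr i).symm⟩

/-- The sign vector of a point. -/
def sg (x : Fin n → ℝ) : Idx n → SignType := fun j => SignType.sign (ev j x)

lemma sg_eq_zero {x : Fin n → ℝ} {j : Idx n} : sg x j = 0 ↔ ev j x = 0 := sign_eq_zero_iff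

lemma sg_eq_one {x : Fin n → ℝ} {j : Idx n} : sg x j = 1 ↔ 0 < ev j x := sign_eq_one_iff

lemma sg_eq_neg_one {x : Fin n → ℝ} {j : Idx n} : sg x j = -1 ↔ ev j x < 0 := sign_eq_neg_one_iff

/-- The points with the same sign vector as `x`. -/
def cell (x : Fin n → ℝ) : Set (Fin n → ℝ) := {y | sg y = sg x}

/-- The smallest linear subset of the arrangement which contains `x`. -/
def flat (x : Fin n → ℝ) : Set (Fin n → ℝ) := {y | ∀ j, ev j x = 0 → ev j y = 0}

lemma mem_flat_self (x : Fin n → ℝ) : x ∈ flat x := fun _ h => h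

lemma isFlat_flat (x : Fin n → ℝ) : IsFlat (FC n) (flat x) := by
  refine ⟨⟨x, mem_flat_self x⟩, hyp '' {j | ev j x = 0}, ?_, (toFinite _).image _, ?_⟩
  · rintro _ ⟨j, -, rfl⟩
    exact hyp_mem j
  · ext y
    simp [flat, hyp]

lemma flat_subset {K : Set (Fin n → ℝ)} (hK : IsFlat (FC n) K) {x : Fin n → ℝ} (hx : x ∈ K) :
    flat x ⊆ K := by
  obtain ⟨-, S, hS, -, rfl⟩ := hK
  intro y hy A hA
  obtain ⟨j, rfl⟩ := exists_hyp_of_mem (hS hA)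
  exact hy j (hx _ hA)

lemma mem_stratum_iff {K : Set (Fin n → ℝ)} (hK : IsFlat (FC n) K) {x : Fin n → ℝ} :
    x ∈ stratum (FC n) K ↔ K = flat x := by
  constructor
  · rintro ⟨hx, hx'⟩
    by_contra hne
    refine hx' ⟨flat x, ⟨isFlat_flat x, ?_⟩, mem_flat_self x⟩
    exact (flat_subset hK hx).ssubset_of_ne fun h => hne h.symm
  · rintro rfl
    refine ⟨mem_flat_self x, ?_⟩
    rintro ⟨K', ⟨hK', hlt⟩, hxK'⟩
    exact hlt.2 (flat_subset hK' hxK')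

lemma flat_eq_flat_iff {x y : Fin n → ℝ} :
    flat x = flat y ↔ ∀ j, ev j x = 0 ↔ ev j y = 0 := by
  constructor
  · intro h j
    have hx : x ∈ flat y := h ▸ mem_flat_self x
    have hy : y ∈ flat x := h ▸ mem_flat_self y
    exact ⟨hy j, hx j⟩
  · intro h
    ext z
    simp only [flat, mem_ofPred_eq, h]

lemma sign_combo {a b t : ℝ} (h : SignType.sign a = SignType.sign b) (h0 : 0 ≤ t) (h1 : t ≤ 1) :
    SignType.sign ((1 - t) * a + t * b) = SignType.sign a := by
  rcases lt_trichotomy a 0 with ha | ha | ha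
  · rw [sign_neg ha] at h ⊢
    have hb := sign_eq_neg_one_iff.1 h.symm
    rw [sign_eq_neg_one_iff]
    nlinarith [mul_nonneg (sub_nonneg.2 h1) (neg_nonneg.2 ha.le), mul_nonneg h0 (neg_nonneg.2 hb.le)]
  · subst ha
    rw [sign_zero] at h ⊢
    rw [sign_eq_zero_iff.1 h.symm]
    simp
  · rw [sign_pos ha] at h ⊢
    have hb := sign_eq_one_iff.1 h.symm
    rw [sign_eq_one_iff]
    nlinarith [mul_nonneg (sub_nonneg.2 h1) ha.le, mul_nonneg h0 hb.le]

lemma convex_cell (x : Fin n → ℝ) : Convex ℝ (cell x) := by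
  intro y hy z hz a b ha hb hab
  obtain rfl : a = 1 - b := by linarith
  change sg _ = sg x
  funext j
  change SignType.sign (ev j _) = _
  rw [ev_combo, sign_combo _ hb (by linarith)]
  · exact congrFun hy j
  · exact (congrFun hy j).trans (congrFun hz j).symm

lemma component_eq_cell {x : Fin n → ℝ} :
    connectedComponentIn (stratum (FC n) (flat x)) x = cell x := by
  have hsub : cell x ⊆ stratum (FC n) (flat x) := by
    intro y hy
    rw [mem_stratum_iff (isFlat_flat x), flat_eq_flat_iff]
    intro j
    rw [← sg_eq_zero, ← sg_eq_zero, show sg y = sg x from hy]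
  refine Subset.antisymm ?_ ((convex_cell x).isPreconnected.subset_connectedComponentIn rfl hsub)
  intro y hy
  have hstr : ∀ z ∈ connectedComponentIn (stratum (FC n) (flat x)) x,
      ∀ j, ev j x = 0 ↔ ev j z = 0 := fun z hz =>
    flat_eq_flat_iff.1 ((mem_stratum_iff (isFlat_flat x)).1 (connectedComponentIn_subset _ _ hz))
  have hx : x ∈ connectedComponentIn (stratum (FC n) (flat x)) x :=
    mem_connectedComponentIn (hsub rfl)
  change sg y = sg x
  funext j
  have hpre := (isPreconnected_connectedComponentIn (x := x)
    (F := stratum (FC n) (flat x))).image (ev j) (continuous_ev j).continuousOn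
  have hord := hpre.ordConnected
  have h0 := hstr y hy j
  -- a sign change would give a zero in between
  have key : ∀ a ∈ connectedComponentIn (stratum (FC n) (flat x)) x,
      ∀ b ∈ connectedComponentIn (stratum (FC n) (flat x)) x, ev j a < 0 → 0 < ev j b → False := by
    intro a ha b hb h1 h2
    obtain ⟨c, hc, hc0⟩ := hord.out (mem_image_of_mem _ ha) (mem_image_of_mem _ hb) ⟨h1.le, h2.le⟩
    exact h1.ne ((hstr a ha j).1 ((hstr c hc j).2 hc0))
  rcases lt_trichotomy (ev j x) 0 with h | h | h
  · refine (sg_eq_neg_one.2 ?_).trans (sg_eq_neg_one.2 h).symm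
    rcases lt_trichotomy (ev j y) 0 with h' | h' | h'
    · exact h'
    · exact absurd (h0.2 h') h.ne
    · exact (key x hx y hy h h').elim
  · exact (sg_eq_zero.2 (h0.1 h)).trans (sg_eq_zero.2 h).symm
  · refine (sg_eq_one.2 ?_).trans (sg_eq_one.2 h).symm
    rcases lt_trichotomy (ev j y) 0 with h' | h' | h'
    · exact (key y hy x hx h' h).elim
    · exact absurd (h0.2 h') h.ne'
    · exact h'

/-- The direction of `flat x`. -/
def dirs (x : Fin n → ℝ) : Submodule ℝ (Fin n → ℝ) :=
  ⨅ j : {j // ev j x = 0}, LinearMap.ker (lin j.1)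

lemma mem_dirs {x v : Fin n → ℝ} : v ∈ dirs x ↔ ∀ j, ev j x = 0 → lin j v = 0 := by
  simp [dirs, Submodule.mem_iInf]

lemma vectorSpan_flat (x : Fin n → ℝ) : vectorSpan ℝ (flat x) = dirs x := by
  rw [vectorSpan_eq_span_vsub_set_right ℝ (mem_flat_self x)]
  have : (fun y => y -ᵥ x) '' flat x = dirs x := by
    ext v
    simp only [mem_image, SetLike.mem_coe, mem_dirs, vsub_eq_sub]
    constructor
    · rintro ⟨y, hy, rfl⟩ j hj
      have h1 := hy j hj
      rw [map_sub]
      unfold ev at hj h1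
      linarith
    · intro hv
      refine ⟨x + v, fun j hj => ?_, by simp⟩
      have := ev_add_smul j x v 1
      rw [one_smul] at this
      rw [this, hj, hv j hj]
      ring
  rw [this, Submodule.span_eq]

/-- `flat x` has codimension `c`. -/
def HasCodim (c : ℕ) (x : Fin n → ℝ) : Prop := Module.finrank ℝ (dirs x) + c = n

lemma isChamber_iff {c : ℕ} {C : Set (Fin n → ℝ)} :
    IsChamber (FC n) c C ↔ ∃ x, HasCodim c x ∧ C = cell x := by
  constructor
  · rintro ⟨K, hK, hdim, x, hx, rfl⟩
    obtain rfl := (mem_stratum_iff hK).1 hx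
    rw [vectorSpan_flat] at hdim
    exact ⟨x, hdim, component_eq_cell⟩
  · rintro ⟨x, hx, rfl⟩
    refine ⟨flat x, isFlat_flat x, ?_, x, (mem_stratum_iff (isFlat_flat x)).2 rfl,
      component_eq_cell.symm⟩
    rw [vectorSpan_flat]
    exact hx

/-- The chamber of a point. -/
def mkCh {c : ℕ} (x : Fin n → ℝ) (hx : HasCodim c x) : Ch (FC n) c :=
  ⟨cell x, isChamber_iff.2 ⟨x, hx, rfl⟩⟩

/-- A point of a chamber. -/
def Ch.pt {c : ℕ} (u : Ch (FC n) c) : Fin n → ℝ := (isChamber_iff.1 u.2).choose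

lemma Ch.hasCodim {c : ℕ} (u : Ch (FC n) c) : HasCodim c (Ch.pt u) :=
  (isChamber_iff.1 u.2).choose_spec.1

lemma Ch.val_eq {c : ℕ} (u : Ch (FC n) c) : u.1 = cell (Ch.pt u) :=
  (isChamber_iff.1 u.2).choose_spec.2

/-- The sign vector of a chamber. -/
def Ch.sgn {c : ℕ} (u : Ch (FC n) c) : Idx n → SignType := sg (Ch.pt u)

lemma Ch.mem_iff {c : ℕ} {u : Ch (FC n) c} {x : Fin n → ℝ} : x ∈ u.1 ↔ sg x = Ch.sgn u := by
  rw [Ch.val_eq]; rfl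

lemma Ch.pt_mem {c : ℕ} (u : Ch (FC n) c) : Ch.pt u ∈ u.1 := Ch.mem_iff.2 rfl

lemma Ch.ext_sgn {c : ℕ} {u v : Ch (FC n) c} (h : Ch.sgn u = Ch.sgn v) : u = v := by
  apply Subtype.ext
  ext x
  rw [Ch.mem_iff, Ch.mem_iff, h]

lemma sgn_mkCh {c : ℕ} {x : Fin n → ℝ} (hx : HasCodim c x) : Ch.sgn (mkCh x hx) = sg x :=
  (Ch.mem_iff.1 (show x ∈ (mkCh x hx).1 from rfl)).symm

/-- A chamber is in the closure of another one iff its sign vector arises by putting some signs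
equal to zero. -/
lemma Ch.subset_closure_iff {c d : ℕ} {w : Ch (FC n) c} {u : Ch (FC n) d} :
    w.1 ⊆ closure u.1 ↔ ∀ j, Ch.sgn w j ≠ 0 → Ch.sgn u j = Ch.sgn w j := by
  constructor
  · intro h j hj
    have hp := h (Ch.pt_mem w)
    rw [mem_closure_iff] at hp
    rcases lt_trichotomy (ev j (Ch.pt w)) 0 with h1 | h1 | h1
    · obtain ⟨y, hy, hyu⟩ := hp _ (isOpen_Iio.preimage (continuous_ev j)) h1
      rw [← Ch.mem_iff.1 hyu]
      exact (sg_eq_neg_one.2 hy).trans (sg_eq_neg_one.2 h1).symm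
    · exact absurd (sg_eq_zero.2 h1) hj
    · obtain ⟨y, hy, hyu⟩ := hp _ (isOpen_Ioi.preimage (continuous_ev j)) h1
      rw [← Ch.mem_iff.1 hyu]
      exact (sg_eq_one.2 hy).trans (sg_eq_one.2 h1).symm
  · intro h p hp
    have hp' := Ch.mem_iff.1 hp
    have htend : Filter.Tendsto (fun t : ℝ => (1 - t) • p + t • Ch.pt u) (𝓝[>] 0) (𝓝 p) := by
      have : Continuous fun t : ℝ => (1 - t) • p + t • Ch.pt u := by fun_prop
      have h2 := this.tendsto 0
      simp only [sub_zero, one_smul, zero_smul, add_zero] at h2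
      exact h2.mono_left nhdsWithin_le_nhds
    refine mem_closure_of_tendsto htend ?_
    filter_upwards [Ioo_mem_nhdsGT (zero_lt_one (α := ℝ))] with t ht
    rw [Ch.mem_iff]
    funext j
    change SignType.sign (ev j _) = SignType.sign (ev j (Ch.pt u))
    rw [ev_combo]
    by_cases hj : Ch.sgn w j = 0
    · have : ev j p = 0 := sg_eq_zero.1 ((congrFun hp' j).trans hj)
      rw [this, mul_zero, zero_add, sign_mul, sign_pos ht.1, one_mul]
    · have h3 := (congrFun hp' j).trans (h j hj).symm
      rw [sign_combo h3 ht.1.le ht.2.le]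
      exact h3

/-- If the signs are nonzero and opposite, the hyperplane separates the chambers, and conversely. -/
lemma separates_iff {x y : Fin n → ℝ} {j : Idx n} (hx : sg x j ≠ 0) (hy : sg y j ≠ 0) :
    Separates (hyp j) (cell x) (cell y) ↔ sg y j ≠ sg x j := by
  constructor
  · intro h heq
    obtain ⟨z, hz, hz0⟩ := h x rfl y rfl
    rw [segment_eq_image] at hz
    obtain ⟨t, ht, rfl⟩ := hz
    have h1 : SignType.sign (ev j ((1 - t) • x + t • y)) = SignType.sign (ev j x) := by
      rw [ev_combo]
      exact sign_combo heq.symm ht.1 ht.2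
    rw [show ev j ((1 - t) • x + t • y) = 0 from hz0, sign_zero] at h1
    exact hx h1.symm
  · intro hne p hp q hq
    have hp' : sg p j = sg x j := congrFun hp j
    have hq' : sg q j = sg y j := congrFun hq j
    rw [← hp'] at hx hne
    rw [← hq'] at hy hne
    have hne0 : ev j p - ev j q ≠ 0 := fun h => hne (by
      rw [sub_eq_zero] at h
      exact (congrArg SignType.sign h).symm)
    have hdiv : ev j p / (ev j p - ev j q) ∈ Icc (0 : ℝ) 1 := by
      rcases lt_trichotomy (ev j p) 0 with h1 | h1 | h1
      · have h2 : 0 < ev j q := by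
          rcases lt_trichotomy (ev j q) 0 with h2 | h2 | h2
          · exact absurd ((sg_eq_neg_one.2 h2).trans (sg_eq_neg_one.2 h1).symm) hne
          · exact absurd (sg_eq_zero.2 h2) hy
          · exact h2
        constructor
        · exact div_nonneg_of_nonpos h1.le (by linarith)
        · rw [div_le_one_of_neg (by linarith)]; linarith
      · exact absurd (sg_eq_zero.2 h1) hx
      · have h2 : ev j q < 0 := by
          rcases lt_trichotomy (ev j q) 0 with h2 | h2 | h2
          · exact h2
          · exact absurd (sg_eq_zero.2 h2) hy
          · exact absurd ((sg_eq_one.2 h2).trans (sg_eq_one.2 h1).symm) hne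
        constructor
        · exact div_nonneg h1.le (by linarith)
        · rw [div_le_one (by linarith)]; linarith
    refine ⟨(1 - ev j p / (ev j p - ev j q)) • p + (ev j p / (ev j p - ev j q)) • q, ?_, ?_⟩
    · rw [segment_eq_image]
      exact ⟨_, hdiv, rfl⟩
    · change ev j _ = 0
      rw [ev_combo]
      field_simp
      ring

lemma sgn_smul_inl (g : Mu n) {c : ℕ} (u : Ch (FC n) c) (ε : Mu n) :
    Ch.sgn (g • u) (Sum.inl ε) = Ch.sgn u (Sum.inl (g * ε)) := by
  have h : g • Ch.pt u ∈ (g • u).1 := smul_mem_smul_set (Ch.pt_mem u)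
  rw [← Ch.mem_iff.1 h]
  change SignType.sign _ = SignType.sign _
  congr 1
  rw [ev_inl, ev_inl]
  congr 1
  refine Finset.sum_congr rfl fun i _ => ?_
  rw [smul_apply]
  simp only [Pi.mul_apply, Units.val_mul, Int.cast_mul]
  ring

lemma sgn_smul_inr (g : Mu n) {c : ℕ} (u : Ch (FC n) c) (i : Fin n) :
    Ch.sgn (g • u) (Sum.inr i) = if g i = 1 then Ch.sgn u (Sum.inr i)
      else - Ch.sgn u (Sum.inr i) := by
  have h : g • Ch.pt u ∈ (g • u).1 := smul_mem_smul_set (Ch.pt_mem u)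
  rw [← Ch.mem_iff.1 h]
  change SignType.sign _ = _
  rw [ev_inr, smul_apply]
  rcases Int.units_eq_one_or (g i) with hg | hg
  · simp [hg, Ch.sgn, sg, ev_inr]
  · rw [if_neg (by rw [hg]; decide)]
    simp [hg, Ch.sgn, sg, ev_inr, Left.sign_neg]

end FCArrangement

/-! ### Faces of codimension at most two -/

namespace FCArrangement

open Salvetti

variable {n : ℕ}

lemma sg_add_smul_eventually (x v : Fin n → ℝ) :
    ∀ᶠ t in 𝓝[>] (0 : ℝ), ∀ j, sg (x + t • v) j =
      if ev j x = 0 then SignType.sign (lin j v) else sg x j := by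
  rw [Filter.eventually_all]
  intro j
  by_cases hj : ev j x = 0
  · filter_upwards [self_mem_nhdsWithin] with t ht
    rw [if_pos hj]
    change SignType.sign (ev j _) = _
    rw [ev_add_smul, hj, zero_add, sign_mul, sign_pos (show (0 : ℝ) < t from ht), one_mul]
  · rw [if_neg hj]
    have hc : Continuous fun t : ℝ => ev j (x + t • v) := (continuous_ev j).comp (by fun_prop)
    have h0 : ev j (x + (0 : ℝ) • v) = ev j x := by simp
    refine Filter.Eventually.filter_mono nhdsWithin_le_nhds ?_
    rcases lt_or_gt_of_ne hj with h | h
    · have := (hc.tendsto 0).eventually_lt_const (u := 0) (by rwa [h0])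
      filter_upwards [this] with t ht
      rw [sg_eq_neg_one.2 ht, sg_eq_neg_one.2 h]
    · have := (hc.tendsto 0).eventually_const_lt (u := 0) (by rwa [h0])
      filter_upwards [this] with t ht
      rw [sg_eq_one.2 ht, sg_eq_one.2 h]

/-- Moving a little from `x` in the direction `v`. -/
lemma exists_sg_add_smul (x v : Fin n → ℝ) :
    ∃ y, ∀ j, sg y j = if ev j x = 0 then SignType.sign (lin j v) else sg x j := by
  obtain ⟨t, ht⟩ := (sg_add_smul_eventually x v).exists
  exact ⟨_, ht⟩

lemma unit_cast_mul_self (a : ℤˣ) : ((a : ℤ) : ℝ) * ((a : ℤ) : ℝ) = 1 := by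
  rcases Int.units_eq_one_or a with h | h <;> simp [h]

lemma unit_cast_mul_of_ne {a b : ℤˣ} (h : a ≠ b) : ((a : ℤ) : ℝ) * ((b : ℤ) : ℝ) = -1 := by
  rcases Int.units_eq_one_or a with h1 | h1 <;> rcases Int.units_eq_one_or b with h2 | h2 <;>
    simp_all

lemma unit_eq_neg_of_ne {a b : ℤˣ} (h : a ≠ b) : a = -b := by
  rcases Int.units_eq_one_or a with h1 | h1 <;> rcases Int.units_eq_one_or b with h2 | h2 <;>
    simp_all

/-- The direction in which only the coordinates `p` and `q` change, parallel to the hyperplane of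
`ε`. -/
def pairDir (ε : Mu n) (p q : Fin n) : Fin n → ℝ :=
  Pi.single p ((ε p : ℤ) : ℝ) - Pi.single q ((ε q : ℤ) : ℝ)

lemma lin_pairDir (ε δ : Mu n) (p q : Fin n) : lin (Sum.inl δ) (pairDir ε p q) =
    ((δ p : ℤ) : ℝ) * ((ε p : ℤ) : ℝ) - ((δ q : ℤ) : ℝ) * ((ε q : ℤ) : ℝ) := by
  rw [pairDir, map_sub, lin_inl_single, lin_inl_single]

lemma lin_pairDir_self (ε : Mu n) (p q : Fin n) : lin (Sum.inl ε) (pairDir ε p q) = 0 := by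
  rw [lin_pairDir, unit_cast_mul_self, unit_cast_mul_self, sub_self]

lemma lin_pairDir_ne {ε δ : Mu n} {p q : Fin n} (hp : δ p = ε p) (hq : δ q ≠ ε q) :
    lin (Sum.inl δ) (pairDir ε p q) = 2 := by
  rw [lin_pairDir, hp, unit_cast_mul_self, unit_cast_mul_of_ne hq]
  norm_num

lemma lin_inl_neg {ε δ : Mu n} {x : Fin n → ℝ} (h : ∀ m, δ m = -ε m ∨ x m = 0) :
    lin (Sum.inl δ) x = -lin (Sum.inl ε) x := by
  rw [lin_inl, lin_inl, ← Finset.sum_neg_distrib]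
  refine Finset.sum_congr rfl fun m _ => ?_
  rcases h m with h | h <;> simp [h]

lemma lin_inl_of_zero {ε : Mu n} {x : Fin n → ℝ} (h : ev (Sum.inl ε) x = 0) :
    lin (Sum.inl ε) x = 1 := by
  have : lin (Sum.inl ε) x - 1 = 0 := h
  linarith

/-- Two sign vectors whose hyperplanes meet agree somewhere. -/
lemma exists_agree {ε δ : Mu n} {x : Fin n → ℝ} (hε : ev (Sum.inl ε) x = 0)
    (hδ : ev (Sum.inl δ) x = 0) : ∃ m, δ m = ε m ∧ x m ≠ 0 := by
  by_contra! h
  have := lin_inl_neg (ε := ε) (δ := δ) (x := x) fun m => by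
    by_cases hm : δ m = ε m
    · exact Or.inr (h m hm)
    · exact Or.inl (unit_eq_neg_of_ne hm)
  rw [lin_inl_of_zero hε, lin_inl_of_zero hδ] at this
  norm_num at this

lemma lin_ne_zero (hn : 2 ≤ n) (j : Idx n) : lin j ≠ 0 := by
  intro h
  rcases j with ε | i
  · have := lin_inl_single ε ⟨0, by omega⟩ 1
    rw [h, mul_one] at this
    rcases Int.units_eq_one_or (ε ⟨0, by omega⟩) with h1 | h1 <;> simp [h1] at this
  · have : lin (Sum.inr i) (Pi.single i (1 : ℝ)) = 1 := by simp [lin_inr]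
    rw [h] at this
    simp at this

lemma lin_inr_eq_ev (i : Fin n) (x : Fin n → ℝ) : lin (Sum.inr i) x = ev (Sum.inr i) x :=
  (ev_inr i x).symm

lemma exists_ne_fin (hn : 2 ≤ n) (i : Fin n) : ∃ m, m ≠ i :=
  haveI : Nontrivial (Fin n) := Fin.nontrivial_iff_two_le.2 hn
  exists_ne i

/-- Two different hyperplanes with a common point are transversal. -/
lemma exists_transversal (hn : 2 ≤ n) {x : Fin n → ℝ} {j k : Idx n} (hjk : j ≠ k)
    (hj : ev j x = 0) (hk : ev k x = 0) : ∃ v, lin j v = 0 ∧ lin k v ≠ 0 := by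
  rcases j with ε | i <;> rcases k with δ | l
  · obtain ⟨m, hm, -⟩ := exists_agree hj hk
    obtain ⟨p, hp⟩ := Function.ne_iff.1 (show ε ≠ δ from fun h => hjk (by rw [h]))
    refine ⟨pairDir ε m p, lin_pairDir_self _ _ _, ?_⟩
    rw [lin_pairDir_ne hm hp.symm]
    norm_num
  · obtain ⟨m, hm⟩ := exists_ne_fin hn l
    refine ⟨pairDir ε l m, lin_pairDir_self _ _ _, ?_⟩
    rw [lin_inr, pairDir]
    simp [hm.symm]
  · refine ⟨x, ?_, ?_⟩
    · rw [lin_inr_eq_ev]; exact hj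
    · rw [lin_inl_of_zero hk]; norm_num
  · have : i ≠ l := fun h => hjk (by rw [h])
    exact ⟨Pi.single l 1, by simp [lin_inr, this], by simp [lin_inr]⟩

lemma finrank_ker_inf_ker {f g : (Fin n → ℝ) →ₗ[ℝ] ℝ} {v : Fin n → ℝ} (hf : f ≠ 0)
    (h1 : f v = 0) (h2 : g v ≠ 0) :
    Module.finrank ℝ ↥(LinearMap.ker f ⊓ LinearMap.ker g) + 2 = n := by
  obtain ⟨w, hw⟩ : ∃ w, f w ≠ 0 := by
    by_contra! h
    exact hf (LinearMap.ext h)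
  have hsurj : LinearMap.range (f.prod g) = ⊤ := by
    rw [LinearMap.range_eq_top]
    rintro ⟨a, b⟩
    refine ⟨(a / f w) • w + ((b - a / f w * g w) / g v) • v, ?_⟩
    refine Prod.ext (?_ : f _ = a) (?_ : g _ = b)
    · rw [map_add, map_smul, map_smul, h1, smul_eq_mul, smul_zero, add_zero]
      field_simp
    · rw [map_add, map_smul, map_smul, smul_eq_mul, smul_eq_mul]
      field_simp
      ring
  have h := LinearMap.finrank_range_add_finrank_ker (f.prod g)
  rw [hsurj, finrank_top, LinearMap.ker_prod] at h
  simp at h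
  omega

lemma finrank_ker_lin (hn : 2 ≤ n) (j : Idx n) :
    Module.finrank ℝ ↥(LinearMap.ker (lin j)) + 1 = n := by
  have := Module.Dual.finrank_ker_add_one_of_ne_zero (f := lin j) (lin_ne_zero hn j)
  simpa using this

lemma hasCodim_zero_iff (hn : 2 ≤ n) {x : Fin n → ℝ} : HasCodim 0 x ↔ ∀ j, ev j x ≠ 0 := by
  constructor
  · intro h j hj
    have h1 : dirs x ≤ LinearMap.ker (lin j) := fun v hv => mem_dirs.1 hv j hj
    have h2 := Submodule.finrank_mono h1
    have h3 := finrank_ker_lin hn j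
    unfold HasCodim at h
    omega
  · intro h
    have : dirs x = ⊤ := by
      rw [eq_top_iff]
      intro v _
      exact mem_dirs.2 fun j hj => absurd hj (h j)
    rw [HasCodim, this]
    simp

lemma dirs_finrank_le (hn : 2 ≤ n) {x : Fin n → ℝ} {j k : Idx n} (hjk : j ≠ k)
    (hj : ev j x = 0) (hk : ev k x = 0) :
    dirs x ≤ LinearMap.ker (lin j) ⊓ LinearMap.ker (lin k) ∧
      Module.finrank ℝ ↥(LinearMap.ker (lin j) ⊓ LinearMap.ker (lin k)) + 2 = n := by
  obtain ⟨v, h1, h2⟩ := exists_transversal hn hjk hj hk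
  exact ⟨fun v hv => ⟨mem_dirs.1 hv j hj, mem_dirs.1 hv k hk⟩,
    finrank_ker_inf_ker (lin_ne_zero hn j) h1 h2⟩

lemma hasCodim_one_iff (hn : 2 ≤ n) {x : Fin n → ℝ} :
    HasCodim 1 x ↔ ∃ j, ∀ k, ev k x = 0 ↔ k = j := by
  constructor
  · intro h
    have h0 : ¬ ∀ j, ev j x ≠ 0 := fun h' => by
      have := (hasCodim_zero_iff hn).2 h'
      unfold HasCodim at h this
      omega
    push Not at h0
    obtain ⟨j, hj⟩ := h0
    refine ⟨j, fun k => ⟨fun hk => ?_, fun hk => hk ▸ hj⟩⟩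
    by_contra hne
    obtain ⟨h1, h2⟩ := dirs_finrank_le hn hne hk hj
    have h3 := Submodule.finrank_mono h1
    unfold HasCodim at h
    omega
  · rintro ⟨j, hj⟩
    have : dirs x = LinearMap.ker (lin j) := by
      ext v
      rw [mem_dirs, LinearMap.mem_ker]
      exact ⟨fun h => h j ((hj j).2 rfl), fun h k hk => (hj k).1 hk ▸ h⟩
    rw [HasCodim, this, finrank_ker_lin hn j]

lemma hasCodim_two_of_dirs (hn : 2 ≤ n) {x : Fin n → ℝ} {j k : Idx n} (hjk : j ≠ k)
    (hj : ev j x = 0) (hk : ev k x = 0)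
    (h : ∀ l, ev l x = 0 → ∀ v, lin j v = 0 → lin k v = 0 → lin l v = 0) : HasCodim 2 x := by
  obtain ⟨h1, h2⟩ := dirs_finrank_le hn hjk hj hk
  have : dirs x = LinearMap.ker (lin j) ⊓ LinearMap.ker (lin k) :=
    le_antisymm h1 fun v hv => mem_dirs.2 fun l hl => h l hl v hv.1 hv.2
  rw [HasCodim, this, h2]

lemma HasCodim.exists_pair (hn : 2 ≤ n) {x : Fin n → ℝ} (h : HasCodim 2 x) :
    ∃ j k, j ≠ k ∧ ev j x = 0 ∧ ev k x = 0 := by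
  by_contra! hne
  by_cases h0 : ∀ j, ev j x ≠ 0
  · have := (hasCodim_zero_iff hn).2 h0
    unfold HasCodim at h this
    omega
  · push Not at h0
    obtain ⟨j, hj⟩ := h0
    have := (hasCodim_one_iff hn).2 ⟨j, fun k => ⟨fun hk => by
      by_contra hkj
      exact hne k j hkj hk hj, fun hk => hk ▸ hj⟩⟩
    unfold HasCodim at h this
    omega

lemma HasCodim.lin_eq_zero (hn : 2 ≤ n) {x : Fin n → ℝ} (h : HasCodim 2 x) {j k l : Idx n}
    (hjk : j ≠ k) (hj : ev j x = 0) (hk : ev k x = 0) (hl : ev l x = 0) {v : Fin n → ℝ}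
    (h1 : lin j v = 0) (h2 : lin k v = 0) : lin l v = 0 := by
  obtain ⟨h3, h4⟩ := dirs_finrank_le hn hjk hj hk
  have : dirs x = LinearMap.ker (lin j) ⊓ LinearMap.ker (lin k) := by
    refine Submodule.eq_of_le_of_finrank_eq h3 ?_
    unfold HasCodim at h
    omega
  exact mem_dirs.1 (this ▸ ⟨h1, h2⟩ : v ∈ dirs x) l hl

/-- The sign vector with the `i`-th sign changed. -/
def flip (i : Fin n) (ε : Mu n) : Mu n := Function.update ε i (-ε i)

lemma flip_same (i : Fin n) (ε : Mu n) : flip i ε i = -ε i := by simp [flip]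

lemma flip_of_ne {i m : Fin n} (h : m ≠ i) (ε : Mu n) : flip i ε m = ε m := by simp [flip, h]

lemma flip_flip (i : Fin n) (ε : Mu n) : flip i (flip i ε) = ε := by
  simp [flip]

lemma flip_ne (i : Fin n) (ε : Mu n) : flip i ε ≠ ε := fun h => by
  have h1 := congrFun h i
  rw [flip_same] at h1
  rcases Int.units_eq_one_or (ε i) with h2 | h2 <;> simp [h2] at h1

lemma lin_flip (i : Fin n) (ε : Mu n) (x : Fin n → ℝ) :
    lin (Sum.inl (flip i ε)) x = lin (Sum.inl ε) x - 2 * (((ε i : ℤ) : ℝ) * x i) := by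
  have h : lin (Sum.inl ε) x - lin (Sum.inl (flip i ε)) x = 2 * (((ε i : ℤ) : ℝ) * x i) := by
    rw [lin_inl, lin_inl, ← Finset.sum_sub_distrib, Finset.sum_eq_single i]
    · simp [flip_same]; ring
    · intro m _ hm
      rw [flip_of_ne hm, sub_self]
    · simp
  linarith

lemma ev_flip (i : Fin n) (ε : Mu n) (x : Fin n → ℝ) :
    ev (Sum.inl (flip i ε)) x = ev (Sum.inl ε) x - 2 * (((ε i : ℤ) : ℝ) * x i) := by
  have := lin_flip i ε x
  simp only [ev, this, cst]
  ring

lemma eq_or_eq_flip {i : Fin n} {ε δ : Mu n} (h : ∀ m, m ≠ i → δ m = ε m) :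
    δ = ε ∨ δ = flip i ε := by
  by_cases hi : δ i = ε i
  · left
    funext m
    by_cases hm : m = i
    · rw [hm, hi]
    · exact h m hm
  · right
    funext m
    by_cases hm : m = i
    · rw [hm, flip_same, unit_eq_neg_of_ne hi]
    · rw [flip_of_ne hm, h m hm]

/-- The three types of faces of codimension two, by the hyperplanes through them. -/
inductive FaceType (x : Fin n → ℝ) : Prop
  | square (ε δ : Mu n) (p q : Fin n) (hpq : p ≠ q) (hp : ε p ≠ δ p) (hq : ε q ≠ δ q)
      (h : ∀ j, ev j x = 0 ↔ j = Sum.inl ε ∨ j = Sum.inl δ)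
  | hexagon (i : Fin n) (ε : Mu n) (hε : ε i = 1)
      (h : ∀ j, ev j x = 0 ↔ j = Sum.inr i ∨ j = Sum.inl ε ∨ j = Sum.inl (flip i ε))
  | corner (i k : Fin n) (hik : i ≠ k) (h : ∀ j, ev j x = 0 ↔ j = Sum.inr i ∨ j = Sum.inr k)

lemma HasCodim.corner (hn : 2 ≤ n) {x : Fin n → ℝ} (h : HasCodim 2 x) {i k : Fin n} (hik : i ≠ k)
    (hi : ev (Sum.inr i) x = 0) (hk : ev (Sum.inr k) x = 0) (j : Idx n) :
    ev j x = 0 ↔ j = Sum.inr i ∨ j = Sum.inr k := by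
  refine ⟨fun hj => ?_, fun hj => by rcases hj with rfl | rfl <;> assumption⟩
  have hne : (Sum.inr i : Idx n) ≠ Sum.inr k := fun h => hik (Sum.inr_injective h)
  rcases j with ε | m
  · have h1 := h.lin_eq_zero hn hne hi hk hj (v := x) (by rwa [lin_inr_eq_ev])
      (by rwa [lin_inr_eq_ev])
    rw [lin_inl_of_zero hj] at h1
    norm_num at h1
  · by_contra! hm
    have hmi : i ≠ m := fun h => hm.1 (by rw [h])
    have hmk : k ≠ m := fun h => hm.2 (by rw [h])
    have h1 := h.lin_eq_zero hn hne hi hk hj (v := Pi.single m 1) (by simp [lin_inr, hmi])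
      (by simp [lin_inr, hmk])
    simp [lin_inr] at h1

lemma HasCodim.hexagon (hn : 2 ≤ n) {x : Fin n → ℝ} (h : HasCodim 2 x) {i : Fin n} {ε : Mu n}
    (hi : ev (Sum.inr i) x = 0) (hε : ev (Sum.inl ε) x = 0) (j : Idx n) :
    ev j x = 0 ↔ j = Sum.inr i ∨ j = Sum.inl ε ∨ j = Sum.inl (flip i ε) := by
  have hxi : x i = 0 := by rwa [← ev_inr i x]
  refine ⟨fun hj => ?_, fun hj => ?_⟩
  · rcases j with δ | m
    · right
      have hsuff : ∀ p, p ≠ i → δ p = ε p := by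
        intro p hp
        by_contra hne
        obtain ⟨m, hm, hxm⟩ := exists_agree hε hj
        have hmi : m ≠ i := fun h => hxm (h ▸ hxi)
        have h1 := h.lin_eq_zero hn (j := Sum.inr i) (k := Sum.inl ε) (by simp) hi hε hj
          (v := pairDir ε m p) (by rw [lin_inr, pairDir]; simp [hp.symm, hmi.symm])
          (lin_pairDir_self _ _ _)
        rw [lin_pairDir_ne hm hne] at h1
        norm_num at h1
      rcases eq_or_eq_flip hsuff with rfl | rfl
      · exact Or.inl rfl
      · exact Or.inr rfl
    · left
      by_contra hne
      have := (h.corner hn (fun h => hne (by rw [h])) hi hj (Sum.inl ε)).1 hε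
      simp at this
  · rcases hj with rfl | rfl | rfl
    · exact hi
    · exact hε
    · rw [ev_flip, hε, hxi]; simp

lemma HasCodim.square (hn : 2 ≤ n) {x : Fin n → ℝ} (h : HasCodim 2 x) {ε δ : Mu n}
    (hne : ε ≠ δ) (hε : ev (Sum.inl ε) x = 0) (hδ : ev (Sum.inl δ) x = 0)
    (hx : ∀ i, ev (Sum.inr i) x ≠ 0) (j : Idx n) :
    ev j x = 0 ↔ j = Sum.inl ε ∨ j = Sum.inl δ := by
  have hne' : (Sum.inl ε : Idx n) ≠ Sum.inl δ := fun h => hne (Sum.inl_injective h)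
  refine ⟨fun hj => ?_, fun hj => by rcases hj with rfl | rfl <;> assumption⟩
  rcases j with η | m
  swap
  · exact absurd hj (hx m)
  -- `η` is `ε` up to a sign on the entries where `ε` and `δ` agree, and also on the other ones
  have key : ∀ p q, lin (Sum.inl δ) (pairDir ε p q) = 0 → η p = ε p → η q = ε q := by
    intro p q h1 hp
    by_contra hq
    have h2 := h.lin_eq_zero hn hne' hε hδ hj (lin_pairDir_self ε p q) h1
    rw [lin_pairDir_ne hp hq] at h2
    norm_num at h2
  have hA : ∀ p q, δ p = ε p → δ q = ε q → η p = ε p → η q = ε q := by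
    intro p q hp hq
    refine key p q ?_
    rw [lin_pairDir, hp, hq, unit_cast_mul_self, unit_cast_mul_self, sub_self]
  have hD : ∀ p q, δ p ≠ ε p → δ q ≠ ε q → η p = ε p → η q = ε q := by
    intro p q hp hq
    refine key p q ?_
    rw [lin_pairDir, unit_cast_mul_of_ne hp, unit_cast_mul_of_ne hq, sub_self]
  -- the points where `η` agrees with `ε`, and where it agrees with `δ`
  obtain ⟨p, hp, -⟩ := exists_agree hε hj
  obtain ⟨q, hq, -⟩ := exists_agree hδ hj
  have hun : ∀ {a b c : ℤˣ}, a ≠ b → c ≠ b → a = c := fun {a b c} h1 h2 =>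
    (unit_eq_neg_of_ne h1).trans (unit_eq_neg_of_ne h2).symm
  by_cases hpA : δ p = ε p
  · have h1 : ∀ m, δ m = ε m → η m = ε m := fun m hm => hA p m hpA hm hp
    by_cases hex : ∃ m, δ m ≠ ε m ∧ η m = ε m
    · left
      obtain ⟨m, hm, hm'⟩ := hex
      congr 1
      funext l
      by_cases hl : δ l = ε l
      · exact h1 l hl
      · exact hD m l hm hl hm'
    · right
      push Not at hex
      congr 1
      funext l
      by_cases hl : δ l = ε l
      · rw [h1 l hl, hl]
      · exact hun (hex l hl) hl
  · have h1 : ∀ m, δ m ≠ ε m → η m = ε m := fun m hm => hD p m hpA hm hp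
    have hqA : δ q = ε q := by
      by_contra hq'
      exact hq' (hq.symm.trans (h1 q hq'))
    left
    congr 1
    funext l
    by_cases hl : δ l = ε l
    · exact hA q l hqA hl (hq.trans hqA)
    · exact h1 l hl

lemma HasCodim.faceType (hn : 2 ≤ n) {x : Fin n → ℝ} (h : HasCodim 2 x) : FaceType x := by
  by_cases hx : ∃ i, ev (Sum.inr i) x = 0
  · obtain ⟨i, hi⟩ := hx
    obtain ⟨j, k, hjk, hj, hk⟩ := h.exists_pair hn
    -- one of the two hyperplanes is not the `i`-th coordinate hyperplane
    obtain ⟨l, hl, hli⟩ : ∃ l, ev l x = 0 ∧ l ≠ Sum.inr i := by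
      by_cases hji : j = Sum.inr i
      · exact ⟨k, hk, fun h => hjk (hji.trans h.symm)⟩
      · exact ⟨j, hj, hji⟩
    rcases l with ε | m
    · rcases Int.units_eq_one_or (ε i) with h1 | h1
      · exact .hexagon i ε h1 (h.hexagon hn hi hl)
      · exact .hexagon i (flip i ε) (by rw [flip_same, h1]; rfl)
          (h.hexagon hn hi ((h.hexagon hn hi hl _).2 (Or.inr (Or.inr rfl))))
    · have hmi : i ≠ m := fun h => hli (by rw [h])
      exact .corner i m hmi (h.corner hn hmi hi hl)
  · push Not at hx
    obtain ⟨j, k, hjk, hj, hk⟩ := h.exists_pair hn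
    rcases j with ε | i
    swap
    · exact absurd hj (hx i)
    rcases k with δ | i
    swap
    · exact absurd hk (hx i)
    have hne : ε ≠ δ := fun h => hjk (by rw [h])
    obtain ⟨p, hp⟩ := Function.ne_iff.1 hne
    by_cases hq : ∃ q, p ≠ q ∧ ε q ≠ δ q
    · obtain ⟨q, hpq, hq⟩ := hq
      exact .square ε δ p q hpq hp hq (h.square hn hne hj hk hx)
    · push Not at hq
      rcases eq_or_eq_flip (i := p) (ε := ε) (δ := δ) fun m hm => (hq m hm.symm).symm with rfl | rfl
      · exact absurd rfl hne
      · rw [ev_flip, hj] at hk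
        refine absurd ?_ (hx p)
        rw [ev_inr]
        rcases Int.units_eq_one_or (ε p) with h | h <;> simpa [h] using hk

lemma hasCodim_two_of_pair (hn : 2 ≤ n) {x : Fin n → ℝ} {j k : Idx n} (hjk : j ≠ k)
    (h : ∀ l, ev l x = 0 ↔ l = j ∨ l = k) : HasCodim 2 x := by
  refine hasCodim_two_of_dirs hn hjk ((h j).2 (Or.inl rfl)) ((h k).2 (Or.inr rfl)) ?_
  intro l hl v h1 h2
  rcases (h l).1 hl with rfl | rfl <;> assumption

end FCArrangement

/-! ### Arrows and paths around a face -/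

namespace FCArrangement

open Salvetti

variable {n : ℕ}

lemma signType_eq_neg {a b : SignType} (ha : a ≠ 0) (hb : b ≠ 0) (h : a ≠ b) : a = -b := by
  revert a b; decide

lemma signType_neg_ne {a : SignType} (ha : a ≠ 0) : -a ≠ a := by
  revert a; decide

lemma signType_eq_one_or {a : SignType} (ha : a ≠ 0) : a = 1 ∨ a = -1 := by
  revert a; decide

lemma signType_neg_eq_zero {a : SignType} : -a = 0 ↔ a = 0 := by
  revert a; decide

lemma sgn_ne_zero (hn : 2 ≤ n) (u : Ch (FC n) 0) (j : Idx n) : Ch.sgn u j ≠ 0 := fun h =>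
  (hasCodim_zero_iff hn).1 (Ch.hasCodim u) j (sg_eq_zero.1 h)

/-- The index of the hyperplane crossed by an arrow. For `2 ≤ n` it exists and is unique by
`hasCodim_one_iff`. -/
def idx (e : Arrow (FC n)) : Idx n := Classical.epsilon fun j => ∀ k, Ch.sgn e.wall k = 0 ↔ k = j

lemma sgn_wall_eq_zero (hn : 2 ≤ n) (e : Arrow (FC n)) (k : Idx n) :
    Ch.sgn e.wall k = 0 ↔ k = idx e := by
  have h : ∃ j, ∀ k, Ch.sgn e.wall k = 0 ↔ k = j := by
    obtain ⟨j, hj⟩ := (hasCodim_one_iff hn).1 (Ch.hasCodim e.wall)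
    exact ⟨j, fun k => sg_eq_zero.trans (hj k)⟩
  exact Classical.epsilon_spec h k

lemma idx_eq (hn : 2 ≤ n) {e : Arrow (FC n)} {k : Idx n} (h : Ch.sgn e.wall k = 0) : idx e = k :=
  ((sgn_wall_eq_zero hn e k).1 h).symm

lemma sgn_src_of_ne (hn : 2 ≤ n) {e : Arrow (FC n)} {k : Idx n} (hk : k ≠ idx e) :
    Ch.sgn e.src k = Ch.sgn e.wall k :=
  Ch.subset_closure_iff.1 e.src_wall k fun h => hk ((sgn_wall_eq_zero hn e k).1 h)

lemma sgn_tgt_of_ne (hn : 2 ≤ n) {e : Arrow (FC n)} {k : Idx n} (hk : k ≠ idx e) :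
    Ch.sgn e.tgt k = Ch.sgn e.src k :=
  (Ch.subset_closure_iff.1 e.tgt_wall k fun h => hk ((sgn_wall_eq_zero hn e k).1 h)).trans
    (sgn_src_of_ne hn hk).symm

lemma sgn_tgt_idx (hn : 2 ≤ n) (e : Arrow (FC n)) :
    Ch.sgn e.tgt (idx e) = -Ch.sgn e.src (idx e) := by
  refine signType_eq_neg (sgn_ne_zero hn _ _) (sgn_ne_zero hn _ _) fun h => e.ne ?_
  refine Ch.ext_sgn (funext fun k => ?_)
  by_cases hk : k = idx e
  · rw [hk, h]
  · rw [sgn_tgt_of_ne hn hk]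

/-- An arrow is determined by its source and the hyperplane which it crosses. -/
lemma arrow_ext (hn : 2 ≤ n) {e f : Arrow (FC n)} (h1 : e.src = f.src) (h2 : idx e = idx f) :
    e = f := by
  refine Arrow.ext h1 ?_ ?_
  · refine Ch.ext_sgn (funext fun k => ?_)
    by_cases hk : k = idx e
    · rw [(sgn_wall_eq_zero hn e k).2 hk, (sgn_wall_eq_zero hn f k).2 (hk.trans h2)]
    · rw [← sgn_src_of_ne hn hk, ← sgn_src_of_ne hn (h2 ▸ hk), h1]
  · refine Ch.ext_sgn (funext fun k => ?_)
    by_cases hk : k = idx e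
    · subst hk
      rw [sgn_tgt_idx hn e]
      conv_rhs => rw [h2, sgn_tgt_idx hn f, ← h1, ← h2]
    · rw [sgn_tgt_of_ne hn hk, sgn_tgt_of_ne hn (h2 ▸ hk), h1]

/-- A wall of a chamber is crossed by an arrow. -/
lemma exists_arrow (hn : 2 ≤ n) {y : Fin n → ℝ} {j : Idx n} (hy : ∀ k, ev k y = 0 ↔ k = j)
    (u : Ch (FC n) 0) (hu : ∀ k, k ≠ j → Ch.sgn u k = sg y k) :
    ∃ e : Arrow (FC n), e.src = u ∧ idx e = j ∧ Ch.sgn e.wall = sg y := by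
  obtain ⟨v, hv⟩ : ∃ v, SignType.sign (lin j v) = -Ch.sgn u j := by
    obtain ⟨w, hw⟩ : ∃ w, lin j w ≠ 0 := by
      by_contra! h
      exact lin_ne_zero hn j (LinearMap.ext h)
    by_cases h : SignType.sign (lin j w) = Ch.sgn u j
    · exact ⟨-w, by rw [map_neg, Left.sign_neg, h]⟩
    · exact ⟨w, signType_eq_neg (by simpa using hw) (sgn_ne_zero hn _ _) h⟩
  obtain ⟨z, hz⟩ := exists_sg_add_smul y v
  have hzj : sg z j = -Ch.sgn u j := by rw [hz, if_pos ((hy j).2 rfl), hv]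
  have hzk : ∀ k, k ≠ j → sg z k = sg y k := fun k hk => by
    rw [hz, if_neg fun h => hk ((hy k).1 h)]
  have hz0 : HasCodim 0 z := (hasCodim_zero_iff hn).2 fun k hk => by
    rw [← sg_eq_zero] at hk
    by_cases hkj : k = j
    · rw [hkj, hzj] at hk
      exact sgn_ne_zero hn u j (by simpa using hk)
    · rw [hzk k hkj, sg_eq_zero, hy] at hk
      exact hkj hk
  have hy1 : HasCodim 1 y := (hasCodim_one_iff hn).2 ⟨j, hy⟩
  let e : Arrow (FC n) :=
    { src := u
      wall := mkCh y hy1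
      tgt := mkCh z hz0
      ne := fun h => by
        have : Ch.sgn u j = -Ch.sgn u j := by
          conv_lhs => rw [h, sgn_mkCh, hzj]
        exact signType_neg_ne (sgn_ne_zero hn u j) this.symm
      src_wall := Ch.subset_closure_iff.2 fun k hk => by
        rw [sgn_mkCh] at hk ⊢
        exact hu k fun h => hk (sg_eq_zero.2 ((hy k).2 h))
      tgt_wall := Ch.subset_closure_iff.2 fun k hk => by
        rw [sgn_mkCh] at hk ⊢
        rw [sgn_mkCh]
        exact hzk k fun h => hk (sg_eq_zero.2 ((hy k).2 h)) }
  refine ⟨e, rfl, idx_eq hn ?_, sgn_mkCh hy1⟩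
  change Ch.sgn (mkCh y hy1) j = 0
  rw [sgn_mkCh, sg_eq_zero, hy]

lemma sgn_of_path (hn : 2 ≤ n) {u v : Ch (FC n) 0} {p : List (Arrow (FC n))} (h : IsPath u p v)
    {k : Idx n} (hk : k ∉ p.map idx) : Ch.sgn v k = Ch.sgn u k := by
  induction p generalizing u with
  | nil => rw [show u = v from h]
  | cons e p ih =>
    rw [List.map_cons, List.mem_cons, not_or] at hk
    rw [ih h.2 hk.2, sgn_tgt_of_ne hn hk.1, h.1]

lemma sgn_of_path_neg (hn : 2 ≤ n) {u v : Ch (FC n) 0} {p : List (Arrow (FC n))}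
    (h : IsPath u p v) (hp : (p.map idx).Nodup) {k : Idx n} (hk : k ∈ p.map idx) :
    Ch.sgn v k = -Ch.sgn u k := by
  induction p generalizing u with
  | nil => simp at hk
  | cons e p ih =>
    rw [List.map_cons, List.nodup_cons] at hp
    rw [List.map_cons, List.mem_cons] at hk
    rcases hk with rfl | hk
    · rw [sgn_of_path hn h.2 hp.1, sgn_tgt_idx hn, h.1]
    · have hne : k ≠ idx e := fun hke => hp.1 (hke ▸ hk)
      rw [ih h.2 hp.2 hk, sgn_tgt_of_ne hn hne, h.1]

/-- The chamber `u` has `x` in its closure. -/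
def Near (x : Fin n → ℝ) (u : Ch (FC n) 0) : Prop := ∀ k, ev k x ≠ 0 → Ch.sgn u k = sg x k

lemma subset_closure_iff_near {c : ℕ} {x : Fin n → ℝ} (hx : HasCodim c x) {u : Ch (FC n) 0} :
    (mkCh x hx).1 ⊆ closure u.1 ↔ Near x u := by
  rw [Ch.subset_closure_iff, sgn_mkCh]
  exact forall_congr' fun k => by rw [Ne, sg_eq_zero]

lemma Near.tgt (hn : 2 ≤ n) {x : Fin n → ℝ} {e : Arrow (FC n)} (h : Near x e.src)
    (hx : ev (idx e) x = 0) : Near x e.tgt := fun k hk => by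
  have hke : k ≠ idx e := fun hke => hk (by rw [hke]; exact hx)
  rw [sgn_tgt_of_ne hn hke, h k hk]

/-- The chamber on the side of `x` to which a direction points. -/
lemma exists_near (hn : 2 ≤ n) (x v : Fin n → ℝ) (hv : ∀ k, ev k x = 0 → lin k v ≠ 0) :
    ∃ u, Near x u ∧ ∀ k, ev k x = 0 → Ch.sgn u k = SignType.sign (lin k v) := by
  obtain ⟨y, hy⟩ := exists_sg_add_smul x v
  have h0 : HasCodim 0 y := (hasCodim_zero_iff hn).2 fun k hk => by
    rw [← sg_eq_zero, hy] at hk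
    split_ifs at hk with h
    · exact hv k h (sign_eq_zero_iff.1 hk)
    · exact h (sg_eq_zero.1 hk)
  refine ⟨mkCh y h0, fun k hk => ?_, fun k hk => ?_⟩
  · rw [sgn_mkCh, hy, if_neg hk]
  · rw [sgn_mkCh, hy, if_pos hk]

/-- A direction parallel to the `j`-th hyperplane gives an arrow which crosses it near `x`. -/
lemma exists_cross (hn : 2 ≤ n) {x v : Fin n → ℝ} {j : Idx n} {u : Ch (FC n) 0} (hu : Near x u)
    (hj : ev j x = 0) (hv : lin j v = 0)
    (h : ∀ k, k ≠ j → ev k x = 0 → Ch.sgn u k = SignType.sign (lin k v)) :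
    ∃ e : Arrow (FC n), e.src = u ∧ idx e = j := by
  obtain ⟨y, hy⟩ := exists_sg_add_smul x v
  have hy0 : ∀ k, ev k y = 0 ↔ k = j := fun k => by
    rw [← sg_eq_zero, hy]
    split_ifs with hk
    · rw [sign_eq_zero_iff]
      refine ⟨fun h0 => ?_, fun hkj => hkj ▸ hv⟩
      by_contra hkj
      have := h k hkj hk
      rw [h0, sign_zero] at this
      exact sgn_ne_zero hn u k this
    · rw [sg_eq_zero]
      exact ⟨fun h => absurd h hk, fun h => by rw [h, hj]⟩
  obtain ⟨e, h1, h2, -⟩ := exists_arrow hn hy0 u fun k hk => by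
    rw [hy]
    split_ifs with hk0
    · exact h k hk hk0
    · exact hu k hk0
  exact ⟨e, h1, h2⟩

lemma exists_transversal_sign (hn : 2 ≤ n) {x : Fin n → ℝ} {j k : Idx n} (hjk : j ≠ k)
    (hj : ev j x = 0) (hk : ev k x = 0) {s : SignType} (hs : s ≠ 0) :
    ∃ v, lin j v = 0 ∧ SignType.sign (lin k v) = s := by
  obtain ⟨v, h1, h2⟩ := exists_transversal hn hjk hj hk
  by_cases h : SignType.sign (lin k v) = s
  · exact ⟨v, h1, h⟩
  · refine ⟨-v, by rw [map_neg, h1, neg_zero], ?_⟩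
    rw [map_neg, Left.sign_neg, signType_eq_neg (by simpa using h2) hs h, neg_neg]

/-- Around a face in only two hyperplanes, each of them can be crossed. -/
lemma exists_cross_pair (hn : 2 ≤ n) {x : Fin n → ℝ} {j k : Idx n} (hjk : j ≠ k)
    (h : ∀ l, ev l x = 0 ↔ l = j ∨ l = k) {u : Ch (FC n) 0} (hu : Near x u) :
    ∃ e : Arrow (FC n), e.src = u ∧ idx e = j := by
  have hj := (h j).2 (Or.inl rfl)
  obtain ⟨v, h1, h2⟩ := exists_transversal_sign hn hjk hj ((h k).2 (Or.inr rfl))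
    (sgn_ne_zero hn u k)
  refine exists_cross hn hu hj h1 fun l hl hl0 => ?_
  rcases (h l).1 hl0 with rfl | rfl
  · exact absurd rfl hl
  · exact h2.symm

section Hexagon

variable {x : Fin n → ℝ} {i : Fin n} {ε : Mu n}

/-- The face `x` is in exactly three hyperplanes, one of which is a coordinate hyperplane. The other
two are ordered by the condition `ε i = 1`. -/
def IsHexagon (x : Fin n → ℝ) (i : Fin n) (ε : Mu n) : Prop :=
  ε i = 1 ∧ ∀ j, ev j x = 0 ↔ j = Sum.inr i ∨ j = Sum.inl ε ∨ j = Sum.inl (flip i ε)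

lemma lin_flip_of_one (hε : ε i = 1) (x : Fin n → ℝ) :
    lin (Sum.inl (flip i ε)) x = lin (Sum.inl ε) x - 2 * lin (Sum.inr i) x := by
  rw [lin_flip, hε, lin_inr]; simp

/-- A chamber around a face in three hyperplanes has only two of them as walls. The coordinate
hyperplane is a wall if the chamber is on the same side of the other two. -/
lemma IsHexagon.cross_coord (hn : 2 ≤ n) (h : IsHexagon x i ε) {u : Ch (FC n) 0} (hu : Near x u)
    (hs : Ch.sgn u (Sum.inl ε) = Ch.sgn u (Sum.inl (flip i ε))) :
    ∃ e : Arrow (FC n), e.src = u ∧ idx e = Sum.inr i := by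
  have h0 := (h.2 _).2 (Or.inl rfl)
  obtain ⟨v, h1, h2⟩ := exists_transversal_sign hn (by simp) h0
    ((h.2 _).2 (Or.inr (Or.inl rfl))) (sgn_ne_zero hn u (Sum.inl ε))
  refine exists_cross hn hu h0 h1 fun l hl hl0 => ?_
  rcases (h.2 l).1 hl0 with rfl | rfl | rfl
  · exact absurd rfl hl
  · exact h2.symm
  · rw [← hs, lin_flip_of_one h.1, h1, mul_zero, sub_zero, h2]

lemma IsHexagon.cross_self (hn : 2 ≤ n) (h : IsHexagon x i ε) {u : Ch (FC n) 0} (hu : Near x u)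
    (hs : Ch.sgn u (Sum.inl (flip i ε)) = -Ch.sgn u (Sum.inr i)) :
    ∃ e : Arrow (FC n), e.src = u ∧ idx e = Sum.inl ε := by
  have h0 := (h.2 _).2 (Or.inr (Or.inl rfl))
  obtain ⟨v, h1, h2⟩ := exists_transversal_sign hn (by simp) h0
    ((h.2 _).2 (Or.inl rfl)) (sgn_ne_zero hn u (Sum.inr i))
  refine exists_cross hn hu h0 h1 fun l hl hl0 => ?_
  rcases (h.2 l).1 hl0 with rfl | rfl | rfl
  · exact h2.symm
  · exact absurd rfl hl
  · rw [hs, lin_flip_of_one h.1, h1, zero_sub, Left.sign_neg, sign_mul, h2, sign_pos two_pos,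
      one_mul]

lemma IsHexagon.cross_flip (hn : 2 ≤ n) (h : IsHexagon x i ε) {u : Ch (FC n) 0} (hu : Near x u)
    (hs : Ch.sgn u (Sum.inl ε) = Ch.sgn u (Sum.inr i)) :
    ∃ e : Arrow (FC n), e.src = u ∧ idx e = Sum.inl (flip i ε) := by
  have h0 := (h.2 _).2 (Or.inr (Or.inr rfl))
  obtain ⟨v, h1, h2⟩ := exists_transversal_sign hn (by simp) h0
    ((h.2 _).2 (Or.inl rfl)) (sgn_ne_zero hn u (Sum.inr i))
  refine exists_cross hn hu h0 h1 fun l hl hl0 => ?_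
  rcases (h.2 l).1 hl0 with rfl | rfl | rfl
  · exact h2.symm
  · have h3 := lin_flip_of_one h.1 v
    rw [h1] at h3
    rw [hs, show lin (Sum.inl ε) v = 2 * lin (Sum.inr i) v by linarith, sign_mul, h2,
      sign_pos two_pos, one_mul]
  · exact absurd rfl hl

/-- On the positive side of the `i`-th coordinate hyperplane, `ε` takes larger values than
`flip i ε`. -/
lemma sgn_of_flip (hε : ε i = 1) {u : Ch (FC n) 0} (h1 : Ch.sgn u (Sum.inr i) = 1)
    (h2 : Ch.sgn u (Sum.inl (flip i ε)) = 1) : Ch.sgn u (Sum.inl ε) = 1 := by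
  have h3 := sg_eq_one.1 h1
  have h4 := sg_eq_one.1 h2
  rw [ev_inr] at h3
  rw [ev_flip, hε] at h4
  refine sg_eq_one.2 ?_
  simp at h4
  linarith

lemma sgn_flip_of (hε : ε i = 1) {u : Ch (FC n) 0} (h1 : Ch.sgn u (Sum.inr i) = -1)
    (h2 : Ch.sgn u (Sum.inl ε) = 1) : Ch.sgn u (Sum.inl (flip i ε)) = 1 := by
  have h3 := sg_eq_neg_one.1 h1
  have h4 := sg_eq_one.1 h2
  rw [ev_inr] at h3
  refine sg_eq_one.2 ?_
  rw [ev_flip, hε]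
  simp
  linarith

end Hexagon

/-- The sign vector after the `j`-th hyperplane has been crossed. -/
def flipAt (s : Idx n → SignType) (j : Idx n) : Idx n → SignType := Function.update s j (-s j)

lemma sgn_tgt (hn : 2 ≤ n) (e : Arrow (FC n)) :
    Ch.sgn e.tgt = flipAt (Ch.sgn e.src) (idx e) := by
  funext k
  by_cases hk : k = idx e
  · subst hk
    rw [sgn_tgt_idx hn, flipAt, Function.update_self]
  · rw [sgn_tgt_of_ne hn hk, flipAt, Function.update_of_ne hk]

/-- Two paths which cross the hyperplanes through a face once have the same product under a
labelling which is compatible with the 2-cells. -/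
lemma prod_eq_of_around (hn : 2 ≤ n) {Q : Type*} [Monoid Q] {ℓ : Arrow (FC n) → Q}
    (hℓ : ∀ F : Disc (FC n), (F.lower.map ℓ).prod = (F.upper.map ℓ).prod) {x : Fin n → ℝ}
    (hx : HasCodim 2 x) {u v w : Ch (FC n) 0} (hu : Near x u) {p q : List (Arrow (FC n))}
    (hp : IsPath u p v) (hq : IsPath u q w) (hp1 : (p.map idx).Nodup) (hq1 : (q.map idx).Nodup)
    (hp2 : ∀ k, k ∈ p.map idx ↔ ev k x = 0) (hq2 : ∀ k, k ∈ q.map idx ↔ ev k x = 0) :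
    (p.map ℓ).prod = (q.map ℓ).prod := by
  by_cases hpq : p = q
  · rw [hpq]
  have hv0 : ∀ k, ev k x ≠ 0 → Ch.sgn v k = Ch.sgn u k := fun k hk =>
    sgn_of_path hn hp fun h => hk ((hp2 k).1 h)
  have hv1 : ∀ k, ev k x = 0 → Ch.sgn v k = -Ch.sgn u k := fun k hk =>
    sgn_of_path_neg hn hp hp1 ((hp2 k).2 hk)
  obtain rfl : v = w := Ch.ext_sgn (funext fun k => by
    by_cases hk : ev k x = 0
    · rw [hv1 k hk, sgn_of_path_neg hn hq hq1 ((hq2 k).2 hk)]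
    · rw [hv0 k hk, sgn_of_path hn hq fun h => hk ((hq2 k).1 h)])
  -- a path from `u` to `v` crosses all the hyperplanes through `x`
  have hshort : ∀ r : List (Arrow (FC n)), (r.map idx).Nodup → (∀ k, k ∈ r.map idx ↔ ev k x = 0) →
      ∀ q, IsPath u q v → r.length ≤ q.length := by
    intro r hr1 hr2 q hq
    have hsub : r.map idx ⊆ q.map idx := fun k hk => by
      by_contra hkq
      have h1 := sgn_of_path hn hq hkq
      rw [hv1 k ((hr2 k).1 hk)] at h1
      exact signType_neg_ne (sgn_ne_zero hn u k) h1
    simpa using (hr1.subperm hsub).length_le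
  exact hℓ
    { src := u
      face := mkCh x hx
      tgt := v
      src_face := (subset_closure_iff_near hx).2 hu
      tgt_face := (subset_closure_iff_near hx).2 fun k hk => by rw [hv0 k hk, hu k hk]
      opposite := fun A hA hxA => by
        obtain ⟨k, rfl⟩ := exists_hyp_of_mem hA
        have hk : ev k x = 0 := hxA (show x ∈ (mkCh x hx).1 from rfl)
        rw [Ch.val_eq, Ch.val_eq, separates_iff (sgn_ne_zero hn u k) (sgn_ne_zero hn v k)]
        change Ch.sgn v k ≠ Ch.sgn u k
        rw [hv1 k hk]
        exact signType_neg_ne (sgn_ne_zero hn u k)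
      lower := p
      upper := q
      lower_shortest := ⟨hp, hshort p hp1 hp2⟩
      upper_shortest := ⟨hq, hshort q hq1 hq2⟩
      lower_ne_upper := hpq }

/-- The chamber has positive coordinates. -/
def IsPos (u : Ch (FC n) 0) : Prop := ∀ i, Ch.sgn u (Sum.inr i) = 1

/-- There is a path to the opposite chamber which crosses each hyperplane through the face once. -/
lemma exists_around (hn : 2 ≤ n) {x : Fin n → ℝ} (hx : HasCodim 2 x) {u : Ch (FC n) 0}
    (hu : Near x u) (hpos : IsPos u) : ∃ (p : List (Arrow (FC n))) (v : Ch (FC n) 0),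
      IsPath u p v ∧ (p.map idx).Nodup ∧ ∀ k, k ∈ p.map idx ↔ ev k x = 0 := by
  have pair : ∀ j k : Idx n, j ≠ k → (∀ l, ev l x = 0 ↔ l = j ∨ l = k) →
      ∃ (p : List (Arrow (FC n))) (v : Ch (FC n) 0),
      IsPath u p v ∧ (p.map idx).Nodup ∧ ∀ k, k ∈ p.map idx ↔ ev k x = 0 := by
    intro j k hjk h
    obtain ⟨e, rfl, he⟩ := exists_cross_pair hn hjk h hu
    have hu' := hu.tgt hn (by rw [he, h]; exact Or.inl rfl)
    obtain ⟨f, hf, hf'⟩ := exists_cross_pair hn hjk.symm (fun l => by rw [h, or_comm]) hu'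
    exact ⟨[e, f], f.tgt, ⟨rfl, hf, rfl⟩, by simp [he, hf', hjk], fun l => by simp [he, hf', h]⟩
  rcases hx.faceType hn with ⟨ε, δ, p, -, -, hp, -, h⟩ | ⟨i, ε, hε, h⟩ | ⟨i, k, hik, h⟩
  · exact pair _ _ (fun h => hp (by rw [Sum.inl_injective h])) h
  swap
  · exact pair _ _ (fun h => hik (Sum.inr_injective h)) h
  have hh : IsHexagon x i ε := ⟨hε, h⟩
  have h0 := hpos i
  have hA := (h _).2 (Or.inl rfl)
  have hE := (h _).2 (Or.inr (Or.inl rfl))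
  have hD := (h _).2 (Or.inr (Or.inr rfl))
  have hne := (flip_ne i ε).symm
  rcases signType_eq_one_or (sgn_ne_zero hn u (Sum.inl (flip i ε))) with h1 | h1
  · -- all three signs are positive
    have h2 := sgn_of_flip hε h0 h1
    obtain ⟨e, rfl, he⟩ := hh.cross_coord hn hu (h2.trans h1.symm)
    have hu1 := hu.tgt hn (by rwa [he])
    obtain ⟨f, hf, hf'⟩ := hh.cross_self hn hu1 (by
      rw [sgn_tgt hn, he]; simp [flipAt, h0, h1])
    have hu2 : Near x f.tgt := Near.tgt hn (by rwa [hf]) (by rwa [hf'])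
    obtain ⟨g, hg, hg'⟩ := hh.cross_flip hn hu2 (by
      rw [sgn_tgt hn, hf', hf, sgn_tgt hn, he]; simp [flipAt, h0, h2])
    exact ⟨[e, f, g], g.tgt, ⟨rfl, hf, hg, rfl⟩, by simp [he, hf', hg', hne],
      fun l => by simp [he, hf', hg', h]⟩
  · rcases signType_eq_one_or (sgn_ne_zero hn u (Sum.inl ε)) with h2 | h2
    · obtain ⟨e, rfl, he⟩ := hh.cross_self hn hu (by rw [h1, h0])
      have hu1 := hu.tgt hn (by rwa [he])
      obtain ⟨f, hf, hf'⟩ := hh.cross_coord hn hu1 (by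
        rw [sgn_tgt hn, he]; simp [flipAt, h1, h2, hne.symm])
      have hu2 : Near x f.tgt := Near.tgt hn (by rwa [hf]) (by rwa [hf'])
      obtain ⟨g, hg, hg'⟩ := hh.cross_flip hn hu2 (by
        rw [sgn_tgt hn, hf', hf, sgn_tgt hn, he]; simp [flipAt, h0, h2])
      exact ⟨[e, f, g], g.tgt, ⟨rfl, hf, hg, rfl⟩, by simp [he, hf', hg', hne],
        fun l => by simp only [List.map_cons, List.map_nil, he, hf', hg', h]; simp; tauto⟩
    · obtain ⟨e, rfl, he⟩ := hh.cross_self hn hu (by rw [h1, h0])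
      have hu1 := hu.tgt hn (by rwa [he])
      obtain ⟨f, hf, hf'⟩ := hh.cross_flip hn hu1 (by
        rw [sgn_tgt hn, he]; simp [flipAt, h0, h2])
      have hu2 : Near x f.tgt := Near.tgt hn (by rwa [hf]) (by rwa [hf'])
      obtain ⟨g, hg, hg'⟩ := hh.cross_coord hn hu2 (by
        rw [sgn_tgt hn, hf', hf, sgn_tgt hn, he]; simp [flipAt, h1, h2, hne, hne.symm])
      exact ⟨[e, f, g], g.tgt, ⟨rfl, hf, hg, rfl⟩, by simp [he, hf', hg', hne],
        fun l => by simp only [List.map_cons, List.map_nil, he, hf', hg', h]; simp; tauto⟩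

/-- The boundary paths of a 2-cell cross each hyperplane through its face once. -/
lemma idx_of_shortest (hn : 2 ≤ n) {F : Disc (FC n)} (hpos : IsPos F.src)
    {q : List (Arrow (FC n))} (hq : IsShortestPath F.src q F.tgt) :
    (q.map idx).Nodup ∧ ∀ k, k ∈ q.map idx ↔ ev k (Ch.pt F.face) = 0 := by
  have hu : Near (Ch.pt F.face) F.src := fun k hk =>
    Ch.subset_closure_iff.1 F.src_face k fun h => hk (sg_eq_zero.1 h)
  have hw : Near (Ch.pt F.face) F.tgt := fun k hk =>
    Ch.subset_closure_iff.1 F.tgt_face k fun h => hk (sg_eq_zero.1 h)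
  obtain ⟨p, v, hp, hp1, hp2⟩ := exists_around hn (Ch.hasCodim F.face) hu hpos
  have hopp : ∀ k, ev k (Ch.pt F.face) = 0 → Ch.sgn F.tgt k = -Ch.sgn F.src k := fun k hk => by
    refine signType_eq_neg (sgn_ne_zero hn _ _) (sgn_ne_zero hn _ _) ?_
    have h := F.opposite _ (hyp_mem k) fun z hz => by
      have h1 := congrFun (Ch.mem_iff.1 hz) k
      rw [Ch.sgn, sg_eq_zero.2 hk, sg_eq_zero] at h1
      exact h1
    rw [Ch.val_eq, Ch.val_eq, separates_iff (sgn_ne_zero hn _ k) (sgn_ne_zero hn _ k)] at h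
    exact h
  obtain rfl : v = F.tgt := Ch.ext_sgn (funext fun k => by
    by_cases hk : ev k (Ch.pt F.face) = 0
    · rw [hopp k hk, sgn_of_path_neg hn hp hp1 ((hp2 k).2 hk)]
    · rw [hw k hk, sgn_of_path hn hp fun h => hk ((hp2 k).1 h), hu k hk])
  have hsub : p.map idx ⊆ q.map idx := fun k hk => by
    by_contra hkq
    have h1 := sgn_of_path hn hq.1 hkq
    rw [hopp k ((hp2 k).1 hk)] at h1
    exact signType_neg_ne (sgn_ne_zero hn _ k) h1
  have hperm := (hp1.subperm hsub).perm_of_length_le (by simpa using hq.2 p hp)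
  exact ⟨hperm.nodup_iff.1 hp1, fun k => by rw [← hperm.mem_iff, hp2]⟩

end FCArrangement

/-! ### The group action, heights and spanning cells in terms of signs -/

namespace FCArrangement

open Salvetti

variable {n : ℕ}

lemma mu_mul_self (g : Mu n) : g * g = 1 := funext fun i => Int.units_mul_self (g i)

lemma mu_mul_cancel (g ε : Mu n) : g * (g * ε) = ε := by
  rw [← mul_assoc, mu_mul_self, one_mul]

/-- The action of the group on the hyperplanes. -/
def actIdx (g : Mu n) : Idx n → Idx n := Sum.map (g * ·) id

lemma sgn_smul_eq_zero {c : ℕ} (g : Mu n) (u : Ch (FC n) c) (j : Idx n) :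
    Ch.sgn (g • u) (actIdx g j) = 0 ↔ Ch.sgn u j = 0 := by
  rcases j with ε | i
  · change Ch.sgn (g • u) (Sum.inl (g * ε)) = 0 ↔ _
    rw [sgn_smul_inl, mu_mul_cancel]
  · change Ch.sgn (g • u) (Sum.inr i) = 0 ↔ _
    rw [sgn_smul_inr]
    split_ifs <;> simp

lemma idx_smul (hn : 2 ≤ n) (g : Mu n) (e : Arrow (FC n)) : idx (g • e) = actIdx g (idx e) :=
  idx_eq hn ((sgn_smul_eq_zero g e.wall _).2 ((sgn_wall_eq_zero hn e _).2 rfl))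

/-- The orthant of a sign vector, as the element of the group which moves it to the positive
orthant. -/
def orth (s : Idx n → SignType) : Mu n := fun i => if s (Sum.inr i) = 1 then 1 else -1

lemma orth_of_isPos {u : Ch (FC n) 0} (h : IsPos u) : orth (Ch.sgn u) = 1 := by
  funext i
  simp [orth, h i]

lemma orth_smul (hn : 2 ≤ n) (g : Mu n) (u : Ch (FC n) 0) :
    orth (Ch.sgn (g • u)) = g * orth (Ch.sgn u) := by
  funext i
  rw [Pi.mul_apply, orth, orth, sgn_smul_inr]
  rcases Int.units_eq_one_or (g i) with h | h <;>
    rcases signType_eq_one_or (sgn_ne_zero hn u (Sum.inr i)) with h1 | h1 <;> simp [h, h1]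

lemma exists_smul_isPos (hn : 2 ≤ n) (u : Ch (FC n) 0) : ∃ g : Mu n, IsPos (g • u) := by
  refine ⟨orth (Ch.sgn u), fun i => ?_⟩
  rw [sgn_smul_inr, orth]
  rcases signType_eq_one_or (sgn_ne_zero hn u (Sum.inr i)) with h1 | h1 <;> simp [h1]

lemma subset_orthant_iff (hn : 2 ≤ n) {u : Ch (FC n) 0} : u.1 ⊆ orthant n ↔ IsPos u := by
  constructor
  · intro h i
    rcases signType_eq_one_or (sgn_ne_zero hn u (Sum.inr i)) with h1 | h1
    · exact h1
    · have h2 := sg_eq_neg_one.1 h1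
      rw [ev_inr] at h2
      exact absurd (h (Ch.pt_mem u) i) (not_le.2 h2)
  · intro h x hx i
    have h1 := sg_eq_one.1 ((congrFun (Ch.mem_iff.1 hx) (Sum.inr i)).trans (h i))
    rw [ev_inr] at h1
    exact h1.le

lemma H_injective : Function.Injective (H : Mu n → Set (Fin n → ℝ)) := by
  intro ε δ h
  funext i
  have h1 : Pi.single i ((ε i : ℤ) : ℝ) ∈ H ε := by
    change _ = _
    rw [← lin_inl, lin_inl_single, unit_cast_mul_self]
  rw [h] at h1
  have h2 : ∑ m, ((δ m : ℤ) : ℝ) * (Pi.single i ((ε i : ℤ) : ℝ) : Fin n → ℝ) m = 1 := h1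
  rw [← lin_inl, lin_inl_single] at h2
  by_contra hne
  rw [unit_cast_mul_of_ne (Ne.symm hne)] at h2
  norm_num at h2

lemma cell_zero : cell (0 : Fin n → ℝ) = {0} := by
  ext x
  constructor
  · intro h
    rw [mem_singleton_iff]
    funext i
    have h1 : sg x (Sum.inr i) = sg 0 (Sum.inr i) := congrFun h _
    rw [sg_eq_zero.2 (by rw [ev_inr]; rfl : ev (Sum.inr i) (0 : Fin n → ℝ) = 0), sg_eq_zero,
      ev_inr] at h1
    exact h1
  · rintro rfl
    rfl

lemma height_eq (hn : 2 ≤ n) (u : Ch (FC n) 0) :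
    height u = {ε : Mu n | Ch.sgn u (Sum.inl ε) = 1}.ncard := by
  rw [← ncard_image_of_injective _ H_injective, height]
  congr 1
  ext K
  have h : ∀ ε, Separates (H ε) {0} u.1 ↔ Ch.sgn u (Sum.inl ε) = 1 := by
    intro ε
    have h0 : sg (0 : Fin n → ℝ) (Sum.inl ε) = -1 := by
      rw [sg_eq_neg_one, ev_inl]
      simp
    rw [← cell_zero, Ch.val_eq u, ← hyp_inl, separates_iff (by rw [h0]; decide)
      (sgn_ne_zero hn u _), h0]
    change Ch.sgn u _ ≠ -1 ↔ _
    rcases signType_eq_one_or (sgn_ne_zero hn u (Sum.inl ε)) with h1 | h1 <;> simp [h1]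
  constructor
  · rintro ⟨⟨ε, rfl⟩, hs⟩
    exact ⟨ε, (h ε).1 hs, rfl⟩
  · rintro ⟨ε, hε, rfl⟩
    exact ⟨⟨ε, rfl⟩, (h ε).2 hε⟩

/-- The arrow crosses one of the hyperplanes `H ε`, away from the origin. -/
def IsUp (e : Arrow (FC n)) : Prop := ∃ ε, idx e = Sum.inl ε ∧ Ch.sgn e.src (Sum.inl ε) = -1

lemma isUp_smul (hn : 2 ≤ n) (g : Mu n) (e : Arrow (FC n)) : IsUp (g • e) ↔ IsUp e := by
  have key : ∀ (g : Mu n) (e : Arrow (FC n)), IsUp e → IsUp (g • e) := by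
    rintro g e ⟨ε, h1, h2⟩
    refine ⟨g * ε, by rw [idx_smul hn, h1]; rfl, ?_⟩
    change Ch.sgn (g • e.src) _ = _
    rw [sgn_smul_inl, mu_mul_cancel, h2]
  refine ⟨fun h => ?_, key g e⟩
  have := key g⁻¹ _ h
  rwa [inv_smul_smul] at this

lemma IsUp.height (hn : 2 ≤ n) {e : Arrow (FC n)} (h : IsUp e) :
    height e.src + 1 = height e.tgt := by
  obtain ⟨ε, h1, h2⟩ := h
  have hn' : ε ∉ {δ : Mu n | Ch.sgn e.src (Sum.inl δ) = 1} := by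
    change ¬ _ = _
    rw [h2]; decide
  rw [height_eq hn, height_eq hn, ← ncard_insert_of_notMem hn']
  congr 1
  ext δ
  rw [sgn_tgt hn, h1]
  change δ = ε ∨ _ ↔ _
  by_cases hδ : δ = ε
  · simp [hδ, flipAt, h2]
  · simp [hδ, flipAt]

/-- An arrow across `H ε` towards the origin lowers the height. -/
lemma not_isUp_height (hn : 2 ≤ n) {e : Arrow (FC n)} {ε : Mu n} (h1 : idx e = Sum.inl ε)
    (h2 : Ch.sgn e.src (Sum.inl ε) = 1) : height e.src = height e.tgt + 1 := by
  have hn' : ε ∉ {δ : Mu n | Ch.sgn e.tgt (Sum.inl δ) = 1} := by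
    change ¬ _ = _
    rw [← h1, sgn_tgt_idx hn, h1, h2]; decide
  rw [height_eq hn, height_eq hn, ← ncard_insert_of_notMem hn']
  congr 1
  ext δ
  rw [sgn_tgt hn, h1]
  change _ ↔ δ = ε ∨ _
  by_cases hδ : δ = ε
  · simp [hδ, h2]
  · simp [hδ, flipAt]

/-- The spanning arrows are the arrows in the positive orthant which lead away from the origin. -/
lemma isSpanningArrow_iff (hn : 2 ≤ n) {e : Arrow (FC n)} :
    IsSpanningArrow e ↔ IsPos e.src ∧ IsUp e := by
  constructor
  · rintro ⟨h1, -, ⟨ε, h3⟩, h4⟩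
    refine ⟨(subset_orthant_iff hn).1 h1, ε, idx_eq hn ?_, ?_⟩
    · have := h3 (Ch.pt_mem e.wall)
      rw [← hyp_inl] at this
      exact sg_eq_zero.2 this
    · have hi : idx e = Sum.inl ε := idx_eq hn (by
        have := h3 (Ch.pt_mem e.wall)
        rw [← hyp_inl] at this
        exact sg_eq_zero.2 this)
      rcases signType_eq_one_or (sgn_ne_zero hn e.src (Sum.inl ε)) with h5 | h5
      · have := not_isUp_height hn hi h5
        omega
      · exact h5
  · rintro ⟨h1, h2⟩
    refine ⟨(subset_orthant_iff hn).2 h1, ?_, ?_, h2.height hn⟩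
    · have hcl : IsClosed (orthant n) := by
        have : orthant n = ⋂ i, {x | 0 ≤ x i} := by ext; simp [orthant]
        rw [this]
        exact isClosed_iInter fun i => isClosed_le continuous_const (continuous_apply i)
      exact e.src_wall.trans (closure_minimal ((subset_orthant_iff hn).2 h1) hcl)
    · obtain ⟨ε, h3, -⟩ := h2
      refine ⟨ε, fun x hx => ?_⟩
      have := (sgn_wall_eq_zero hn e _).2 h3.symm
      rw [← Ch.mem_iff.1 hx, sg_eq_zero] at this
      rw [← hyp_inl]
      exact this

lemma exists_smul_isSpanningArrow (hn : 2 ≤ n) {e : Arrow (FC n)} (h : IsUp e) :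
    ∃ g : Mu n, IsSpanningArrow (g • e) := by
  obtain ⟨g, hg⟩ := exists_smul_isPos hn e.src
  exact ⟨g, (isSpanningArrow_iff hn).2 ⟨hg, (isUp_smul hn g e).2 h⟩⟩

lemma sgn_src_of_mem_path (hn : 2 ≤ n) {u v : Ch (FC n) 0} {p : List (Arrow (FC n))}
    (h : IsPath u p v) (hp : (p.map idx).Nodup) {e : Arrow (FC n)} (he : e ∈ p) :
    Ch.sgn e.src (idx e) = Ch.sgn u (idx e) := by
  induction p generalizing u with
  | nil => simp at he
  | cons f p ih =>
    rw [List.map_cons, List.nodup_cons] at hp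
    rcases List.mem_cons.1 he with rfl | he
    · rw [h.1]
    · have hne : idx e ≠ idx f := fun hke => hp.1 (hke ▸ List.mem_map_of_mem he)
      rw [ih h.2 hp.2 he, sgn_tgt_of_ne hn hne, h.1]

/-- The boundary of a spanning 2-cell consists of spanning 1-cells. -/
lemma isUp_of_isSpanningDisc (hn : 2 ≤ n) {F : Disc (FC n)} (hF : IsSpanningDisc F)
    {q : List (Arrow (FC n))} (hq : IsShortestPath F.src q F.tgt) {e : Arrow (FC n)}
    (he : e ∈ q) : IsUp e := by
  obtain ⟨h1, -, ⟨ε, δ, h2, h3⟩, h4⟩ := hF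
  have hx := Ch.hasCodim F.face
  have hu : Near (Ch.pt F.face) F.src := fun k hk =>
    Ch.subset_closure_iff.1 F.src_face k fun h => hk (sg_eq_zero.1 h)
  obtain ⟨hε, hδ⟩ := h3 (Ch.pt_mem F.face)
  rw [← hyp_inl] at hε hδ
  have hnone : ∀ i, ev (Sum.inr i) (Ch.pt F.face) ≠ 0 := by
    intro i hi
    have h5 : {m | ε m ≠ δ m} ⊆ {i} := by
      intro m hm
      by_contra hmi
      rcases (hx.hexagon hn hi hε (Sum.inl δ)).1 hδ with h | h | h
      · simp at h
      · exact hm (congrFun (Sum.inl_injective h) m).symm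
      · refine hm ?_
        rw [Sum.inl_injective h, flip_of_ne hmi]
    have h6 := ncard_le_ncard h5
    rw [ncard_singleton] at h6
    omega
  have hpos : IsPos F.src := (subset_orthant_iff hn).1 h1
  -- compare with the chamber on the side of the origin
  obtain ⟨u, hu1, hu2⟩ := exists_near hn (Ch.pt F.face) (-Ch.pt F.face) fun k hk => by
    rcases k with η | i
    · rw [map_neg, lin_inl_of_zero hk]; norm_num
    · exact absurd hk (hnone i)
  have hlow : ∀ k, ev k (Ch.pt F.face) = 0 → Ch.sgn F.src k = -1 := by
    intro k hk
    rcases k with η | i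
    swap
    · exact absurd hk (hnone i)
    by_contra hne
    have hη : Ch.sgn F.src (Sum.inl η) = 1 :=
      (signType_eq_one_or (sgn_ne_zero hn F.src (Sum.inl η))).resolve_right hne
    have hneg : ∀ η, ev (Sum.inl η) (Ch.pt F.face) = 0 → Ch.sgn u (Sum.inl η) = -1 := by
      intro η hη
      rw [hu2 _ hη, map_neg, lin_inl_of_zero hη]
      simp
    have hlt : {η : Mu n | Ch.sgn u (Sum.inl η) = 1} ⊂
        {η : Mu n | Ch.sgn F.src (Sum.inl η) = 1} := by
      refine (ssubset_iff_of_subset ?_).2 ⟨η, hη, ?_⟩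
      · intro θ hθ
        by_cases hθ0 : ev (Sum.inl θ) (Ch.pt F.face) = 0
        · have h7 : Ch.sgn u (Sum.inl θ) = 1 := hθ
          rw [hneg θ hθ0] at h7
          exact absurd h7 (by decide)
        · exact (hu _ hθ0).trans ((hu1 _ hθ0).symm.trans hθ)
      · change ¬ _ = _
        rw [hneg η hk]; decide
    have h8 := ncard_lt_ncard hlt
    have h9 := h4 u (by
      have : F.face.1 = (mkCh (Ch.pt F.face) hx).1 := Ch.val_eq F.face
      rw [this]
      exact (subset_closure_iff_near hx).2 hu1)
    rw [height_eq hn, height_eq hn] at h9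
    omega
  obtain ⟨hq1, hq2⟩ := idx_of_shortest hn hpos hq
  have hz := (hq2 _).1 (List.mem_map_of_mem he)
  rcases hi : idx e with η | i
  · refine ⟨η, hi, ?_⟩
    rw [← hi, sgn_src_of_mem_path hn hq.1 hq1 he, hlow _ hz]
  · rw [hi] at hz
    exact absurd hz (hnone i)

/-! ### Labels of arrows which depend on the signs of their source -/

section Val

variable {G : Type*} [Group G] (D : Mu n → G) (c : Fin n → G)

/-- The label of an arrow whose source has sign vector `s`: crossings of the hyperplanes `H ε` away
from the origin have trivial label; those towards the origin are moved to the positive orthant. -/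
def val (s : Idx n → SignType) : Idx n → G
  | Sum.inl ε => if s (Sum.inl ε) = -1 then 1 else D (ε * orth s)
  | Sum.inr i => c i

/-- The product of the labels along a path which crosses a list of hyperplanes. -/
def valProd : (Idx n → SignType) → List (Idx n) → G
  | _, [] => 1
  | s, j :: l => val D c s j * valProd (flipAt s j) l

lemma val_smul_idx (hn : 2 ≤ n) (g : Mu n) (u : Ch (FC n) 0) (j : Idx n) :
    val D c (Ch.sgn (g • u)) (actIdx g j) = val D c (Ch.sgn u) j := by
  rcases j with ε | i
  · change (if Ch.sgn (g • u) (Sum.inl (g * ε)) = -1 then 1 else D (g * ε * _)) = if _ then _ else _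
    rw [sgn_smul_inl, mu_mul_cancel, orth_smul hn, mul_mul_mul_comm, mu_mul_self, one_mul]
  · rfl

/-- The label of an arrow. -/
def label (e : Arrow (FC n)) : G := val D c (Ch.sgn e.src) (idx e)

lemma label_smul (hn : 2 ≤ n) (g : Mu n) (e : Arrow (FC n)) : label D c (g • e) = label D c e := by
  rw [label, idx_smul hn]
  exact val_smul_idx D c hn g e.src (idx e)

lemma label_of_isUp {e : Arrow (FC n)} (h : IsUp e) : label D c e = 1 := by
  obtain ⟨ε, h1, h2⟩ := h
  rw [label, h1]
  exact if_pos h2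

lemma prod_label_of_path (hn : 2 ≤ n) {u v : Ch (FC n) 0} {p : List (Arrow (FC n))}
    (h : IsPath u p v) : (p.map (label D c)).prod = valProd D c (Ch.sgn u) (p.map idx) := by
  induction p generalizing u with
  | nil => rfl
  | cons e p ih =>
    rw [List.map_cons, List.prod_cons, ih h.2, List.map_cons, valProd, sgn_tgt hn, ← h.1]
    rfl

end Val

end FCArrangement

/-! ### The relations of the 2-cells for labels -/

namespace FCArrangement

open Salvetti

variable {n : ℕ}

lemma eq_of_nodup_of_mem_iff_pair {α : Type*} {l : List α} {a b : α} (hl : l.Nodup)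
    (hab : a ≠ b) (h : ∀ k, k ∈ l ↔ k = a ∨ k = b) : l = [a, b] ∨ l = [b, a] := by
  have hp : l.Perm [a, b] := (List.perm_ext_iff_of_nodup hl (by simp [hab])).2 (by simpa using h)
  obtain ⟨x, y, rfl⟩ := List.length_eq_two.1 hp.length_eq
  have hx := (h x).1 (by simp)
  have hy := (h y).1 (by simp)
  have hxy : x ≠ y := by simpa using hl
  rcases hx with rfl | rfl <;> rcases hy with rfl | rfl <;> simp_all

lemma eq_of_nodup_of_mem_iff_triple {α : Type*} {l : List α} {a b c : α} (hl : l.Nodup)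
    (hab : a ≠ b) (hac : a ≠ c) (hbc : b ≠ c) (h : ∀ k, k ∈ l ↔ k = a ∨ k = b ∨ k = c) :
    (l = [a, b, c] ∨ l = [a, c, b]) ∨ (l = [b, a, c] ∨ l = [b, c, a]) ∨
      (l = [c, a, b] ∨ l = [c, b, a]) := by
  have hp : l.Perm [a, b, c] :=
    (List.perm_ext_iff_of_nodup hl (by simp [hab, hac, hbc])).2 (by simpa using h)
  obtain ⟨x, y, z, rfl⟩ := List.length_eq_three.1 hp.length_eq
  have hx := (h x).1 (by simp)
  have hy := (h y).1 (by simp)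
  have hz := (h z).1 (by simp)
  simp only [List.nodup_cons, List.mem_cons, List.not_mem_nil, or_false, not_or] at hl
  obtain ⟨⟨hxy, hxz⟩, hyz, -⟩ := hl
  rcases hx with rfl | rfl | rfl <;> rcases hy with rfl | rfl | rfl <;>
    rcases hz with rfl | rfl | rfl <;> simp_all

section Labels

variable {G : Type*} [Group G] (D : Mu n → G) (c : Fin n → G)

/-- The possible signs of the hyperplanes of `ε` and `flip i ε`, given the sign of the `i`-th
coordinate. -/
def HexSigns (i : Fin n) (ε : Mu n) (s : Idx n → SignType) : Prop :=
  (s (Sum.inr i) = 1 → s (Sum.inl (flip i ε)) = 1 → s (Sum.inl ε) = 1) ∧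
    (s (Sum.inr i) = -1 → s (Sum.inl ε) = 1 → s (Sum.inl (flip i ε)) = 1)

lemma hexSigns {i : Fin n} {ε : Mu n} (hε : ε i = 1) (u : Ch (FC n) 0) :
    HexSigns i ε (Ch.sgn u) := ⟨sgn_of_flip hε, sgn_flip_of hε⟩

/-- Crossing the `i`-th coordinate hyperplane and moving back to the positive orthant turns `H ε`
into `H (flip i ε)`. -/
lemma mul_orth_flipAt {s : Idx n → SignType} (hs : orth s = 1) {i : Fin n}
    (hi : s (Sum.inr i) = 1) (ε : Mu n) : ε * orth (flipAt s (Sum.inr i)) = flip i ε := by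
  funext m
  rw [Pi.mul_apply]
  by_cases hm : m = i
  · subst hm
    rw [flip_same]
    simp [orth, flipAt, hi]
  · rw [flip_of_ne hm]
    have h1 := congrFun hs m
    have h2 : orth (flipAt s (Sum.inr i)) m = orth s m := by
      simp [orth, flipAt, hm]
    rw [h2, h1]
    simp

lemma orth_flipAt_inl (s : Idx n → SignType) (ε : Mu n) :
    orth (flipAt s (Sum.inl ε)) = orth s := by
  funext m
  simp [orth, flipAt]

lemma flipAt_of_ne (s : Idx n → SignType) {j k : Idx n} (h : k ≠ j) : flipAt s j k = s k := by
  rw [flipAt, Function.update_of_ne h]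

lemma val_inl (s : Idx n → SignType) (ε : Mu n) :
    val D c s (Sum.inl ε) = if s (Sum.inl ε) = -1 then 1 else D (ε * orth s) := rfl

lemma val_inr (s : Idx n → SignType) (i : Fin n) : val D c s (Sum.inr i) = c i := rfl

/-- The relations on labels which come from the 2-cells: at faces in two coordinate hyperplanes, at
faces in two hyperplanes `H ε`, `H δ`, and, for `conj` and `braid`, at faces in a coordinate
hyperplane and the pair `H ε`, `H (flip i ε)`. -/
structure LabelRel : Prop where
  coord (i k : Fin n) : Commute (c i) (c k)
  square (ε δ : Mu n) : (H ε ∩ H δ ∩ {x | ∀ i, 0 < x i}).Nonempty → Commute (D ε) (D δ)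
  conj (i : Fin n) (ε : Mu n) : ε i = 1 → c i * D (flip i ε) = D ε * c i
  braid (i : Fin n) (ε : Mu n) : ε i = 1 → Commute (c i) (D (flip i ε) * D ε)

variable {D c}

/-- The product of the labels along a path which starts in the positive orthant and crosses each of
the three hyperplanes through a face once. Only two of the six orders of crossing are compatible
with `HexSigns`, and the product is the same for both. -/
lemma LabelRel.valProd_hexagon (h : LabelRel D c) {i : Fin n} {ε : Mu n} (hε : ε i = 1)
    {s : Idx n → SignType} (hs0 : orth s = 1) (hsi : s (Sum.inr i) = 1)
    (hs1 : s (Sum.inl ε) = 1 ∨ s (Sum.inl ε) = -1)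
    (hs2 : s (Sum.inl (flip i ε)) = 1 ∨ s (Sum.inl (flip i ε)) = -1) (hs : HexSigns i ε s)
    {l : List (Idx n)} (hl : l.Nodup)
    (hmem : ∀ k, k ∈ l ↔ k = Sum.inr i ∨ k = Sum.inl ε ∨ k = Sum.inl (flip i ε))
    (hpath : ∀ a b t, l = a :: b :: t → HexSigns i ε (flipAt s a) ∧
      HexSigns i ε (flipAt (flipAt s a) b)) :
    valProd D c s l = if s (Sum.inl ε) = -1 then c i else
      if s (Sum.inl (flip i ε)) = -1 then D ε * c i else D (flip i ε) * D ε * c i := by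
  have hne := flip_ne i ε
  have hne' : (Sum.inl ε : Idx n) ≠ Sum.inl (flip i ε) := fun h => hne (Sum.inl_injective h).symm
  have hff := flip_flip i ε
  have hb := (h.braid i ε hε).eq
  have hf := h.conj i ε hε
  rcases eq_of_nodup_of_mem_iff_triple hl (by simp) (by simp) hne' hmem with
    (rfl | rfl) | (rfl | rfl) | (rfl | rfl) <;>
  obtain ⟨⟨p1, p2⟩, p3, p4⟩ := hpath _ _ _ rfl <;>
  obtain ⟨p5, p6⟩ := hs <;>
  rcases hs1 with hs1 | hs1 <;> rcases hs2 with hs2 | hs2 <;>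
  simp [flipAt, hsi, hs1, hs2, hne, hne.symm] at p1 p2 p3 p4 p5 p6 <;>
  simp [valProd, val_inl, val_inr, flipAt_of_ne, orth_flipAt_inl, mul_orth_flipAt,
    hs0, hsi, hs1, hs2, hne, hne.symm, hff, hb, hf, mul_assoc]

/-- For a pair of hyperplanes whose labels commute, the two paths have the same product. -/
lemma LabelRel.valProd_square (h : LabelRel D c) {ε δ : Mu n} (hne : ε ≠ δ)
    (hcross : (H ε ∩ H δ ∩ {x | ∀ i, 0 < x i}).Nonempty) {s : Idx n → SignType}
    (hs : orth s = 1) :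
    valProd D c s [Sum.inl ε, Sum.inl δ] = valProd D c s [Sum.inl δ, Sum.inl ε] := by
  have hc := (h.square ε δ hcross).eq
  simp only [valProd, val_inl, flipAt_of_ne _ (show (Sum.inl ε : Idx n) ≠ Sum.inl δ by simpa),
    flipAt_of_ne _ (show (Sum.inl δ : Idx n) ≠ Sum.inl ε by simpa using hne.symm),
    orth_flipAt_inl, hs, mul_one]
  split_ifs <;> simp [hc]

lemma LabelRel.valProd_corner (h : LabelRel D c) (i k : Fin n) (s : Idx n → SignType) :
    valProd D c s [Sum.inr i, Sum.inr k] = valProd D c s [Sum.inr k, Sum.inr i] := by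
  simp [valProd, val_inr, (h.coord i k).eq]

/-- A path satisfies the constraints on the signs at each of its vertices. -/
lemma hexSigns_of_path (hn : 2 ≤ n) {i : Fin n} {ε : Mu n} (hε : ε i = 1) {u v : Ch (FC n) 0}
    {p : List (Arrow (FC n))} (hp : IsPath u p v) (a b : Idx n) (t : List (Idx n))
    (h : p.map idx = a :: b :: t) :
    HexSigns i ε (flipAt (Ch.sgn u) a) ∧ HexSigns i ε (flipAt (flipAt (Ch.sgn u) a) b) := by
  rcases p with _ | ⟨e, _ | ⟨f, p⟩⟩
  · simp at h
  · simp at h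
  · simp only [List.map_cons, List.cons.injEq] at h
    obtain ⟨rfl, h1, -⟩ := hp
    obtain ⟨rfl, rfl, -⟩ := h
    rw [← sgn_tgt hn, ← h1, ← sgn_tgt hn]
    exact ⟨hexSigns hε _, hexSigns hε _⟩

/-- The labels satisfy the relations of all 2-cells. -/
lemma LabelRel.prod_eq (hn : 2 ≤ n) (h : LabelRel D c) (F : Disc (FC n)) :
    (F.lower.map (label D c)).prod = (F.upper.map (label D c)).prod := by
  -- by symmetry, the 2-cell may be assumed to start in the positive orthant
  wlog hpos : IsPos F.src generalizing F
  · obtain ⟨g, hg⟩ := exists_smul_isPos hn F.src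
    have h1 := this (g • F) hg
    have h2 : ∀ q : List (Arrow (FC n)),
        ((q.map (g • ·)).map (label D c)) = q.map (label D c) := fun q => by
      rw [List.map_map]
      exact List.map_congr_left fun e _ => label_smul D c hn g e
    change ((F.lower.map (g • ·)).map _).prod = ((F.upper.map (g • ·)).map _).prod at h1
    rwa [h2, h2] at h1
  have hlow := idx_of_shortest hn hpos F.lower_shortest
  have hup := idx_of_shortest hn hpos F.upper_shortest
  have hs := orth_of_isPos hpos
  rw [prod_label_of_path D c hn F.lower_shortest.1, prod_label_of_path D c hn F.upper_shortest.1]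
  rcases (Ch.hasCodim F.face).faceType hn with
    ⟨ε, δ, p, -, -, hp, -, hz⟩ | ⟨i, ε, hε, hz⟩ | ⟨i, k, hik, hz⟩
  · have hne : ε ≠ δ := fun h => hp (by rw [h])
    have hne' : (Sum.inl ε : Idx n) ≠ Sum.inl δ := by simpa
    have hcross : (H ε ∩ H δ ∩ {x | ∀ i, 0 < x i}).Nonempty := by
      refine ⟨Ch.pt F.face, ⟨?_, ?_⟩, fun i => ?_⟩
      · rw [← hyp_inl]; exact (hz _).2 (Or.inl rfl)
      · rw [← hyp_inl]; exact (hz _).2 (Or.inr rfl)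
      · have h0 : Ch.sgn F.face (Sum.inr i) ≠ 0 := fun h => by
          have := (hz _).1 (sg_eq_zero.1 h)
          simp at this
        have h1 := Ch.subset_closure_iff.1 F.src_face _ h0
        rw [hpos i] at h1
        have h2 := sg_eq_one.1 h1.symm
        rwa [ev_inr] at h2
    have hsq := h.valProd_square hne hcross hs
    rcases eq_of_nodup_of_mem_iff_pair hlow.1 hne' fun k => (hlow.2 k).trans (hz k) with h1 | h1 <;>
      rcases eq_of_nodup_of_mem_iff_pair hup.1 hne' fun k => (hup.2 k).trans (hz k) with h2 | h2 <;>
      rw [h1, h2] <;> simp [hsq]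
  · have key := fun (q : List (Arrow (FC n))) (hq : IsShortestPath F.src q F.tgt) =>
      h.valProd_hexagon hε hs (hpos i) (signType_eq_one_or (sgn_ne_zero hn _ _))
        (signType_eq_one_or (sgn_ne_zero hn _ _)) (hexSigns hε F.src)
        (idx_of_shortest hn hpos hq).1
        (fun k => ((idx_of_shortest hn hpos hq).2 k).trans (hz k)) (hexSigns_of_path hn hε hq.1)
    rw [key _ F.lower_shortest, key _ F.upper_shortest]
  · have hne' : (Sum.inr i : Idx n) ≠ Sum.inr k := by simpa
    have hsq := h.valProd_corner i k (Ch.sgn F.src)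
    rcases eq_of_nodup_of_mem_iff_pair hlow.1 hne' fun k => (hlow.2 k).trans (hz k) with h1 | h1 <;>
      rcases eq_of_nodup_of_mem_iff_pair hup.1 hne' fun k => (hup.2 k).trans (hz k) with h2 | h2 <;>
      rw [h1, h2] <;> simp [hsq]

end Labels

end FCArrangement

/-! ### The relations between conjugates of one generator -/

namespace FCArrangement

open Salvetti

variable {n : ℕ} {G : Type*} [Group G]

/-- The value of the word `m_ε` in a group. -/
def wrd (c : Fin n → G) (ε : Mu n) : G :=
  (((List.finRange n).filter fun i => ε i = -1).map c).prod

/-- The conjugate of `a` by the value of the word `m_ε`. -/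
def conjWrd (a : G) (c : Fin n → G) (ε : Mu n) : G := (wrd c ε)⁻¹ * a * wrd c ε

lemma lift_word (γ : Fin (n + 1) → G) (ε : Mu n) :
    FreeGroup.lift γ (word ε) = wrd (fun i => γ i.succ) ε := by
  rw [word, wrd, map_list_prod, List.map_map]
  congr 2
  funext i
  simp

lemma wrd_one (c : Fin n → G) : wrd c 1 = 1 := by
  have : (List.finRange n).filter (fun i => (1 : Mu n) i = -1) = [] := by
    rw [List.filter_eq_nil_iff]
    intro i _
    rw [decide_eq_true_eq, Pi.one_apply]
    decide
  rw [wrd, this]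
  rfl

lemma commute_wrd {c : Fin n → G} (hc : ∀ i k, Commute (c i) (c k)) (i : Fin n) (ε : Mu n) :
    Commute (c i) (wrd c ε) := by
  refine Commute.list_prod_right _ _ fun a ha => ?_
  obtain ⟨k, -, rfl⟩ := List.mem_map.1 ha
  exact hc i k

lemma wrd_flip {c : Fin n → G} (hc : ∀ i k, Commute (c i) (c k)) {i : Fin n} {ε : Mu n}
    (hε : ε i = 1) : wrd c (flip i ε) = wrd c ε * c i := by
  have key : ∀ l : List (Fin n), l.Nodup →
      ((l.filter fun m => flip i ε m = -1).map c).prod =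
        if i ∈ l then ((l.filter fun m => ε m = -1).map c).prod * c i
        else ((l.filter fun m => ε m = -1).map c).prod := by
    intro l hl
    induction l with
    | nil => simp
    | cons m l ih =>
      rw [List.nodup_cons] at hl
      have ih := ih hl.2
      by_cases hm : m = i
      · subst hm
        rw [if_neg hl.1] at ih
        have hcomm : Commute (c m) ((l.filter fun k => ε k = -1).map c).prod :=
          Commute.list_prod_right _ _ fun a ha => by
            obtain ⟨k, -, rfl⟩ := List.mem_map.1 ha
            exact hc m k
        have h1 : flip m ε m = -1 := by rw [flip_same, hε]
        have h2 : ¬ ε m = -1 := by rw [hε]; decide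
        rw [List.filter_cons_of_pos (by simpa using h1), List.filter_cons_of_neg (by simpa using h2),
          if_pos (by simp), List.map_cons, List.prod_cons, ih, hcomm.eq]
      · have h1 : flip i ε m = ε m := flip_of_ne hm ε
        have h2 : (i ∈ m :: l) = (i ∈ l) := by simp [Ne.symm hm]
        simp only [List.filter_cons, h1, h2]
        split_ifs with h3 h4 h4
        · rw [List.map_cons, List.prod_cons, ih, if_pos h4, List.map_cons, List.prod_cons, mul_assoc]
        · rw [List.map_cons, List.prod_cons, ih, if_neg h4, List.map_cons, List.prod_cons]
        · rw [ih, if_pos h4]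
        · rw [ih, if_neg h4]
  have := key _ (List.nodup_finRange n)
  rwa [if_pos (List.mem_finRange i)] at this

lemma conjWrd_flip {c : Fin n → G} (hc : ∀ i k, Commute (c i) (c k)) (a : G) {i : Fin n}
    {ε : Mu n} (hε : ε i = 1) : conjWrd a c (flip i ε) = (c i)⁻¹ * conjWrd a c ε * c i := by
  rw [conjWrd, wrd_flip hc hε, conjWrd]
  group

/-- The braid relation of length four, as a commutation relation. -/
lemma commute_of_braid {a b : G} (h : (a * b) ^ 2 = (b * a) ^ 2) :
    Commute b (b⁻¹ * a * b * a) := by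
  rw [sq, sq] at h
  change b * (b⁻¹ * a * b * a) = b⁻¹ * a * b * a * b
  rw [eq_comm, show b⁻¹ * a * b * a * b = b⁻¹ * (a * b * (a * b)) by group, h]
  group

lemma braid_of_commute {a b : G} (h : Commute b (b⁻¹ * a * b * a)) :
    (a * b) ^ 2 = (b * a) ^ 2 := by
  have h1 : b * (b⁻¹ * a * b * a) = b⁻¹ * a * b * a * b := h
  rw [sq, sq, show a * b * (a * b) = b * (b⁻¹ * a * b * a * b) by group, ← h1]
  group

lemma lift_comm_eq_one {γ : Fin (n + 1) → G} {a b : FreeGroup (Fin (n + 1))} :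
    FreeGroup.lift γ (comm a b) = 1 ↔ Commute (FreeGroup.lift γ a) (FreeGroup.lift γ b) := by
  rw [comm, map_mul, map_mul, map_mul, map_inv, map_inv, commute_iff_eq, mul_inv_eq_one,
    mul_inv_eq_iff_eq_mul]

lemma lift_conj (γ : Fin (n + 1) → G) (ε : Mu n) :
    FreeGroup.lift γ ((word ε)⁻¹ * FreeGroup.of 0 * word ε) =
      conjWrd (γ 0) (fun i => γ i.succ) ε := by
  rw [map_mul, map_mul, map_inv, lift_word, FreeGroup.lift_apply_of, conjWrd]

/-- In a group in which the relators vanish, the conjugates of the generator with index zero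
satisfy the relations of the 2-cells. -/
lemma labelRel_of_rel {γ : Fin (n + 1) → G} (h : ∀ r, Rel n r → FreeGroup.lift γ r = 1) :
    LabelRel (conjWrd (γ 0) fun i => γ i.succ) fun i => γ i.succ := by
  have hc : ∀ i k : Fin n, Commute (γ i.succ) (γ k.succ) := fun i k => by
    simpa using lift_comm_eq_one.1 (h _ (Rel.comm i k))
  refine ⟨hc, fun ε δ hne => ?_, fun i ε hε => ?_, fun i ε hε => ?_⟩
  · have := lift_comm_eq_one.1 (h _ (Rel.conj ε δ hne))
    rwa [lift_conj, lift_conj] at this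
  · rw [conjWrd_flip hc _ hε]
    group
  · have h1 : (γ 0 * γ i.succ) ^ 2 = (γ i.succ * γ 0) ^ 2 := by
      have := h _ (Rel.braid i)
      rw [map_mul, map_inv, mul_inv_eq_one] at this
      simpa using this
    have h2 := commute_wrd hc i ε
    have h3 := (h2.inv_right.mul_right (commute_of_braid h1)).mul_right h2
    rw [conjWrd_flip hc _ hε, conjWrd]
    have h4 : (γ i.succ)⁻¹ * ((wrd (fun i => γ i.succ) ε)⁻¹ * γ 0 * wrd (fun i => γ i.succ) ε) *
        γ i.succ * ((wrd (fun i => γ i.succ) ε)⁻¹ * γ 0 * wrd (fun i => γ i.succ) ε) =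
        (wrd (fun i => γ i.succ) ε)⁻¹ * ((γ i.succ)⁻¹ * γ 0 * γ i.succ * γ 0) *
          wrd (fun i => γ i.succ) ε := by
      generalize wrd (fun i => γ i.succ) ε = w at h2
      have e1 : (γ i.succ)⁻¹ * w⁻¹ = w⁻¹ * (γ i.succ)⁻¹ := (h2.inv_inv).eq
      have e2 : w * γ i.succ * w⁻¹ = γ i.succ := by rw [← h2.eq]; group
      calc _ = (γ i.succ)⁻¹ * w⁻¹ * γ 0 * (w * γ i.succ * w⁻¹) * γ 0 * w := by group
        _ = _ := by rw [e1, e2]; group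
    rw [h4]
    exact h3

end FCArrangement

/-! ### Generic points and generic segments -/

namespace FCArrangement

open Salvetti

variable {n : ℕ}

/-- A direction in `K` on which a finite family of linear forms vanishes only where it has to. -/
lemma exists_generic_dir {ι : Type*} [Finite ι] (K : Submodule ℝ (Fin n → ℝ))
    (f : ι → (Fin n → ℝ) →ₗ[ℝ] ℝ) :
    ∃ w ∈ K, ∀ a, f a w = 0 → ∀ v ∈ K, f a v = 0 := by
  obtain ⟨w, hw, h⟩ := Module.Dual.exists_forall_mem_ne_zero_of_forall_exists K
    (fun a : {a : ι // ∃ v ∈ K, f a v ≠ 0} => f a.1) fun a => a.2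
  refine ⟨w, hw, fun a ha v hv => ?_⟩
  by_contra hne
  exact h ⟨a, v, hv, hne⟩ ha

/-- Moving `x₀` in a generic direction of `K` leaves only the hyperplanes through `x₀` which are
parallel to `K`. -/
lemma exists_generic_point (x₀ : Fin n → ℝ) (K : Submodule ℝ (Fin n → ℝ)) :
    ∃ x, (∀ l, ev l x₀ ≠ 0 → sg x l = sg x₀ l) ∧
      ∀ l, ev l x = 0 ↔ ev l x₀ = 0 ∧ ∀ v ∈ K, lin l v = 0 := by
  obtain ⟨w, hw, hw'⟩ := exists_generic_dir K (lin : Idx n → _)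
  obtain ⟨x, hx⟩ := exists_sg_add_smul x₀ w
  refine ⟨x, fun l hl => by rw [hx, if_neg hl], fun l => ?_⟩
  rw [← sg_eq_zero, hx]
  split_ifs with hl
  · rw [sign_eq_zero_iff]
    exact ⟨fun h => ⟨hl, hw' l h⟩, fun h => h.2 w hw⟩
  · rw [sg_eq_zero]
    exact ⟨fun h => absurd h hl, fun h => h.1⟩

/-- Two hyperplanes with a common point `x₀` share a face of codimension two whose closure
contains `x₀`. -/
lemma exists_face_point (hn : 2 ≤ n) {x₀ : Fin n → ℝ} {j k : Idx n} (hjk : j ≠ k)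
    (hj : ev j x₀ = 0) (hk : ev k x₀ = 0) :
    ∃ x, (∀ l, ev l x₀ ≠ 0 → sg x l = sg x₀ l) ∧ HasCodim 2 x ∧ ev j x = 0 ∧ ev k x = 0 := by
  obtain ⟨x, h1, h2⟩ := exists_generic_point x₀ (LinearMap.ker (lin j) ⊓ LinearMap.ker (lin k))
  have hj' := (h2 j).2 ⟨hj, fun v hv => hv.1⟩
  have hk' := (h2 k).2 ⟨hk, fun v hv => hv.2⟩
  exact ⟨x, h1, hasCodim_two_of_dirs hn hjk hj' hk' fun l hl v h3 h4 =>
    ((h2 l).1 hl).2 v ⟨h3, h4⟩, hj', hk'⟩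

/-- The affine function on `[0, 1]` with values `a` and `b` at the ends has the sign of `a` until
it vanishes. -/
lemma sign_combo_of_lt {a b t : ℝ} (ha : a ≠ 0) (hab : SignType.sign b = -SignType.sign a)
    (h : t < a / (a - b)) : SignType.sign ((1 - t) * a + t * b) = SignType.sign a := by
  have h2 : (1 - t) * a + t * b = a - t * (a - b) := by ring
  rcases lt_or_gt_of_ne ha with h1 | h1
  · rw [sign_neg h1, neg_neg, sign_eq_one_iff] at hab
    rw [lt_div_iff_of_neg (by linarith)] at h
    rw [sign_neg h1, sign_eq_neg_one_iff, h2]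
    linarith
  · rw [sign_pos h1, sign_eq_neg_one_iff] at hab
    rw [lt_div_iff₀ (by linarith)] at h
    rw [sign_pos h1, sign_eq_one_iff, h2]
    linarith

/-- Between two regions of a hyperplane there is a face of codimension one in it, in the closure
of the first region, such that the region `z` on the other side of it is closer to the second
one. It is the first face met by a generic segment. -/
lemma exists_adjacent (hn : 2 ≤ n) {j : Idx n} {y y' : Fin n → ℝ} (hy : ∀ k, ev k y = 0 ↔ k = j)
    (hy' : ∀ k, ev k y' = 0 ↔ k = j) (hne : sg y ≠ sg y') :
    ∃ x z, HasCodim 2 x ∧ ev j x = 0 ∧ (∀ l, ev l x ≠ 0 → sg y l = sg x l) ∧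
      (∀ l, ev l x = 0 → sg y' l = -sg y l) ∧ (∃ l, l ≠ j ∧ ev l x = 0) ∧
      (∀ l, ev l x ≠ 0 → sg z l = sg x l) ∧ ∀ l, ev l x = 0 → sg z l = -sg y l := by
  have hyj := (hy j).2 rfl
  have hyj' := (hy' j).2 rfl
  -- the forms which compare the times at which two hyperplanes are met; moving `y` in a direction
  -- on which they do not vanish ensures that hyperplanes met at the same time share a face
  obtain ⟨w, hw, hw'⟩ := exists_generic_dir (LinearMap.ker (lin j))
    fun a : Idx n × Idx n => ev a.2 y' • lin a.1 - ev a.1 y' • lin a.2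
  obtain ⟨y₁, hy₁, hgen⟩ : ∃ y₁, sg y₁ = sg y ∧ ∀ k l,
      ev l y' * ev k y₁ = ev k y' * ev l y₁ →
        ∀ v, lin j v = 0 → ev l y' * lin k v = ev k y' * lin l v := by
    have hev : ∀ᶠ t in 𝓝[>] (0 : ℝ), ∀ a : Idx n × Idx n,
        ev a.2 y' * ev a.1 (y + t • w) = ev a.1 y' * ev a.2 (y + t • w) →
        ev a.2 y' * lin a.1 w = ev a.1 y' * lin a.2 w := by
      rw [Filter.eventually_all]
      rintro ⟨k, l⟩
      simp only [ev_add_smul]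
      by_cases h0 : ev l y' * ev k y = ev k y' * ev l y
      · filter_upwards [self_mem_nhdsWithin] with t ht h
        have ht' : t ≠ 0 := ne_of_gt ht
        refine mul_left_cancel₀ ht' ?_
        linear_combination h - h0
      · have hc : Continuous fun t : ℝ => ev l y' * (ev k y + t * lin k w) -
            ev k y' * (ev l y + t * lin l w) := by fun_prop
        have := hc.continuousAt.eventually_ne (x := 0) (y := 0) (by simpa [sub_eq_zero] using h0)
        refine Filter.Eventually.filter_mono nhdsWithin_le_nhds ?_
        filter_upwards [this] with t ht h
        exact absurd (sub_eq_zero.2 h) ht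
    obtain ⟨t, h1, h2⟩ := ((sg_add_smul_eventually y w).and hev).exists
    refine ⟨y + t • w, ?_, fun k l h v hv => ?_⟩
    · funext l
      rw [h1]
      split_ifs with hl
      · rw [(hy l).1 hl, show lin j w = 0 from hw, sign_zero, eq_comm, sg_eq_zero, hyj]
      · rfl
    · have h3 := hw' (k, l) (by
        change ev l y' * lin k w - ev k y' * lin l w = 0
        rw [h2 (k, l) h, sub_self]) v hv
      exact sub_eq_zero.1 h3
  have hsg : ∀ l, SignType.sign (ev l y₁) = sg y l := congrFun hy₁
  -- the hyperplanes which separate the two regions, and the first of them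
  let T : Finset (Idx n) := Finset.univ.filter fun l => sg y l ≠ sg y' l
  have hT : ∀ l, l ∈ T ↔ sg y l ≠ sg y' l := fun l => by simp [T]
  let τ : Idx n → ℝ := fun l => ev l y₁ / (ev l y₁ - ev l y')
  obtain ⟨l₀, hl₀, hmin⟩ := T.exists_min_image τ (by
    obtain ⟨l, hl⟩ := Function.ne_iff.1 hne
    exact ⟨l, (hT l).2 hl⟩)
  have hTj : ∀ l ∈ T, l ≠ j := by
    rintro l hl rfl
    refine (hT l).1 hl ?_
    rw [sg_eq_zero.2 hyj, sg_eq_zero.2 hyj']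
  have hT0 : ∀ l ∈ T, ev l y₁ ≠ 0 ∧ ev l y' ≠ 0 ∧
      SignType.sign (ev l y') = -SignType.sign (ev l y₁) := by
    intro l hl
    have h1 : sg y l ≠ 0 := fun h => hTj l hl ((hy l).1 (sg_eq_zero.1 h))
    have h2 : sg y' l ≠ 0 := fun h => hTj l hl ((hy' l).1 (sg_eq_zero.1 h))
    refine ⟨fun h => h1 ?_, fun h => h2 (sg_eq_zero.2 h), ?_⟩
    · rw [← hsg, h, sign_zero]
    · rw [hsg]
      exact signType_eq_neg h2 h1 (Ne.symm ((hT l).1 hl))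
  have hden : ∀ l ∈ T, ev l y₁ - ev l y' ≠ 0 := fun l hl h => by
    obtain ⟨h1, -, h2⟩ := hT0 l hl
    rw [← sub_eq_zero.1 h] at h2
    exact signType_neg_ne (by simpa using h1) h2.symm
  have hτ : ∀ l ∈ T, 0 < τ l ∧ τ l < 1 := fun l hl => by
    obtain ⟨h1, -, h2⟩ := hT0 l hl
    rcases lt_or_gt_of_ne h1 with h3 | h3
    · rw [sign_neg h3, neg_neg, sign_eq_one_iff] at h2
      exact ⟨div_pos_of_neg_of_neg h3 (by linarith), by
        rw [div_lt_one_of_neg (by linarith)]; linarith⟩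
    · rw [sign_pos h3, sign_eq_neg_one_iff] at h2
      exact ⟨div_pos h3 (by linarith), by rw [div_lt_one (by linarith)]; linarith⟩
  set t := τ l₀ with ht
  obtain ⟨ht0, ht1⟩ := hτ l₀ hl₀
  let x := (1 - t) • y₁ + t • y'
  have hxe : ∀ l, ev l x = (1 - t) * ev l y₁ + t * ev l y' := fun l => ev_combo l y₁ y' t
  have hxT : ∀ l, l ∉ T → sg x l = sg y l := fun l hl => by
    have h1 : sg y l = sg y' l := by
      by_contra h
      exact hl ((hT l).2 h)
    change SignType.sign (ev l x) = _
    rw [hxe, sign_combo ((hsg l).trans h1) ht0.le ht1.le, hsg]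
  have hxlt : ∀ l ∈ T, t < τ l → sg x l = sg y l := fun l hl h => by
    obtain ⟨h1, -, h2⟩ := hT0 l hl
    change SignType.sign (ev l x) = _
    rw [hxe, sign_combo_of_lt h1 h2 h, hsg]
  have hxeq : ∀ l ∈ T, τ l = t → ev l x = 0 := fun l hl h => by
    rw [hxe, ← h]
    have := hden l hl
    simp only [τ]
    field_simp
    ring
  have hxj : ev j x = 0 := by
    have h1 : ev j y₁ = 0 := by
      rw [← sign_eq_zero_iff, hsg, sg_eq_zero, hyj]
    rw [hxe, h1, hyj']; ring
  have hxl₀ := hxeq l₀ hl₀ rfl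
  have hzero : ∀ l, l ≠ j → ev l x = 0 → l ∈ T ∧ τ l = t := by
    intro l hlj hl
    have hlT : l ∈ T := by
      by_contra h
      have h1 := hxT l h
      rw [sg_eq_zero.2 hl, eq_comm, sg_eq_zero, hy] at h1
      exact hlj h1
    refine ⟨hlT, (lt_or_eq_of_le (hmin l hlT)).elim (fun h => ?_) Eq.symm⟩
    have h1 := hxlt l hlT h
    rw [sg_eq_zero.2 hl, eq_comm, sg_eq_zero, hy] at h1
    exact absurd h1 hlj
  have hcodim : HasCodim 2 x := by
    refine hasCodim_two_of_dirs hn (hTj l₀ hl₀).symm hxj hxl₀ fun l hl v hv1 hv2 => ?_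
    by_cases hlj : l = j
    · rw [hlj, hv1]
    obtain ⟨hlT, hlt⟩ := hzero l hlj hl
    have h1 : ev l₀ y' * ev l y₁ = ev l y' * ev l₀ y₁ := by
      have h2 : ev l y₁ / (ev l y₁ - ev l y') = ev l₀ y₁ / (ev l₀ y₁ - ev l₀ y') := hlt
      rw [div_eq_div_iff (hden l hlT) (hden l₀ hl₀)] at h2
      linarith
    have h3 := hgen l l₀ h1 v hv1
    rw [hv2, mul_zero] at h3
    exact (mul_eq_zero.1 h3).resolve_left (hT0 l₀ hl₀).2.1
  have hopp : ∀ l, ev l x = 0 → sg y' l = -sg y l := fun l hl => by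
    by_cases hlj : l = j
    · rw [hlj, sg_eq_zero.2 hyj, sg_eq_zero.2 hyj', neg_zero]
    · rw [← hsg]
      exact (hT0 l (hzero l hlj hl).1).2.2
  obtain ⟨z, hz⟩ := exists_sg_add_smul x (y' - x)
  refine ⟨x, z, hcodim, hxj, fun l hl => ?_, hopp, ⟨l₀, hTj l₀ hl₀, hxl₀⟩,
    fun l hl => by rw [hz, if_neg hl], fun l hl => ?_⟩
  · by_cases hlT : l ∈ T
    · rcases lt_or_eq_of_le (hmin l hlT) with h | h
      · exact (hxlt l hlT h).symm
      · exact absurd (hxeq l hlT h.symm) hl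
    · exact (hxT l hlT).symm
  · rw [hz, if_pos hl, ← hopp l hl]
    change _ = SignType.sign (ev l y')
    congr 1
    rw [map_sub]
    have h1 : lin l x - cst l = 0 := hl
    simp only [ev]
    linarith

/-- A function on the generic points of a hyperplane is constant on the region where the signs of
some other hyperplanes are positive, if it depends only on the signs and does not change when one
passes through a face of codimension two of the arrangement. -/
lemma eq_of_step (hn : 2 ≤ n) {α : Type*} {j : Idx n} {f : (Fin n → ℝ) → α} {S : Set (Idx n)}
    (hcell : ∀ y z, sg y = sg z → f y = f z)
    (hstep : ∀ x y z, HasCodim 2 x → ev j x = 0 → (∀ l ∈ S, sg x l = 1) →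
      (∀ k, ev k y = 0 ↔ k = j) → (∀ k, ev k z = 0 ↔ k = j) →
      (∀ l, ev l x ≠ 0 → sg y l = sg x l) → (∀ l, ev l x ≠ 0 → sg z l = sg x l) →
      (∀ l, ev l x = 0 → sg z l = -sg y l) → f y = f z) {y y' : Fin n → ℝ}
    (hy : ∀ k, ev k y = 0 ↔ k = j) (hy' : ∀ k, ev k y' = 0 ↔ k = j)
    (hS : ∀ l ∈ S, sg y l = 1) (hS' : ∀ l ∈ S, sg y' l = 1) : f y = f y' := by
  induction hm : {l | sg y l ≠ sg y' l}.ncard using Nat.strong_induction_on generalizing y with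
  | _ m ih =>
  by_cases hne : sg y = sg y'
  · exact hcell _ _ hne
  obtain ⟨x, z, hx, hxj, h1, h2, ⟨l₀, h3, h4⟩, h5, h6⟩ := exists_adjacent hn hy hy' hne
  have hz : ∀ k, ev k z = 0 ↔ k = j := by
    intro k
    by_cases hk : ev k x = 0
    · rw [← hy k, ← sg_eq_zero, h6 k hk, ← sg_eq_zero]
      exact signType_neg_eq_zero
    · rw [← sg_eq_zero, h5 k hk, sg_eq_zero]
      exact ⟨fun h => absurd h hk, fun h => by rw [h, hxj]⟩
  have hne0 : ∀ l, ev l x = 0 → sg y l = 1 → sg y' l ≠ 1 := fun l hl h h' => by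
    have := h2 l hl
    rw [h, h'] at this
    exact absurd this (by decide)
  have hxS : ∀ l ∈ S, ev l x ≠ 0 := fun l hl h => hne0 l h (hS l hl) (hS' l hl)
  have hxS' : ∀ l ∈ S, sg x l = 1 := fun l hl => by rw [← h1 l (hxS l hl), hS l hl]
  refine (hstep x y z hx hxj hxS' hy hz h1 h5 h6).trans ?_
  refine ih _ ?_ hz (fun l hl => by rw [h5 l (hxS l hl), hxS' l hl]) rfl
  rw [← hm]
  refine ncard_lt_ncard ((ssubset_iff_of_subset ?_).2 ⟨l₀, ?_, ?_⟩)
  · intro l hl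
    by_cases hlx : ev l x = 0
    · refine absurd ?_ hl
      rw [h6 l hlx, h2 l hlx]
    · change sg y l ≠ _
      rw [h1 l hlx, ← h5 l hlx]
      exact hl
  · change sg y l₀ ≠ _
    rw [h2 l₀ h4]
    refine (signType_neg_ne fun h => h3 ?_).symm
    exact (hy l₀).1 (sg_eq_zero.1 h)
  · change ¬ (sg z l₀ ≠ _)
    rw [h6 l₀ h4, h2 l₀ h4, not_not]

end FCArrangement

/-! ### Labellings of the arrows which are compatible with the cells -/

namespace FCArrangement

open Salvetti

variable {n : ℕ}

/-- A labelling of the arrows by elements of a group which is invariant, trivial on the spanning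
arrows and compatible with the 2-cells. -/
structure Labelling {Q : Type*} [Group Q] (ℓ : Arrow (FC n) → Q) : Prop where
  smul (g : Mu n) (e : Arrow (FC n)) : ℓ (g • e) = ℓ e
  up (e : Arrow (FC n)) : IsUp e → ℓ e = 1
  disc (F : Disc (FC n)) : (F.lower.map ℓ).prod = (F.upper.map ℓ).prod

/-- At a generic point `y` of the `j`-th hyperplane, the label of the arrow from the positive to the
negative side. -/
def wallLabel {Q : Type*} [Group Q] (ℓ : Arrow (FC n) → Q) (j : Idx n) (y : Fin n → ℝ) : Q :=
  open Classical in
  if h : ∃ e, idx e = j ∧ Ch.sgn e.src j = 1 ∧ ∀ k, k ≠ j → Ch.sgn e.src k = sg y k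
    then ℓ h.choose else 1

lemma wallLabel_eq (hn : 2 ≤ n) {Q : Type*} [Group Q] (ℓ : Arrow (FC n) → Q) {j : Idx n}
    {y : Fin n → ℝ} {e : Arrow (FC n)} (h1 : idx e = j) (h2 : Ch.sgn e.src j = 1)
    (h3 : ∀ k, k ≠ j → Ch.sgn e.src k = sg y k) : wallLabel ℓ j y = ℓ e := by
  have h : ∃ e, idx e = j ∧ Ch.sgn e.src j = 1 ∧ ∀ k, k ≠ j → Ch.sgn e.src k = sg y k :=
    ⟨e, h1, h2, h3⟩
  rw [wallLabel, dif_pos h]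
  obtain ⟨h4, h5, h6⟩ := h.choose_spec
  congr 1
  refine arrow_ext hn (Ch.ext_sgn (funext fun k => ?_)) (h4.trans h1.symm)
  by_cases hk : k = j
  · rw [hk, h5, h2]
  · rw [h6 k hk, h3 k hk]

lemma wallLabel_congr {Q : Type*} [Group Q] (ℓ : Arrow (FC n) → Q) (j : Idx n) {y z : Fin n → ℝ}
    (h : sg y = sg z) : wallLabel ℓ j y = wallLabel ℓ j z := by
  rw [wallLabel, wallLabel, h]

/-- The arrow which defines `wallLabel` exists, so that the junk value `1` is not attained at
generic points. -/
lemma exists_down (hn : 2 ≤ n) {j : Idx n} {y : Fin n → ℝ} (hy : ∀ k, ev k y = 0 ↔ k = j) :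
    ∃ e : Arrow (FC n), idx e = j ∧ Ch.sgn e.src j = 1 ∧ ∀ k, k ≠ j → Ch.sgn e.src k = sg y k := by
  obtain ⟨v, hv⟩ : ∃ v, 0 < lin j v := by
    obtain ⟨w, hw⟩ : ∃ w, lin j w ≠ 0 := by
      by_contra! h
      exact lin_ne_zero hn j (LinearMap.ext h)
    rcases lt_or_gt_of_ne hw with h | h
    · exact ⟨-w, by rw [map_neg]; linarith⟩
    · exact ⟨w, h⟩
  obtain ⟨u, hu1, hu2⟩ := exists_near hn y v fun k hk => by rw [(hy k).1 hk]; exact hv.ne'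
  have hu1' : ∀ k, k ≠ j → Ch.sgn u k = sg y k := fun k hk => hu1 k fun h => hk ((hy k).1 h)
  obtain ⟨e, rfl, he, -⟩ := exists_arrow hn hy u hu1'
  exact ⟨e, he, by rw [hu2 j ((hy j).2 rfl), sign_pos hv], hu1'⟩

section

variable {Q : Type*} [Group Q] {ℓ : Arrow (FC n) → Q}

/-- Passing through another hyperplane `H δ` does not change the label of a wall in `H ε`. -/
lemma Labelling.wallLabel_step_inl (hn : 2 ≤ n) (hℓ : Labelling ℓ) {ε : Mu n} {x y z : Fin n → ℝ}
    (hx : HasCodim 2 x) (hxε : ev (Sum.inl ε) x = 0) (hpos : ∀ i, ev (Sum.inr i) x ≠ 0)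
    (hy : ∀ k, ev k y = 0 ↔ k = Sum.inl ε) (hz : ∀ k, ev k z = 0 ↔ k = Sum.inl ε)
    (hyx : ∀ l, ev l x ≠ 0 → sg y l = sg x l) (hzx : ∀ l, ev l x ≠ 0 → sg z l = sg x l)
    (hyz : ∀ l, ev l x = 0 → sg z l = -sg y l) :
    wallLabel ℓ (Sum.inl ε) y = wallLabel ℓ (Sum.inl ε) z := by
  obtain ⟨δ, hδ, hδε⟩ : ∃ δ, ev (Sum.inl δ) x = 0 ∧ ε ≠ δ := by
    obtain ⟨j, k, hjk, hj, hk⟩ := hx.exists_pair hn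
    have h : ∀ j, ev j x = 0 → j ≠ Sum.inl ε → ∃ δ, ev (Sum.inl δ) x = 0 ∧ ε ≠ δ := by
      rintro (δ | i) hj hne
      · exact ⟨δ, hj, fun h => hne (by rw [h])⟩
      · exact absurd hj (hpos i)
    by_cases h1 : j = Sum.inl ε
    · exact h k hk fun h => hjk (h1.trans h.symm)
    · exact h j hj h1
  have hne : (Sum.inl ε : Idx n) ≠ Sum.inl δ := by simpa
  have hx0 := hx.square hn hδε hxε hδ hpos
  have hyδ : sg y (Sum.inl δ) ≠ 0 := fun h => hne ((hy _).1 (sg_eq_zero.1 h)).symm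
  have hyz' := hyz _ hδ
  -- by symmetry, `y` is on the side of the origin
  wlog hneg : sg y (Sum.inl δ) = -1 generalizing y z
  · refine (this hz hy hzx hyx (fun l hl => by rw [hyz l hl, neg_neg]) ?_ ?_ ?_).symm
    · rw [hyz']
      exact fun h => hyδ (signType_neg_eq_zero.1 h)
    · rw [hyz', neg_neg]
    · rw [hyz', (signType_eq_one_or hyδ).resolve_right hneg]
  rw [hneg, neg_neg] at hyz'
  obtain ⟨e, he1, he2, he3⟩ := exists_down hn hy
  have heδ : Ch.sgn e.src (Sum.inl δ) = -1 := (he3 _ hne.symm).trans hneg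
  have hnear : Near x e.src := fun k hk => by
    rw [he3 k fun h => hk (h ▸ hxε), hyx k hk]
  obtain ⟨g', hg1', hg2'⟩ := exists_cross_pair hn hne.symm (fun l => by rw [hx0, or_comm])
    (hnear.tgt hn (by rwa [he1]))
  obtain ⟨g, hg1, hg2⟩ := exists_cross_pair hn hne.symm (fun l => by rw [hx0, or_comm]) hnear
  obtain ⟨e', he1', he2'⟩ := exists_cross_pair hn hne hx0
    (Near.tgt hn (by rwa [hg1]) (by rwa [hg2]) : Near x g.tgt)
  have h1 := prod_eq_of_around hn hℓ.disc hx hnear (p := [e, g']) (q := [g, e'])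
    ⟨rfl, hg1', rfl⟩ ⟨hg1, he1', rfl⟩ (by simp [he1, hg2', hδε]) (by simp [he2', hg2, hδε.symm])
    (fun k => by rw [hx0]; simp [he1, hg2']) (fun k => by rw [hx0, or_comm]; simp [he2', hg2])
  have hup : ℓ g = 1 := hℓ.up g ⟨δ, hg2, by rw [hg1, heδ]⟩
  have hup' : ℓ g' = 1 := hℓ.up g' ⟨δ, hg2', by
    rw [hg1', sgn_tgt_of_ne hn (by rw [he1]; exact hne.symm), heδ]⟩
  have hes : Ch.sgn e'.src = flipAt (Ch.sgn e.src) (Sum.inl δ) := by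
    rw [he1', sgn_tgt hn, hg1, hg2]
  rw [wallLabel_eq hn ℓ he1 he2 he3, wallLabel_eq hn ℓ (e := e') he2' ?_ ?_]
  · simpa [hup, hup'] using h1
  · rw [hes, flipAt_of_ne _ hne, he2]
  · intro k hk
    rw [hes]
    by_cases hkδ : k = Sum.inl δ
    · rw [hkδ, flipAt, Function.update_self, heδ, hyz', neg_neg]
    · have hkx : ev k x ≠ 0 := fun h => ((hx0 k).1 h).elim hk hkδ
      rw [flipAt_of_ne _ hkδ, he3 k hk, hyx k hkx, hzx k hkx]

/-- A face in exactly one coordinate hyperplane is in exactly two of the hyperplanes `H ε`. -/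
lemma exists_isHexagon (hn : 2 ≤ n) {x : Fin n → ℝ} (hx : HasCodim 2 x) {i : Fin n}
    (hi : ev (Sum.inr i) x = 0) (hpos : ∀ k, k ≠ i → ev (Sum.inr k) x ≠ 0) :
    ∃ ε, IsHexagon x i ε := by
  obtain ⟨ε, hε⟩ : ∃ ε, ev (Sum.inl ε) x = 0 := by
    obtain ⟨j, k, hjk, hj, hk⟩ := hx.exists_pair hn
    have h : ∀ j, ev j x = 0 → j ≠ Sum.inr i → ∃ ε, ev (Sum.inl ε) x = 0 := by
      rintro (ε | k) hj hne
      · exact ⟨ε, hj⟩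
      · exact absurd hj (hpos k fun h => hne (by rw [h]))
    by_cases h1 : j = Sum.inr i
    · exact h k hk fun h => hjk (h1.trans h.symm)
    · exact h j hj h1
  have h := hx.hexagon hn hi hε
  rcases Int.units_eq_one_or (ε i) with h1 | h1
  · exact ⟨ε, h1, h⟩
  · exact ⟨flip i ε, by rw [flip_same, h1]; rfl,
      hx.hexagon hn hi ((h _).2 (Or.inr (Or.inr rfl)))⟩

/-- Passing through a pair of hyperplanes `H ε`, `H (flip i ε)` does not change the label of a wall
in the `i`-th coordinate hyperplane. -/
lemma Labelling.wallLabel_step_inr (hn : 2 ≤ n) (hℓ : Labelling ℓ) {i : Fin n}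
    {x y z : Fin n → ℝ} (hx : HasCodim 2 x) (hxi : ev (Sum.inr i) x = 0)
    (hpos : ∀ k, k ≠ i → ev (Sum.inr k) x ≠ 0)
    (hy : ∀ k, ev k y = 0 ↔ k = Sum.inr i) (hz : ∀ k, ev k z = 0 ↔ k = Sum.inr i)
    (hyx : ∀ l, ev l x ≠ 0 → sg y l = sg x l) (hzx : ∀ l, ev l x ≠ 0 → sg z l = sg x l)
    (hyz : ∀ l, ev l x = 0 → sg z l = -sg y l) :
    wallLabel ℓ (Sum.inr i) y = wallLabel ℓ (Sum.inr i) z := by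
  obtain ⟨ε, hε, hx0⟩ := exists_isHexagon hn hx hxi hpos
  have hh : IsHexagon x i ε := ⟨hε, hx0⟩
  have hxε := (hx0 _).2 (Or.inr (Or.inl rfl))
  have hxδ := (hx0 _).2 (Or.inr (Or.inr rfl))
  have hsame : ∀ y, ev (Sum.inr i) y = 0 → sg y (Sum.inl (flip i ε)) = sg y (Sum.inl ε) := by
    intro y hy
    rw [ev_inr] at hy
    change SignType.sign _ = SignType.sign _
    rw [ev_flip, hy, mul_zero, mul_zero, sub_zero]
  have hyε : sg y (Sum.inl ε) ≠ 0 := fun h => by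
    have := (hy _).1 (sg_eq_zero.1 h)
    simp at this
  have hyz' := hyz _ hxε
  have hysame := hsame y ((hy _).2 rfl)
  wlog hneg : sg y (Sum.inl ε) = -1 generalizing y z
  · refine (this hz hy hzx hyx (fun l hl => by rw [hyz l hl, neg_neg]) ?_ ?_ ?_ ?_).symm
    · rw [hyz']
      exact fun h => hyε (signType_neg_eq_zero.1 h)
    · rw [hyz', neg_neg]
    · exact hsame z ((hz _).2 rfl)
    · rw [hyz', (signType_eq_one_or hyε).resolve_right hneg]
  rw [hneg] at hysame
  have hne := flip_ne i ε
  have hne' : (Sum.inl ε : Idx n) ≠ Sum.inl (flip i ε) := fun h => hne (Sum.inl_injective h).symm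
  obtain ⟨e, he1, he2, he3⟩ := exists_down hn hy
  have heε : Ch.sgn e.src (Sum.inl ε) = -1 := (he3 _ (by simp)).trans hneg
  have heδ : Ch.sgn e.src (Sum.inl (flip i ε)) = -1 := (he3 _ (by simp)).trans hysame
  have hnear : Near x e.src := fun k hk => by
    rw [he3 k fun h => hk (h ▸ hxi), hyx k hk]
  have hs1 := sgn_tgt hn e
  rw [he1] at hs1
  -- the path which starts with the crossing at `y`
  have hn1 := hnear.tgt hn (by rwa [he1])
  obtain ⟨f, hf1, hf2⟩ := hh.cross_flip hn hn1 (by rw [hs1]; simp [flipAt, heε, he2])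
  have hs2 := sgn_tgt hn f
  rw [hf1, hf2, hs1] at hs2
  obtain ⟨g, hg1, hg2⟩ := hh.cross_self hn (Near.tgt hn (by rwa [hf1]) (by rwa [hf2]))
    (by rw [hs2]; simp [flipAt, heδ, he2])
  -- the path which ends with the crossing at `z`
  obtain ⟨f', hf1', hf2'⟩ := hh.cross_self hn hnear (by rw [heδ, he2])
  have hn1' : Near x f'.tgt := Near.tgt hn (by rwa [hf1']) (by rwa [hf2'])
  have hs1' := sgn_tgt hn f'
  rw [hf1', hf2'] at hs1'
  obtain ⟨g', hg1', hg2'⟩ := hh.cross_flip hn hn1' (by rw [hs1']; simp [flipAt, heε, he2])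
  have hs2' := sgn_tgt hn g'
  rw [hg1', hg2', hs1'] at hs2'
  obtain ⟨e', he1', he2'⟩ := hh.cross_coord hn (Near.tgt hn (by rwa [hg1']) (by rwa [hg2']))
    (by rw [hs2']; simp [flipAt, heδ, heε, hne, hne.symm])
  have h1 := prod_eq_of_around hn hℓ.disc hx hnear (p := [e, f, g]) (q := [f', g', e'])
    ⟨rfl, hf1, hg1, rfl⟩ ⟨hf1', hg1', he1', rfl⟩ (by simp [he1, hf2, hg2, hne])
    (by simp [he2', hf2', hg2', hne.symm])
    (fun k => by rw [hx0]; simp [he1, hf2, hg2]; tauto)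
    (fun k => by rw [hx0]; simp [he2', hf2', hg2']; tauto)
  have hf : ℓ f = 1 := hℓ.up f ⟨_, hf2, by rw [hf1, hs1]; simp [flipAt, heδ]⟩
  have hg : ℓ g = 1 := hℓ.up g ⟨_, hg2, by rw [hg1, hs2]; simp [flipAt, heε, hne.symm]⟩
  have hf' : ℓ f' = 1 := hℓ.up f' ⟨_, hf2', by rw [hf1', heε]⟩
  have hg' : ℓ g' = 1 := hℓ.up g' ⟨_, hg2', by rw [hg1', hs1']; simp [flipAt, heδ, hne]⟩
  have hes : Ch.sgn e'.src =
      flipAt (flipAt (Ch.sgn e.src) (Sum.inl ε)) (Sum.inl (flip i ε)) := by rw [he1', hs2']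
  rw [wallLabel_eq hn ℓ he1 he2 he3, wallLabel_eq hn ℓ (e := e') he2' ?_ ?_]
  · simpa [hf, hg, hf', hg'] using h1
  · rw [hes]
    simp [flipAt, he2]
  · intro k hk
    rw [hes]
    by_cases hkδ : k = Sum.inl (flip i ε)
    · rw [hkδ, flipAt, Function.update_self, flipAt_of_ne _ hne'.symm, heδ, hyz _ hxδ, hysame]
    · rw [flipAt_of_ne _ hkδ]
      by_cases hkε : k = Sum.inl ε
      · rw [hkε, flipAt, Function.update_self, heε, hyz', hneg]
      · have hkx : ev k x ≠ 0 := fun h => by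
          rcases (hx0 k).1 h with h | h | h
          · exact hk h
          · exact hkε h
          · exact hkδ h
        rw [flipAt_of_ne _ hkε, he3 k hk, hyx k hkx, hzx k hkx]

/-- All walls of the positive orthant in the same hyperplane have the same label. -/
lemma Labelling.wallLabel_const (hn : 2 ≤ n) (hℓ : Labelling ℓ) {j : Idx n} {y z : Fin n → ℝ}
    (hy : ∀ k, ev k y = 0 ↔ k = j) (hz : ∀ k, ev k z = 0 ↔ k = j)
    (hy' : ∀ i, Sum.inr i ≠ j → sg y (Sum.inr i) = 1)
    (hz' : ∀ i, Sum.inr i ≠ j → sg z (Sum.inr i) = 1) : wallLabel ℓ j y = wallLabel ℓ j z := by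
  refine eq_of_step hn (S := {k | k ≠ j ∧ ∃ i, k = Sum.inr i})
    (fun y z h => wallLabel_congr ℓ j h) ?_ hy hz ?_ ?_
  · intro x y z hx hxj hxS hy hz h1 h2 h3
    have hx0 : ∀ i, Sum.inr i ≠ j → ev (Sum.inr i) x ≠ 0 := fun i hi h => by
      have h4 := hxS (Sum.inr i) ⟨hi, i, rfl⟩
      rw [sg_eq_zero.2 h] at h4
      exact absurd h4 (by decide)
    rcases j with ε | i
    · exact hℓ.wallLabel_step_inl hn hx hxj (fun i => hx0 i (by simp)) hy hz h1 h2 h3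
    · exact hℓ.wallLabel_step_inr hn hx hxj
        (fun k hk => hx0 k fun h => hk (Sum.inr_injective h)) hy hz h1 h2 h3
  · rintro _ ⟨hk, i, rfl⟩
    exact hy' i hk
  · rintro _ ⟨hk, i, rfl⟩
    exact hz' i hk

end

end FCArrangement

/-! ### A labelling is determined by the labels of the arrows at `sigma0` -/

namespace FCArrangement

open Salvetti

variable {n : ℕ} {Q : Type*} [Group Q] {ℓ : Arrow (FC n) → Q}

/-- In the positive orthant, arrows which cross the same hyperplane from its positive side have the
same label. -/
lemma Labelling.eq_of_isPos (hn : 2 ≤ n) (hℓ : Labelling ℓ) {e f : Arrow (FC n)} {j : Idx n}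
    (he : idx e = j) (hf : idx f = j) (he1 : IsPos e.src) (hf1 : IsPos f.src)
    (he2 : Ch.sgn e.src j = 1) (hf2 : Ch.sgn f.src j = 1) : ℓ e = ℓ f := by
  have key : ∀ e : Arrow (FC n), idx e = j → IsPos e.src → Ch.sgn e.src j = 1 →
      wallLabel ℓ j (Ch.pt e.wall) = ℓ e ∧ (∀ k, ev k (Ch.pt e.wall) = 0 ↔ k = j) ∧
        ∀ i, Sum.inr i ≠ j → sg (Ch.pt e.wall) (Sum.inr i) = 1 := by
    intro e he he1 he2
    have h : ∀ k, k ≠ j → Ch.sgn e.src k = sg (Ch.pt e.wall) k := fun k hk =>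
      sgn_src_of_ne hn (by rwa [he])
    refine ⟨wallLabel_eq hn ℓ he he2 h, fun k => ?_, fun i hi => ?_⟩
    · rw [← sg_eq_zero, ← he]
      exact sgn_wall_eq_zero hn e k
    · rw [← h _ hi, he1 i]
  obtain ⟨h1, h2, h3⟩ := key e he he1 he2
  obtain ⟨h4, h5, h6⟩ := key f hf hf1 hf2
  rw [← h1, ← h4]
  exact hℓ.wallLabel_const hn h2 h5 h3 h6

/-- The label of the arrows which cross `H ε` towards the origin in the positive orthant. It has the
junk value `1` if there is no such arrow, which is the case only if all entries of `ε` are `-1`. -/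
def downLabel (ℓ : Arrow (FC n) → Q) (ε : Mu n) : Q :=
  open Classical in
  if h : ∃ e, idx e = Sum.inl ε ∧ IsPos e.src ∧ Ch.sgn e.src (Sum.inl ε) = 1
    then ℓ h.choose else 1

lemma Labelling.downLabel_eq (hn : 2 ≤ n) (hℓ : Labelling ℓ) {e : Arrow (FC n)} {ε : Mu n}
    (h1 : idx e = Sum.inl ε) (h2 : IsPos e.src) (h3 : Ch.sgn e.src (Sum.inl ε) = 1) :
    downLabel ℓ ε = ℓ e := by
  have h : ∃ e, idx e = Sum.inl ε ∧ IsPos e.src ∧ Ch.sgn e.src (Sum.inl ε) = 1 := ⟨e, h1, h2, h3⟩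
  rw [downLabel, dif_pos h]
  obtain ⟨h4, h5, h6⟩ := h.choose_spec
  exact hℓ.eq_of_isPos hn h4 h1 h5 h2 h6 h3

/-- Every labelling is of the form `label D c`. -/
lemma Labelling.eq_label (hn : 2 ≤ n) (hℓ : Labelling ℓ) {b : Fin n → Arrow (FC n)}
    (hb : ∀ i, idx (b i) = Sum.inr i) (hb1 : ∀ i, IsPos (b i).src) (e : Arrow (FC n)) :
    ℓ e = label (downLabel ℓ) (fun i => ℓ (b i)) e := by
  wlog hpos : IsPos e.src generalizing e
  · obtain ⟨g, hg⟩ := exists_smul_isPos hn e.src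
    rw [← hℓ.smul g, this (g • e) hg, label_smul _ _ hn]
  rw [label]
  rcases hi : idx e with ε | i
  · rw [val_inl]
    split_ifs with h
    · exact hℓ.up e ⟨ε, hi, h⟩
    · rw [orth_of_isPos hpos, mul_one]
      exact (hℓ.downLabel_eq hn hi hpos
        ((signType_eq_one_or (sgn_ne_zero hn _ _)).resolve_right h)).symm
  · exact hℓ.eq_of_isPos hn hi (hb i) hpos (hb1 i) (hpos i) (hb1 i i)

/-- Products of labels along two paths around a face. -/
lemma valProd_eq_of_around (hn : 2 ≤ n) {D : Mu n → Q} {c : Fin n → Q}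
    (h : Labelling (label D c)) {x : Fin n → ℝ} (hx : HasCodim 2 x) {u v w : Ch (FC n) 0}
    (hu : Near x u) {p q : List (Arrow (FC n))} (hp : IsPath u p v) (hq : IsPath u q w)
    {l m : List (Idx n)} (hl : p.map idx = l) (hm : q.map idx = m) (hl1 : l.Nodup) (hm1 : m.Nodup)
    (hl2 : ∀ k, k ∈ l ↔ ev k x = 0) (hm2 : ∀ k, k ∈ m ↔ ev k x = 0) :
    valProd D c (Ch.sgn u) l = valProd D c (Ch.sgn u) m := by
  subst hl hm
  rw [← prod_label_of_path D c hn hp, ← prod_label_of_path D c hn hq]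
  exact prod_eq_of_around hn h.disc hx hu hp hq hl1 hm1 hl2 hm2

lemma valProd_pair (hn : 2 ≤ n) {D : Mu n → Q} {c : Fin n → Q} (h : Labelling (label D c))
    {x : Fin n → ℝ} {j k : Idx n} (hjk : j ≠ k) (hx : ∀ l, ev l x = 0 ↔ l = j ∨ l = k)
    {u : Ch (FC n) 0} (hu : Near x u) :
    valProd D c (Ch.sgn u) [j, k] = valProd D c (Ch.sgn u) [k, j] := by
  have hx' : ∀ l, ev l x = 0 ↔ l = k ∨ l = j := fun l => by rw [hx, or_comm]
  obtain ⟨e, rfl, he⟩ := exists_cross_pair hn hjk hx hu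
  obtain ⟨f, hf, hf'⟩ := exists_cross_pair hn hjk.symm hx'
    (hu.tgt hn (by rw [he, hx]; exact Or.inl rfl))
  obtain ⟨g, hg, hg'⟩ := exists_cross_pair hn hjk.symm hx' hu
  obtain ⟨d, hd, hd'⟩ := exists_cross_pair hn hjk hx
    (Near.tgt hn (by rwa [hg]) (by rw [hg', hx]; exact Or.inr rfl) : Near x g.tgt)
  exact valProd_eq_of_around hn h (hasCodim_two_of_pair hn hjk hx) hu (p := [e, f]) (q := [g, d])
    ⟨rfl, hf, rfl⟩ ⟨hg, hd, rfl⟩ (by simp [he, hf']) (by simp [hg', hd']) (by simp [hjk])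
    (by simp [hjk.symm]) (fun l => by simp [hx]) (fun l => by simp [hx'])

/-- The relation at a face in two coordinate hyperplanes. -/
lemma commute_of_labelling (hn : 2 ≤ n) {D : Mu n → Q} {c : Fin n → Q}
    (h : Labelling (label D c)) (i k : Fin n) : Commute (c i) (c k) := by
  by_cases hik : i = k
  · rw [hik]
  have hne : (Sum.inr i : Idx n) ≠ Sum.inr k := by simpa
  obtain ⟨x, -, hx, hi, hk⟩ := exists_face_point hn (x₀ := 0) hne
    (by rw [ev_inr]; rfl) (by rw [ev_inr]; rfl)
  have hx0 := hx.corner hn hik hi hk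
  obtain ⟨u, hu, -⟩ := exists_near hn x (Pi.single i 1 + Pi.single k 1) fun l hl => by
    rcases (hx0 l).1 hl with rfl | rfl <;> simp [lin_inr, hik, Ne.symm hik]
  have := valProd_pair hn h hne hx0 hu
  rw [commute_iff_eq]
  simpa [valProd, val_inr] using this

/-- The relation at a face in `H ε` and `H δ`. -/
lemma commute_down_of_labelling (hn : 2 ≤ n) {D : Mu n → Q} {c : Fin n → Q}
    (h : Labelling (label D c)) {ε δ : Mu n}
    (hcross : (H ε ∩ H δ ∩ {x | ∀ i, 0 < x i}).Nonempty) : Commute (D ε) (D δ) := by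
  by_cases hne : ε = δ
  · rw [hne]
  obtain ⟨x₀, ⟨hε, hδ⟩, hpos⟩ := hcross
  have hne' : (Sum.inl ε : Idx n) ≠ Sum.inl δ := by simpa
  rw [← hyp_inl] at hε hδ
  have hx₀ : ∀ i, sg x₀ (Sum.inr i) = 1 := fun i => by
    rw [sg_eq_one, ev_inr]
    exact hpos i
  obtain ⟨x, h1, hx, hε', hδ'⟩ := exists_face_point hn hne' hε hδ
  have hxpos : ∀ i, sg x (Sum.inr i) = 1 := fun i => by
    rw [h1 _ fun h0 => ?_, hx₀ i]
    rw [← sg_eq_zero, hx₀] at h0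
    exact absurd h0 (by decide)
  have hxne : ∀ i, ev (Sum.inr i) x ≠ 0 := fun i h0 => by
    rw [← sg_eq_zero, hxpos] at h0
    exact absurd h0 (by decide)
  have hx0 := hx.square hn hne hε' hδ' hxne
  have hlin : ∀ l, ev l x = 0 → lin l x = 1 := fun l hl => by
    rcases (hx0 l).1 hl with rfl | rfl <;> exact lin_inl_of_zero hl
  obtain ⟨u, hu, hu2⟩ := exists_near hn x x fun l hl => by rw [hlin l hl]; norm_num
  have hupos : IsPos u := fun i => by rw [hu _ (hxne i), hxpos]
  have hs : ∀ l, ev l x = 0 → Ch.sgn u l = 1 := fun l hl => by rw [hu2 l hl, hlin l hl, sign_one]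
  have := valProd_pair hn h hne' hx0 hu
  rw [commute_iff_eq]
  simpa [valProd, val_inl, flipAt_of_ne _ hne', flipAt_of_ne _ hne'.symm, orth_flipAt_inl,
    orth_of_isPos hupos, hs _ hε', hs _ hδ'] using this

/-- A face in the `i`-th coordinate hyperplane and in `H ε`, in the closed positive orthant. -/
lemma exists_hexagon_point (hn : 2 ≤ n) {i k : Fin n} (hik : k ≠ i) {ε : Mu n} (hi : ε i = 1)
    (hk : ε k = 1) : ∃ x, HasCodim 2 x ∧ IsHexagon x i ε ∧
      ∀ m, m ≠ i → sg x (Sum.inr m) = 1 := by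
  -- the `k`-th coordinate is so large that the sum in the equation of `H ε` is positive
  let z : Fin n → ℝ := fun m => if m = i then 0 else if m = k then n else 1
  have hS : 0 < lin (Sum.inl ε) z := by
    rw [lin_inl, ← Finset.add_sum_erase _ _ (Finset.mem_univ k)]
    have h1 : ∀ m ∈ Finset.univ.erase k, (-1 : ℝ) ≤ ((ε m : ℤ) : ℝ) * z m := by
      intro m hm
      have hmk : m ≠ k := Finset.ne_of_mem_erase hm
      by_cases hmi : m = i
      · simp [z, hmi]
      · rcases Int.units_eq_one_or (ε m) with h | h <;> simp [z, hmi, hmk, h]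
    have h2 := Finset.card_nsmul_le_sum _ _ _ h1
    rw [Finset.card_erase_of_mem (Finset.mem_univ k), Finset.card_univ, Fintype.card_fin,
      nsmul_eq_mul, Nat.cast_sub (by omega)] at h2
    have h3 : ((ε k : ℤ) : ℝ) * z k = n := by simp [z, hk, hik]
    rw [h3]
    push_cast at h2
    linarith
  set S := lin (Sum.inl ε) z
  have hε : ev (Sum.inl ε) (S⁻¹ • z) = 0 := by
    change lin (Sum.inl ε) (S⁻¹ • z) - 1 = 0
    rw [map_smul, smul_eq_mul, inv_mul_cancel₀ hS.ne', sub_self]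
  have hi0 : ev (Sum.inr i) (S⁻¹ • z) = 0 := by
    rw [ev_inr]
    simp [z]
  have hpos : ∀ m, m ≠ i → sg (S⁻¹ • z) (Sum.inr m) = 1 := fun m hm => by
    rw [sg_eq_one, ev_inr]
    have : 0 < z m := by
      simp only [z, if_neg hm]
      split_ifs
      · exact_mod_cast (by omega : 0 < n)
      · exact one_pos
    exact mul_pos (inv_pos.2 hS) this
  obtain ⟨x, h1, hx, hxi, hxε⟩ := exists_face_point hn (by simp) hi0 hε
  refine ⟨x, hx, ⟨hi, hx.hexagon hn hxi hxε⟩, fun m hm => ?_⟩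
  rw [h1 _ fun h0 => ?_, hpos m hm]
  rw [← sg_eq_zero, hpos m hm] at h0
  exact absurd h0 (by decide)

/-- A chamber near a face in a coordinate hyperplane, in the direction of `x + a eᵢ`. -/
lemma IsHexagon.exists_near (hn : 2 ≤ n) {x : Fin n → ℝ} {i : Fin n} {ε : Mu n}
    (h : IsHexagon x i ε) (hpos : ∀ m, m ≠ i → sg x (Sum.inr m) = 1) {a : ℝ} (ha : 0 < a)
    (ha' : a ≠ 1) : ∃ u, Near x u ∧ IsPos u ∧ Ch.sgn u (Sum.inl ε) = 1 ∧
      Ch.sgn u (Sum.inl (flip i ε)) = SignType.sign (1 - a) := by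
  have hi := (h.2 _).2 (Or.inl rfl)
  have hε := (h.2 _).2 (Or.inr (Or.inl rfl))
  have hδ := (h.2 _).2 (Or.inr (Or.inr rfl))
  have l1 : lin (Sum.inr i) (x + Pi.single i a) = a := by
    rw [map_add, lin_inr_eq_ev, hi, lin_inr]; simp
  have l2 : lin (Sum.inl ε) (x + Pi.single i a) = 1 + a := by
    rw [map_add, lin_inl_of_zero hε, lin_inl_single, h.1]; simp
  have l3 : lin (Sum.inl (flip i ε)) (x + Pi.single i a) = 1 - a := by
    rw [map_add, lin_inl_of_zero hδ, lin_inl_single, flip_same, h.1]; simp; ring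
  obtain ⟨u, hu, hu'⟩ := FCArrangement.exists_near hn x (x + Pi.single i a) fun l hl => by
    rcases (h.2 l).1 hl with rfl | rfl | rfl
    · rw [l1]; exact ha.ne'
    · rw [l2]; positivity
    · rw [l3, sub_ne_zero]; exact ha'.symm
  refine ⟨u, hu, fun m => ?_, ?_, ?_⟩
  · by_cases hm : m = i
    · rw [hm, hu' _ hi, l1, sign_pos ha]
    · rw [hu _ fun h0 => ?_, hpos m hm]
      rw [← sg_eq_zero, hpos m hm] at h0
      exact absurd h0 (by decide)
  · rw [hu' _ hε, l2, sign_pos (by positivity)]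
  · rw [hu' _ hδ, l3]

/-- The relation at a face in a coordinate hyperplane, from a chamber between `H ε` and
`H (flip i ε)`. -/
lemma down_flip_of_labelling (hn : 2 ≤ n) {D : Mu n → Q} {c : Fin n → Q}
    (h : Labelling (label D c)) {i k : Fin n} (hik : k ≠ i) {ε : Mu n} (hi : ε i = 1)
    (hk : ε k = 1) : D (flip i ε) = (c i)⁻¹ * D ε * c i := by
  obtain ⟨x, hx, hh, hpos⟩ := exists_hexagon_point hn hik hi hk
  obtain ⟨u, hu, hupos, h2, h3⟩ := hh.exists_near hn hpos (a := 2) (by norm_num) (by norm_num)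
  rw [sign_neg (by norm_num)] at h3
  have hne := flip_ne i ε
  have hi1 := hupos i
  have hxi := (hh.2 _).2 (Or.inl rfl)
  have hxε := (hh.2 _).2 (Or.inr (Or.inl rfl))
  have hxδ := (hh.2 _).2 (Or.inr (Or.inr rfl))
  obtain ⟨e, rfl, he⟩ := hh.cross_self hn hu (by rw [hi1, h3])
  have hs1 := sgn_tgt hn e
  rw [he] at hs1
  obtain ⟨f, hf, hf'⟩ := hh.cross_coord hn (hu.tgt hn (by rwa [he]))
    (by rw [hs1]; simp [flipAt, h2, h3, hne])
  have hs2 := sgn_tgt hn f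
  rw [hf, hf', hs1] at hs2
  obtain ⟨g, hg, hg'⟩ := hh.cross_flip hn (Near.tgt hn (by rw [hf]; exact hu.tgt hn (by rwa [he]))
    (by rwa [hf'])) (by rw [hs2]; simp [flipAt, h2, hi1])
  obtain ⟨e', he1, he'⟩ := hh.cross_flip hn hu (by rw [hi1, h2])
  have hs1' := sgn_tgt hn e'
  rw [he1, he'] at hs1'
  have hu1' : Near x e'.tgt := Near.tgt hn (by rwa [he1]) (by rwa [he'])
  obtain ⟨f', hf1, hf1'⟩ := hh.cross_coord hn hu1'
    (by rw [hs1']; simp [flipAt, h2, h3, hne.symm])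
  have hs2' := sgn_tgt hn f'
  rw [hf1, hf1', hs1'] at hs2'
  obtain ⟨g', hg1, hg1'⟩ := hh.cross_self hn (Near.tgt hn (by rwa [hf1]) (by rwa [hf1']))
    (by rw [hs2']; simp [flipAt, h3, hi1])
  have key := valProd_eq_of_around hn h hx hu (p := [e, f, g]) (q := [e', f', g'])
    ⟨rfl, hf, hg, rfl⟩ ⟨he1, hf1, hg1, rfl⟩ (l := [Sum.inl ε, Sum.inr i, Sum.inl (flip i ε)])
    (m := [Sum.inl (flip i ε), Sum.inr i, Sum.inl ε]) (by simp [he, hf', hg'])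
    (by simp [he', hf1', hg1']) (by simp [hne.symm]) (by simp [hne])
    (fun k => by rw [hh.2]; simp; tauto) (fun k => by rw [hh.2]; simp; tauto)
  have ho := orth_of_isPos hupos
  simp [valProd, val_inl, val_inr, flipAt_of_ne, orth_flipAt_inl, mul_orth_flipAt, ho, hi1, h2, h3,
    hne, hne.symm] at key
  rw [mul_assoc, key]
  group

/-- The relation at a face in a coordinate hyperplane, from the chamber farthest from the origin. -/
lemma braid_of_labelling (hn : 2 ≤ n) {D : Mu n → Q} {c : Fin n → Q}
    (h : Labelling (label D c)) {i k : Fin n} (hik : k ≠ i) {ε : Mu n} (hi : ε i = 1)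
    (hk : ε k = 1) : Commute (c i) (D (flip i ε) * D ε) := by
  obtain ⟨x, hx, hh, hpos⟩ := exists_hexagon_point hn hik hi hk
  obtain ⟨u, hu, hupos, h2, h3⟩ := hh.exists_near hn hpos (a := 1 / 2) (by norm_num) (by norm_num)
  rw [sign_pos (by norm_num)] at h3
  have hne := flip_ne i ε
  have hi1 := hupos i
  have hxi := (hh.2 _).2 (Or.inl rfl)
  have hxε := (hh.2 _).2 (Or.inr (Or.inl rfl))
  have hxδ := (hh.2 _).2 (Or.inr (Or.inr rfl))
  obtain ⟨e, rfl, he⟩ := hh.cross_coord hn hu (by rw [h2, h3])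
  have hs1 := sgn_tgt hn e
  rw [he] at hs1
  obtain ⟨f, hf, hf'⟩ := hh.cross_self hn (hu.tgt hn (by rwa [he]))
    (by rw [hs1]; simp [flipAt, h3, hi1])
  have hs2 := sgn_tgt hn f
  rw [hf, hf', hs1] at hs2
  obtain ⟨g, hg, hg'⟩ := hh.cross_flip hn (Near.tgt hn (by rw [hf]; exact hu.tgt hn (by rwa [he]))
    (by rwa [hf'])) (by rw [hs2]; simp [flipAt, h2, hi1])
  obtain ⟨e', he1, he'⟩ := hh.cross_flip hn hu (by rw [hi1, h2])
  have hs1' := sgn_tgt hn e'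
  rw [he1, he'] at hs1'
  have hu1' : Near x e'.tgt := Near.tgt hn (by rwa [he1]) (by rwa [he'])
  obtain ⟨f', hf1, hf1'⟩ := hh.cross_self hn hu1' (by rw [hs1']; simp [flipAt, h3, hi1])
  have hs2' := sgn_tgt hn f'
  rw [hf1, hf1', hs1'] at hs2'
  obtain ⟨g', hg1, hg1'⟩ := hh.cross_coord hn (Near.tgt hn (by rwa [hf1]) (by rwa [hf1']))
    (by rw [hs2']; simp [flipAt, h2, h3, hne, hne.symm])
  have key := valProd_eq_of_around hn h hx hu (p := [e, f, g]) (q := [e', f', g'])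
    ⟨rfl, hf, hg, rfl⟩ ⟨he1, hf1, hg1, rfl⟩ (l := [Sum.inr i, Sum.inl ε, Sum.inl (flip i ε)])
    (m := [Sum.inl (flip i ε), Sum.inl ε, Sum.inr i]) (by simp [he, hf', hg'])
    (by simp [he', hf1', hg1']) (by simp [hne.symm]) (by simp [hne])
    (fun k => by rw [hh.2]; simp) (fun k => by rw [hh.2]; simp; tauto)
  have ho := orth_of_isPos hupos
  simp [valProd, val_inl, val_inr, flipAt_of_ne, orth_flipAt_inl, mul_orth_flipAt, ho, hi1, h2, h3,
    hne, hne.symm, flip_flip] at key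
  rw [commute_iff_eq, key, mul_assoc]

/-- All labels of crossings towards the origin are conjugates of one of them. -/
lemma down_eq_conjWrd (hn : 2 ≤ n) {D : Mu n → Q} {c : Fin n → Q} (h : Labelling (label D c))
    {ε : Mu n} {k : Fin n} (hk : ε k = 1) : D ε = conjWrd (D 1) c ε := by
  induction hm : {i | ε i = -1}.ncard generalizing ε with
  | zero =>
    have h1 : ε = 1 := by
      rw [ncard_eq_zero] at hm
      funext i
      refine (Int.units_eq_one_or (ε i)).resolve_right fun hi => ?_
      have : i ∈ {i | ε i = -1} := hi
      rw [hm] at this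
      exact this
    rw [h1, conjWrd, wrd_one]
    simp
  | succ m ih =>
    obtain ⟨i, hi⟩ : {i | ε i = -1}.Nonempty := by
      rw [← ncard_pos]; omega
    have hi' : ε i = -1 := hi
    have hki : k ≠ i := by
      rintro rfl
      rw [hk] at hi'
      exact absurd hi' (by decide)
    have h1 : flip i ε i = 1 := by rw [flip_same, hi']; rfl
    have h2 : flip i ε k = 1 := by rw [flip_of_ne hki, hk]
    have h3 : {m | flip i ε m = -1} = {m | ε m = -1} \ {i} := by
      ext m
      by_cases hmi : m = i
      · simp [hmi, h1]
      · simp [flip_of_ne hmi, hmi]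
    have h4 := ih h2 (by rw [h3, ncard_sdiff_singleton_of_mem hi, hm]; rfl)
    have h5 := down_flip_of_labelling hn h hki h1 h2
    rw [flip_flip] at h5
    rw [h5, h4, ← conjWrd_flip (commute_of_labelling hn h) _ h1, flip_flip]

/-- A hyperplane `H ε` which meets the open positive orthant, or separates a point of it from the
origin, has a positive coefficient. -/
lemma exists_eq_one_of_pos {x : Fin n → ℝ} {ε : Mu n} (hx : ∀ i, 0 < x i)
    (h : 0 ≤ ev (Sum.inl ε) x) : ∃ k, ε k = 1 := by
  by_contra! hne
  have h1 : ∑ i, ((ε i : ℤ) : ℝ) * x i ≤ 0 := Finset.sum_nonpos fun i _ => by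
    rw [(Int.units_eq_one_or (ε i)).resolve_left (hne i)]
    simpa using (hx i).le
  rw [ev_inl] at h
  linarith

/-- In a labelling, the labels of the arrow into `sigma0` and of the arrows out of `sigma0` satisfy
the relations of the presentation. -/
theorem Labelling.rel (hn : 2 ≤ n) (hℓ : Labelling ℓ) {a : Arrow (FC n)}
    (ha : idx a = Sum.inl 1) (ha1 : IsPos a.src) (ha2 : Ch.sgn a.src (Sum.inl 1) = 1)
    {b : Fin n → Arrow (FC n)} (hb : ∀ i, idx (b i) = Sum.inr i) (hb1 : ∀ i, IsPos (b i).src)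
    {γ : Fin (n + 1) → Q} (hγ0 : γ 0 = ℓ a) (hγ : ∀ i : Fin n, γ i.succ = ℓ (b i))
    {r : FreeGroup (Fin (n + 1))} (hr : Rel n r) : FreeGroup.lift γ r = 1 := by
  have hlab : label (downLabel ℓ) (fun i => γ i.succ) = ℓ := funext fun e => by
    rw [hℓ.eq_label hn hb hb1 e]
    simp only [hγ]
  have h : Labelling (label (downLabel ℓ) fun i => γ i.succ) := by
    rw [hlab]
    exact hℓ
  have hc := commute_of_labelling hn h
  have hD1 : downLabel ℓ 1 = γ 0 := by rw [hℓ.downLabel_eq hn ha ha1 ha2, hγ0]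
  cases hr with
  | comm i k => exact lift_comm_eq_one.2 (by simpa using hc i k)
  | braid i =>
    obtain ⟨k, hk⟩ := exists_ne_fin hn i
    have h1 := braid_of_labelling hn h hk (ε := 1) rfl rfl
    rw [down_flip_of_labelling hn h hk (ε := 1) rfl rfl, hD1] at h1
    rw [map_mul, map_inv, mul_inv_eq_one]
    simpa using braid_of_commute h1
  | conj ε δ hne =>
    rw [lift_comm_eq_one, lift_conj, lift_conj]
    have h1 := commute_down_of_labelling hn h hne
    obtain ⟨x, ⟨hε, hδ⟩, hx⟩ := hne
    rw [← hyp_inl] at hε hδ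
    obtain ⟨k, hk⟩ := exists_eq_one_of_pos hx (le_of_eq (Eq.symm hε))
    obtain ⟨m, hm⟩ := exists_eq_one_of_pos hx (le_of_eq (Eq.symm hδ))
    rwa [down_eq_conjWrd hn h hk, down_eq_conjWrd hn h hm, hD1] at h1

/-- The labels of the arrow into `sigma0` and of the arrows out of `sigma0` generate the group
generated by all labels. -/
theorem Labelling.mem (hn : 2 ≤ n) (hℓ : Labelling ℓ) {a : Arrow (FC n)}
    (ha : idx a = Sum.inl 1) (ha1 : IsPos a.src) (ha2 : Ch.sgn a.src (Sum.inl 1) = 1)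
    {b : Fin n → Arrow (FC n)} (hb : ∀ i, idx (b i) = Sum.inr i) (hb1 : ∀ i, IsPos (b i).src)
    {P : Subgroup Q} (h0 : ℓ a ∈ P) (hP : ∀ i, ℓ (b i) ∈ P) (e : Arrow (FC n)) : ℓ e ∈ P := by
  have h : Labelling (label (downLabel ℓ) fun i => ℓ (b i)) := by
    convert hℓ using 1
    exact funext fun e => (hℓ.eq_label hn hb hb1 e).symm
  wlog hpos : IsPos e.src generalizing e
  · obtain ⟨g, hg⟩ := exists_smul_isPos hn e.src
    rw [← hℓ.smul g]
    exact this _ hg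
  rw [hℓ.eq_label hn hb hb1 e, label]
  rcases hi : idx e with ε | i
  · rw [val_inl]
    split_ifs with hs
    · exact P.one_mem
    · rw [orth_of_isPos hpos, mul_one]
      have hs' := (signType_eq_one_or (sgn_ne_zero hn e.src (Sum.inl ε))).resolve_right hs
      obtain ⟨k, hk⟩ := exists_eq_one_of_pos (x := Ch.pt e.src) (ε := ε)
        (fun i => by
          have := sg_eq_one.1 (hpos i)
          rwa [ev_inr] at this) (sg_eq_one.1 hs').le
      rw [down_eq_conjWrd hn h hk, hℓ.downLabel_eq hn ha ha1 ha2, conjWrd]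
      have hw : wrd (fun i => ℓ (b i)) ε ∈ P := P.list_prod_mem fun q hq => by
        obtain ⟨m, -, rfl⟩ := List.mem_map.1 hq
        exact hP m
      exact P.mul_mem (P.mul_mem (P.inv_mem hw) h0) hw
  · exact hP i

end FCArrangement

/-! ### The collapsed space as a 2-complex with one vertex -/

namespace FCArrangement

open Salvetti TwoComplex

variable {n : ℕ}

/-- A point of a chamber at which the left-hand sides of the equations of the hyperplanes `H ε` have
different values. -/
lemma exists_mem_lin_ne (hn : 2 ≤ n) (u : Ch (FC n) 0) :
    ∃ y, sg y = Ch.sgn u ∧ ∀ ε δ : Mu n, ε ≠ δ → lin (Sum.inl ε) y ≠ lin (Sum.inl δ) y := by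
  obtain ⟨w, -, hw⟩ := exists_generic_dir (n := n) ⊤
    fun a : Mu n × Mu n => lin (Sum.inl a.1) - lin (Sum.inl a.2)
  have hev : ∀ᶠ t in 𝓝[>] (0 : ℝ), ∀ a : Mu n × Mu n, a.1 ≠ a.2 →
      lin (Sum.inl a.1) (Ch.pt u + t • w) ≠ lin (Sum.inl a.2) (Ch.pt u + t • w) := by
    rw [Filter.eventually_all]
    rintro ⟨ε, δ⟩
    by_cases hne : ε = δ
    · simp [hne]
    simp only [map_add, map_smul, smul_eq_mul]
    by_cases h0 : lin (Sum.inl ε) (Ch.pt u) = lin (Sum.inl δ) (Ch.pt u)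
    · filter_upwards [self_mem_nhdsWithin] with t ht _ h
      rw [h0, add_right_inj] at h
      have h1 := hw (ε, δ) (by
        change lin (Sum.inl ε) w - lin (Sum.inl δ) w = 0
        rw [mul_left_cancel₀ (ne_of_gt ht) h, sub_self])
      obtain ⟨i, hi⟩ := Function.ne_iff.1 hne
      have h2 := h1 (Pi.single i ((ε i : ℤ) : ℝ)) trivial
      rw [LinearMap.sub_apply, lin_inl_single, lin_inl_single, unit_cast_mul_self,
        unit_cast_mul_of_ne hi.symm] at h2
      norm_num at h2
    · have hc : Continuous fun t : ℝ => (lin (Sum.inl ε) (Ch.pt u) + t * lin (Sum.inl ε) w) -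
          (lin (Sum.inl δ) (Ch.pt u) + t * lin (Sum.inl δ) w) := by fun_prop
      have := hc.continuousAt.eventually_ne (x := 0) (y := 0) (by simpa [sub_eq_zero] using h0)
      refine Filter.Eventually.filter_mono nhdsWithin_le_nhds ?_
      filter_upwards [this] with t ht _ h
      exact ht (sub_eq_zero.2 h)
  obtain ⟨t, h1, h2⟩ := ((sg_add_smul_eventually (Ch.pt u) w).and hev).exists
  refine ⟨_, funext fun l => ?_, fun ε δ h => h2 (ε, δ) h⟩
  rw [h1, if_neg ((hasCodim_zero_iff hn).1 (Ch.hasCodim u) l)]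
  rfl

/-- A ray from the origin through a chamber crosses hyperplanes `H ε` only, so that each chamber has
a wall in one of them. -/
lemma exists_arrow_inl (hn : 2 ≤ n) (u : Ch (FC n) 0) :
    ∃ (e : Arrow (FC n)) (ε : Mu n), e.src = u ∧ idx e = Sum.inl ε := by
  obtain ⟨y, hy, hne⟩ := exists_mem_lin_ne hn u
  have hu0 : ∀ l, ev l y ≠ 0 := fun l h => by
    rw [← sg_eq_zero, hy] at h
    exact sgn_ne_zero hn u l h
  suffices h : ∃ (ε : Mu n) (t : ℝ), 0 < t ∧ t * lin (Sum.inl ε) y = 1 ∧ ∀ δ, δ ≠ ε →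
      sg (t • y) (Sum.inl δ) = sg y (Sum.inl δ) ∧ sg y (Sum.inl δ) ≠ 0 by
    obtain ⟨ε, t, ht, h1, h2⟩ := h
    have h3 : ∀ i, sg (t • y) (Sum.inr i) = sg y (Sum.inr i) := fun i => by
      change SignType.sign _ = SignType.sign _
      rw [ev_inr, ev_inr, Pi.smul_apply, smul_eq_mul, sign_mul, sign_pos ht, one_mul]
    have h4 : ∀ k, k ≠ Sum.inl ε → sg (t • y) k = sg y k := by
      rintro (δ | i) hk
      · exact (h2 δ fun h => hk (by rw [h])).1
      · exact h3 i
    obtain ⟨e, he, he', -⟩ := exists_arrow hn (y := t • y) (j := Sum.inl ε) (fun k => by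
      constructor
      · intro hk
        by_contra hkε
        rw [← sg_eq_zero, h4 k hkε, sg_eq_zero] at hk
        exact hu0 k hk
      · rintro rfl
        change lin (Sum.inl ε) (t • y) - 1 = 0
        rw [map_smul, smul_eq_mul, h1, sub_self]) u fun k hk => by rw [h4 k hk, hy]
    exact ⟨e, ε, he, he'⟩
  have hsg : ∀ (t : ℝ) (δ : Mu n), 0 < (t * lin (Sum.inl δ) y - 1) * (lin (Sum.inl δ) y - 1) →
      sg (t • y) (Sum.inl δ) = sg y (Sum.inl δ) ∧ sg y (Sum.inl δ) ≠ 0 := by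
    intro t δ h
    refine ⟨?_, fun h => hu0 _ (sg_eq_zero.1 h)⟩
    have e1 : ev (Sum.inl δ) (t • y) = t * lin (Sum.inl δ) y - 1 := by
      change lin (Sum.inl δ) (t • y) - 1 = _
      rw [map_smul, smul_eq_mul]
    change SignType.sign (ev _ _) = SignType.sign (lin (Sum.inl δ) y - 1)
    rw [e1]
    rcases pos_and_pos_or_neg_and_neg_of_mul_pos h with ⟨h1, h2⟩ | ⟨h1, h2⟩
    · rw [sign_pos h1, sign_pos h2]
    · rw [sign_neg h1, sign_neg h2]
  have hne1 : ∀ δ, lin (Sum.inl δ) y ≠ 1 := fun δ h => hu0 (Sum.inl δ) (sub_eq_zero.2 h)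
  by_cases hex : ∃ δ, 1 < lin (Sum.inl δ) y
  · -- go towards the origin, to the first hyperplane
    let T : Finset (Mu n) := Finset.univ.filter fun δ => 1 < lin (Sum.inl δ) y
    obtain ⟨ε, hε, hmin⟩ := T.exists_min_image (fun δ => lin (Sum.inl δ) y)
      (by obtain ⟨δ, hδ⟩ := hex; exact ⟨δ, by simpa [T] using hδ⟩)
    have hε1 : 1 < lin (Sum.inl ε) y := by simpa [T] using hε
    have hε0 : 0 < lin (Sum.inl ε) y := by linarith
    refine ⟨ε, (lin (Sum.inl ε) y)⁻¹, inv_pos.2 hε0, inv_mul_cancel₀ hε0.ne', fun δ hδ => ?_⟩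
    refine hsg _ _ ?_
    rw [inv_mul_eq_div]
    rcases lt_or_gt_of_ne (hne1 δ) with h | h
    · refine mul_pos_of_neg_of_neg ?_ (by linarith)
      rw [sub_neg, div_lt_one hε0]
      linarith
    · refine mul_pos ?_ (by linarith)
      rw [sub_pos, one_lt_div hε0]
      exact lt_of_le_of_ne (hmin δ (by simpa [T] using h)) (hne ε δ hδ.symm)
  · -- go away from the origin, to the first hyperplane
    push Not at hex
    obtain ⟨ε, -, hmax⟩ := (Finset.univ : Finset (Mu n)).exists_max_image
      (fun δ => lin (Sum.inl δ) y) ⟨1, Finset.mem_univ _⟩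
    have hn0 : 0 < n := by omega
    have hε0 : 0 < lin (Sum.inl ε) y := by
      have h1 : (1 : Mu n) ≠ -1 := fun h => by
        have h2 : (1 : ℤˣ) = -1 := congrFun h ⟨0, hn0⟩
        exact absurd h2 (by decide)
      have h2 : lin (Sum.inl (-1 : Mu n)) y = -lin (Sum.inl (1 : Mu n)) y :=
        lin_inl_neg fun m => Or.inl rfl
      have h3 := hne _ _ h1
      have h4 := hmax 1 (Finset.mem_univ _)
      have h5 := hmax (-1) (Finset.mem_univ _)
      rw [h2] at h3 h5
      by_contra h6
      exact h3 (by linarith)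
    refine ⟨ε, (lin (Sum.inl ε) y)⁻¹, inv_pos.2 hε0, inv_mul_cancel₀ hε0.ne', fun δ hδ => ?_⟩
    refine hsg _ _ (mul_pos_of_neg_of_neg ?_ ?_)
    · rw [inv_mul_eq_div, sub_neg, div_lt_one hε0]
      exact lt_of_le_of_ne (hmax δ (Finset.mem_univ _)) (hne δ ε hδ)
    · linarith [lt_of_le_of_ne (hex δ) (hne1 δ)]

/-- Each chamber is an end of an arrow which is a translate of a spanning arrow. -/
lemma exists_isUp (hn : 2 ≤ n) (u : Ch (FC n) 0) :
    ∃ e : Arrow (FC n), IsUp e ∧ (e.src = u ∨ e.tgt = u) := by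
  obtain ⟨e, ε, rfl, he⟩ := exists_arrow_inl hn u
  rcases signType_eq_one_or (sgn_ne_zero hn e.src (Sum.inl ε)) with h | h
  · let f : Arrow (FC n) :=
      { src := e.tgt, wall := e.wall, tgt := e.src, ne := e.ne.symm, src_wall := e.tgt_wall,
        tgt_wall := e.src_wall }
    refine ⟨f, ⟨ε, he, ?_⟩, Or.inr rfl⟩
    change Ch.sgn e.tgt _ = _
    rw [← he, sgn_tgt_idx hn, he, h]
  · exact ⟨e, ⟨ε, he, h⟩, Or.inl rfl⟩

lemma continuous_X2s_mk : Continuous (X2s.mk (n := n)) :=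
  (continuous_quot_mk.comp continuous_inl).comp
    ((continuous_quotient_mk' (s := MulAction.orbitRel (Mu n) (X2 (FC n)))).comp continuous_quot_mk)

lemma X2s_mk_smul (g : Mu n) (a : Cells (FC n)) : X2s.mk (smulCells g a) = X2s.mk a := by
  refine congrArg (fun x => Quot.mk _ (Sum.inl x)) ?_
  exact Quotient.sound (s := MulAction.orbitRel (Mu n) (X2 (FC n))) ⟨g, rfl⟩

lemma X2s_mk_glue {a b : Cells (FC n)} (h : Glue a b) : X2s.mk a = X2s.mk b :=
  congrArg (fun x : X2 (FC n) => (Quot.mk _ (Sum.inl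
    (Quotient.mk (MulAction.orbitRel (Mu n) (X2 (FC n))) x)) : X2s n)) (Quot.sound h)

lemma X2s_mk_arrow_of_isUp (hn : 2 ≤ n) {e : Arrow (FC n)} (h : IsUp e) (t : I) :
    X2s.mk (arrowPt e t) = X2s.base n := by
  obtain ⟨g, hg⟩ := exists_smul_isSpanningArrow hn h
  rw [← X2s_mk_smul g]
  exact Quot.sound (Collapse.mk _ (Or.inl ⟨g • e, hg, t, rfl⟩))

lemma X2s_mk_disc_of_isSpanningDisc {F : Disc (FC n)} {g : Mu n} (h : IsSpanningDisc (g • F))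
    (z : D2) : X2s.mk (discPt F z) = X2s.base n := by
  rw [← X2s_mk_smul g]
  exact Quot.sound (Collapse.mk _ (Or.inr ⟨g • F, h, z, rfl⟩))

lemma X2s_mk_vertex (hn : 2 ≤ n) (u : Ch (FC n) 0) : X2s.mk (vertexPt u) = X2s.base n := by
  obtain ⟨e, he, rfl | rfl⟩ := exists_isUp hn u
  · rw [← X2s_mk_glue (Glue.src e), X2s_mk_arrow_of_isUp hn he]
  · rw [← X2s_mk_glue (Glue.tgt e), X2s_mk_arrow_of_isUp hn he]

lemma lower_ne_nil (F : Disc (FC n)) : F.lower ≠ [] := fun h => by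
  have h1 := F.upper_shortest.2 _ F.lower_shortest.1
  rw [h, List.length_nil, Nat.le_zero, List.length_eq_zero_iff] at h1
  exact F.lower_ne_upper (h.trans h1.symm)

/-- The combinatorics of the cells of the collapsed space: the arrows and the 2-cells with the
action of the group, those translated into the spanning complex being collapsed. -/
def shape (hn : 2 ≤ n) : Shape where
  Edge := Arrow (FC n)
  Disc := Disc (FC n)
  Sym := Mu n
  actE g e := g • e
  actD g F := g • F
  swap F := F.swap
  word F h := if h then F.upper else F.lower
  trivE := IsUp
  trivD F := ∃ g : Mu n, IsSpanningDisc (g • F)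
  word_ne_nil F h := by
    cases h
    · exact lower_ne_nil F
    · exact lower_ne_nil F.swap
  word_swap F h := by cases h <;> rfl
  word_act g F h := by cases h <;> rfl
  trivE_act g e := isUp_smul hn g e
  trivD_act g F := by
    constructor
    · rintro ⟨k, hk⟩
      exact ⟨k * g, by rwa [mul_smul]⟩
    · rintro ⟨k, hk⟩
      exact ⟨k * g⁻¹, by rwa [mul_smul, inv_smul_smul]⟩
  trivD_swap F := Iff.rfl
  trivE_of_mem F h e := by
    rintro ⟨g, hg⟩ he
    refine (isUp_smul hn g e).1 ?_
    cases h
    · exact isUp_of_isSpanningDisc hn hg (g • F).lower_shortest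
        (List.mem_map.2 ⟨e, he, rfl⟩)
    · exact isUp_of_isSpanningDisc hn hg (g • F).upper_shortest
        (List.mem_map.2 ⟨e, he, rfl⟩)

section Lift

variable {T : Type} {c : T} {a : Arrow (FC n) → I → T} {b : Disc (FC n) → D2 → T}

/-- The function on the disjoint union of the closed cells with given values on the cells. -/
def cellsFun (c : T) (a : Arrow (FC n) → I → T) (b : Disc (FC n) → D2 → T) : Cells (FC n) → T
  | Sum.inl _ => c
  | Sum.inr (Sum.inl ⟨e, t⟩) => a e t
  | Sum.inr (Sum.inr ⟨F, z⟩) => b F z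

/-- Functions on the cells which respect the attaching maps, the action and the collapse descend. -/
lemma exists_lift (hn : 2 ≤ n) (h : (shape hn).Compat c a b) :
    ∃ f : X2s n → T, f (X2s.base n) = c ∧ (∀ e t, f (X2s.mk (arrowPt e t)) = a e t) ∧
      ∀ F z, f (X2s.mk (discPt F z)) = b F z := by
  have hglue : ∀ p q : Cells (FC n), Glue p q → cellsFun c a b p = cellsFun c a b q := by
    intro p q hpq
    cases hpq with
    | src e => exact h.zero e
    | tgt e => exact h.one e
    | lower F z hz him k t ht => exact h.bdry F false z k k.2 t ⟨hz, by simpa using him⟩ ht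
    | upper F z hz him k t ht => exact h.bdry F true z k k.2 t ⟨hz, by simpa using him⟩ ht
    | swap F z => exact (h.swap F z).symm
  let f₁ : X2 (FC n) → T := Quot.lift (cellsFun c a b) hglue
  have hact : ∀ (g : Mu n) (x : X2 (FC n)), f₁ (g • x) = f₁ x := by
    intro g x
    induction x using Quot.ind with
    | mk p =>
      rcases p with ⟨u, _⟩ | ⟨e, t⟩ | ⟨F, z⟩
      · rfl
      · exact h.act g e t
      · exact h.actD g F z
  let f₂ : X2bar n → T := Quotient.lift (s := MulAction.orbitRel (Mu n) (X2 (FC n))) f₁ (by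
    rintro _ x ⟨g, rfl⟩
    exact hact g x)
  refine ⟨Quot.lift (Sum.elim f₂ fun _ => c) ?_, rfl, fun e t => rfl, fun F z => rfl⟩
  rintro _ _ ⟨x, ⟨e, he, t, rfl⟩ | ⟨F, hF, z, rfl⟩⟩
  · exact h.triv e t ((isSpanningArrow_iff hn).1 he).2
  · exact h.trivD F z ⟨1, by rwa [one_smul]⟩

end Lift

lemma isOpen_X2s (U : Set (X2s n)) (h1 : ∀ e, IsOpen ((fun t => X2s.mk (arrowPt e t)) ⁻¹' U))
    (h2 : ∀ F, IsOpen ((fun z => X2s.mk (discPt F z)) ⁻¹' U)) : IsOpen U := by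
  change IsOpen (Quot.mk _ ⁻¹' U)
  rw [isOpen_sum_iff]
  refine ⟨?_, isOpen_discrete _⟩
  change IsOpen (Quotient.mk (MulAction.orbitRel (Mu n) (X2 (FC n))) ⁻¹' _)
  change IsOpen (Quot.mk (Glue (A := FC n)) ⁻¹' _)
  rw [isOpen_sum_iff, isOpen_sum_iff]
  refine ⟨?_, ?_, ?_⟩
  · rw [isOpen_sigma_iff]
    exact fun u => isOpen_discrete _
  · rw [isOpen_sigma_iff]
    exact h1
  · rw [isOpen_sigma_iff]
    exact h2

/-- The collapsed space is the 2-complex with one vertex described by `shape`. -/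
def realization (hn : 2 ≤ n) : Realization (shape hn) (X2s n) (X2s.base n) where
  edge e := ⟨fun t => X2s.mk (arrowPt e t), continuous_X2s_mk.comp
    (continuous_inr.comp (continuous_inl.comp continuous_sigmaMk))⟩
  disc F := ⟨fun z => X2s.mk (discPt F z), continuous_X2s_mk.comp
    (continuous_inr.comp (continuous_inr.comp continuous_sigmaMk))⟩
  compat :=
    { zero := fun e => (X2s_mk_glue (Glue.src e)).trans (X2s_mk_vertex hn _)
      one := fun e => (X2s_mk_glue (Glue.tgt e)).trans (X2s_mk_vertex hn _)
      triv := fun e t h => X2s_mk_arrow_of_isUp hn h t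
      act := fun g e t => X2s_mk_smul g (arrowPt e t)
      trivD := fun F z ⟨_, hg⟩ => X2s_mk_disc_of_isSpanningDisc hg z
      actD := fun g F z => X2s_mk_smul g (discPt F z)
      swap := fun F z => (X2s_mk_glue (Glue.swap F z)).symm
      bdry := fun F h z k hk t hz ht => by
        cases h
        · exact X2s_mk_glue (Glue.lower F z hz.1 (by simpa using hz.2) ⟨k, hk⟩ t ht)
        · exact X2s_mk_glue (Glue.upper F z hz.1 (by simpa using hz.2) ⟨k, hk⟩ t ht) }
  surj x := by
    induction x using Quot.ind with
    | mk x =>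
      rcases x with x | _
      · induction x using Quotient.ind with
        | _ x =>
          induction x using Quot.ind with
          | mk p =>
            rcases p with ⟨u, _⟩ | ⟨e, t⟩ | ⟨F, z⟩
            · exact Or.inl (X2s_mk_vertex hn u)
            · exact Or.inr (Or.inl ⟨e, t, rfl⟩)
            · exact Or.inr (Or.inr ⟨F, z, rfl⟩)
      · exact Or.inl rfl
  isOpen := isOpen_X2s
  lift h := exists_lift hn h

end FCArrangement

/-! ### The generators and the presentation -/

namespace FCArrangement

open Salvetti TwoComplex

variable {n : ℕ}

lemma lin_inl_one (x : Fin n → ℝ) : lin (Sum.inl 1) x = ∑ i, x i := by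
  rw [lin_inl]
  simp

lemma unit_cast_mul_le (a : ℤˣ) {r : ℝ} (hr : 0 ≤ r) : ((a : ℤ) : ℝ) * r ≤ r := by
  rcases Int.units_eq_one_or a with h | h
  · simp [h]
  · simp only [h, Units.val_neg, Units.val_one, Int.cast_neg, Int.cast_one]
    linarith

lemma lin_inl_le (ε : Mu n) {x : Fin n → ℝ} (hx : ∀ i, 0 ≤ x i) :
    lin (Sum.inl ε) x ≤ ∑ i, x i := by
  rw [lin_inl]
  exact Finset.sum_le_sum fun i _ => unit_cast_mul_le (ε i) (hx i)

lemma lin_inl_lt {ε : Mu n} (hε : ε ≠ 1) {x : Fin n → ℝ} (hx : ∀ i, 0 < x i) :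
    lin (Sum.inl ε) x < ∑ i, x i := by
  rw [lin_inl]
  obtain ⟨i, hi⟩ := Function.ne_iff.1 hε
  refine Finset.sum_lt_sum (fun i _ => unit_cast_mul_le (ε i) (hx i).le) ⟨i, Finset.mem_univ i, ?_⟩
  rw [(Int.units_eq_one_or (ε i)).resolve_left hi]
  simp only [Units.val_neg, Units.val_one, Int.cast_neg, Int.cast_one]
  linarith [hx i]

lemma sg_inr_eq_one {x : Fin n → ℝ} {i : Fin n} : sg x (Sum.inr i) = 1 ↔ 0 < x i := by
  rw [sg_eq_one, ev_inr]

lemma sg_inl_eq_neg_one {x : Fin n → ℝ} {ε : Mu n} :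
    sg x (Sum.inl ε) = -1 ↔ lin (Sum.inl ε) x < 1 := by
  rw [sg_eq_neg_one]
  exact sub_neg

lemma mem_sigma0_iff {x : Fin n → ℝ} :
    x ∈ sigma0 n ↔ sg x = Sum.elim (fun _ => -1) fun _ => 1 := by
  constructor
  · rintro ⟨h1, h2⟩
    funext k
    rcases k with ε | i
    · exact sg_inl_eq_neg_one.2 ((lin_inl_le ε fun i => (h1 i).le).trans_lt h2)
    · exact sg_inr_eq_one.2 (h1 i)
  · intro h
    refine ⟨fun i => sg_inr_eq_one.1 (congrFun h (Sum.inr i)), ?_⟩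
    rw [← lin_inl_one]
    exact sg_inl_eq_neg_one.1 (congrFun h (Sum.inl 1))

lemma mem_tau0_iff {x : Fin n → ℝ} : x ∈ tau0 n ↔
    sg x = Sum.elim (fun ε => open Classical in if ε = 1 then 0 else -1) fun _ => 1 := by
  constructor
  · rintro ⟨h1, h2⟩
    funext k
    rcases k with ε | i
    · by_cases hε : ε = 1
      · rw [Sum.elim_inl, if_pos hε, hε, sg_eq_zero, ev, lin_inl_one, h2]
        exact sub_self 1
      · rw [Sum.elim_inl, if_neg hε]
        exact sg_inl_eq_neg_one.2 ((lin_inl_lt hε h1).trans_eq h2)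
    · exact sg_inr_eq_one.2 (h1 i)
  · intro h
    refine ⟨fun i => sg_inr_eq_one.1 (congrFun h (Sum.inr i)), ?_⟩
    have h1 := congrFun h (Sum.inl 1)
    rw [Sum.elim_inl, if_pos rfl, sg_eq_zero] at h1
    rw [← lin_inl_one]
    exact sub_eq_zero.1 h1

lemma mem_tau_iff {x : Fin n → ℝ} {i : Fin n} : x ∈ tau i ↔
    sg x = Sum.elim (fun _ => -1) fun k => if k = i then 0 else 1 := by
  constructor
  · rintro ⟨h1, h2, h3⟩
    have h0 : ∀ k, 0 ≤ x k := fun k => by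
      by_cases hk : k = i
      · rw [hk, h2]
      · exact (h1 k hk).le
    funext k
    rcases k with ε | k
    · exact sg_inl_eq_neg_one.2 ((lin_inl_le ε h0).trans_lt h3)
    · by_cases hk : k = i
      · rw [Sum.elim_inr, if_pos hk, sg_eq_zero, ev_inr, hk, h2]
      · rw [Sum.elim_inr, if_neg hk]
        exact sg_inr_eq_one.2 (h1 k hk)
  · intro h
    refine ⟨fun k hk => ?_, ?_, ?_⟩
    · have := congrFun h (Sum.inr k)
      rw [Sum.elim_inr, if_neg hk] at this
      exact sg_inr_eq_one.1 this
    · have := congrFun h (Sum.inr i)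
      rwa [Sum.elim_inr, if_pos rfl, sg_eq_zero, ev_inr] at this
    · rw [← lin_inl_one]
      exact sg_inl_eq_neg_one.1 (congrFun h (Sum.inl 1))

lemma Ch.val_eq_of_sgn {c : ℕ} {u : Ch (FC n) c} {s : Idx n → SignType} (h : Ch.sgn u = s)
    {S : Set (Fin n → ℝ)} (hS : ∀ x, x ∈ S ↔ sg x = s) : u.1 = S := by
  ext x
  rw [Ch.mem_iff, h, hS]

lemma sgn_wall_of_sg (hn : 2 ≤ n) {e : Arrow (FC n)} {y : Fin n → ℝ}
    (h : ∀ k, k ≠ idx e → Ch.sgn e.src k = sg y k) (h0 : ev (idx e) y = 0) :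
    Ch.sgn e.wall = sg y := by
  funext k
  by_cases hk : k = idx e
  · rw [(sgn_wall_eq_zero hn e k).2 hk, hk, sg_eq_zero.2 h0]
  · rw [← sgn_src_of_ne hn hk, h k hk]

/-- The arrow into `sigma0` through `tau0`. -/
lemma exists_arrow_tau0 (hn : 2 ≤ n) : ∃ e : Arrow (FC n), e.tgt.1 = sigma0 n ∧ e.wall.1 = tau0 n ∧
    idx e = Sum.inl 1 ∧ IsPos e.src ∧ Ch.sgn e.src (Sum.inl 1) = 1 := by
  have hn0 : (0 : ℝ) < n := by exact_mod_cast (by omega : 0 < n)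
  have hy : (fun _ => (n : ℝ)⁻¹) ∈ tau0 n := by
    refine ⟨fun _ => inv_pos.2 hn0, ?_⟩
    rw [Finset.sum_const, Finset.card_univ, Fintype.card_fin, nsmul_eq_mul, mul_inv_cancel₀ hn0.ne']
  have hs := mem_tau0_iff.1 hy
  set y : Fin n → ℝ := fun _ => (n : ℝ)⁻¹
  have hz : ∀ k, ev k y = 0 ↔ k = Sum.inl 1 := fun k => by
    rw [← sg_eq_zero, hs]
    rcases k with ε | i
    · by_cases hε : ε = 1 <;> simp [hε]
    · simp
  obtain ⟨e, he1, he2, he3⟩ := exists_down hn hz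
  refine ⟨e, ?_, ?_, he1, fun i => ?_, he2⟩
  · refine Ch.val_eq_of_sgn (funext fun k => ?_) fun x => mem_sigma0_iff
    rw [sgn_tgt hn, he1]
    by_cases hk : k = Sum.inl 1
    · rw [hk, flipAt, Function.update_self, he2, Sum.elim_inl]
    · rw [flipAt_of_ne _ hk, he3 k hk, hs]
      rcases k with ε | i
      · have hε : ε ≠ 1 := fun h => hk (by rw [h])
        simp [hε]
      · rfl
  · refine Ch.val_eq_of_sgn ((sgn_wall_of_sg hn (fun k hk => he3 k (by rwa [← he1])) ?_).trans hs)
      fun x => mem_tau0_iff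
    rw [he1, hz]
  · rw [he3 _ (by simp), hs, Sum.elim_inr]

/-- The arrow out of `sigma0` through `tau i`. -/
lemma exists_arrow_tau (hn : 2 ≤ n) (i : Fin n) : ∃ e : Arrow (FC n), e.src.1 = sigma0 n ∧
    e.wall.1 = tau i ∧ idx e = Sum.inr i ∧ IsPos e.src := by
  have hn0 : (0 : ℝ) < n := by exact_mod_cast (by omega : 0 < n)
  have hy : (fun k => if k = i then 0 else (2 * n : ℝ)⁻¹) ∈ tau i := by
    refine ⟨fun k hk => ?_, if_pos rfl, ?_⟩
    · simp only [if_neg hk]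
      positivity
    · have h1 := Finset.sum_le_card_nsmul Finset.univ
        (fun k => if k = i then 0 else (2 * n : ℝ)⁻¹) (2 * n : ℝ)⁻¹ fun k _ => by
          split_ifs
          · positivity
          · exact le_rfl
      refine h1.trans_lt ?_
      rw [Finset.card_univ, Fintype.card_fin, nsmul_eq_mul, mul_inv, mul_left_comm,
        mul_inv_cancel₀ hn0.ne']
      norm_num
  have hs := mem_tau_iff.1 hy
  set y : Fin n → ℝ := fun k => if k = i then 0 else (2 * n : ℝ)⁻¹
  have hz : ∀ k, ev k y = 0 ↔ k = Sum.inr i := fun k => by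
    rw [← sg_eq_zero, hs]
    rcases k with ε | k
    · simp
    · by_cases hk : k = i <;> simp [hk]
  obtain ⟨e, he1, he2, he3⟩ := exists_down hn hz
  have hsrc : Ch.sgn e.src = Sum.elim (fun _ => -1) fun _ => 1 := funext fun k => by
    by_cases hk : k = Sum.inr i
    · rw [hk, he2, Sum.elim_inr]
    · rw [he3 k hk, hs]
      rcases k with ε | k
      · rfl
      · have hki : k ≠ i := fun h => hk (by rw [h])
        simp [hki]
  refine ⟨e, Ch.val_eq_of_sgn hsrc fun x => mem_sigma0_iff, ?_, he1, fun k => by rw [hsrc]; rfl⟩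
  refine Ch.val_eq_of_sgn ((sgn_wall_of_sg hn (fun k hk => he3 k (by rwa [← he1])) ?_).trans hs)
    fun x => mem_tau_iff
  rw [he1, hz]

/-- The classes of the arrows of the 2-complex form a labelling. -/
lemma labelling_loop (hn : 2 ≤ n) :
    Labelling fun e : Arrow (FC n) => op ((realization hn).loop e) where
  smul g e := congrArg op ((realization hn).loop_act g e)
  up e h := by
    rw [(realization hn).loop_triv h]
    rfl
  disc F := (realization hn).prod_word F

lemma isLoopClass_loop (hn : 2 ≤ n) (e : Arrow (FC n)) :
    IsLoopClass e ((realization hn).loop e) := ⟨_, fun _ => rfl, rfl⟩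

lemma lift_of_eq_one {r : FreeGroup (Fin (n + 1))} (hr : Rel n r) :
    FreeGroup.lift (PresentedGroup.of (rels := {r | Rel n r})) r = 1 := by
  have h : FreeGroup.lift (PresentedGroup.of (rels := {r | Rel n r})) =
      PresentedGroup.mk {r | Rel n r} := by
    ext i
    rw [FreeGroup.lift_apply_of]
    rfl
  rw [h]
  exact PresentedGroup.one_of_mem hr

end FCArrangement

end


open FCArrangement TwoComplex MulOpposite in
/-- Multiplication in `FundamentalGroup` is composition in the order of functions; in the opposite
group `a * b` is the class of the loop that runs first through `a` and then through `b`. -/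
theorem mainTheorem2 (n : ℕ) (hn : 2 ≤ n) :
    ∃ γ : Fin (n + 1) → FundamentalGroup (FCArrangement.X2s n) (FCArrangement.X2s.base n),
      FCArrangement.IsStandard γ ∧
      ∃ φ : PresentedGroup {r | FCArrangement.Rel n r} ≃*
          (FundamentalGroup (FCArrangement.X2s n) (FCArrangement.X2s.base n))ᵐᵒᵖ,
        ∀ i, φ (PresentedGroup.of i) = MulOpposite.op (γ i) := by
  let R := realization hn
  obtain ⟨a, ha1, ha2, ha3, ha4, ha5⟩ := exists_arrow_tau0 hn
  choose b hb1 hb2 hb3 hb4 using exists_arrow_tau hn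
  let γ : Fin (n + 1) → FundamentalGroup (X2s n) (X2s.base n) :=
    Fin.cons (R.loop a) fun i => R.loop (b i)
  have hℓ := labelling_loop hn
  let f : PresentedGroup {r | Rel n r} →* (FundamentalGroup (X2s n) (X2s.base n))ᵐᵒᵖ :=
    PresentedGroup.toGroup (f := fun i => op (γ i)) fun r hr =>
      hℓ.rel hn ha3 ha4 ha5 hb3 hb4 rfl (fun _ => rfl) hr
  have hf : ∀ i, f (PresentedGroup.of i) = op (γ i) := fun i => PresentedGroup.toGroup.of _
  have hrel := labelRel_of_rel (γ := PresentedGroup.of (rels := {r | Rel n r}))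
    fun r hr => lift_of_eq_one hr
  obtain ⟨ψ, hψ⟩ := R.exists_hom (label _ _) (fun g e => label_smul _ _ hn g e)
    (fun e he => label_of_isUp _ _ he) (hrel.prod_eq hn)
  -- `ψ` is a left inverse of `f`, as the generators are labelled by themselves
  have hinv : ψ.comp f = MonoidHom.id _ := PresentedGroup.ext fun i => by
    rw [MonoidHom.comp_apply, hf]
    refine Fin.cases ?_ (fun i => ?_) i
    · refine (hψ a).trans ?_
      rw [label, ha3, val_inl, ha5, if_neg (by decide), orth_of_isPos ha4, mul_one, conjWrd,
        wrd_one]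
      simp
    · refine (hψ (b i)).trans ?_
      rw [label, hb3]
      rfl
  have hinj : Function.Injective f :=
    Function.LeftInverse.injective (g := ψ) fun x => DFunLike.congr_fun hinv x
  have htop : f.range.unop = ⊤ := R.eq_top_of_loop_mem _ fun e =>
    hℓ.mem hn ha3 ha4 ha5 hb3 hb4 (P := f.range) ⟨PresentedGroup.of 0, hf 0⟩
      (fun i => ⟨PresentedGroup.of i.succ, hf i.succ⟩) e
  have hsurj : Function.Surjective f := fun x =>
    (htop ▸ Subgroup.mem_top x.unop : x.unop ∈ f.range.unop)
  exact ⟨γ, ⟨⟨a, ha1, ha2, isLoopClass_loop hn a⟩,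
    fun i => ⟨b i, hb1 i, hb2 i, isLoopClass_loop hn (b i)⟩⟩,
    MulEquiv.ofBijective f ⟨hinj, hsurj⟩, hf⟩
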